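/- Let $\omega>2$ and $\kappa$ be real numbers. Costs are counted in the algebraic RAM model over a field $K$: each operation $+,-,\times,/$ in $K$ and each zero test of an element of $K$ costs $1$; integer operations and memory accesses are free. Suppose that $N\times N$ matrices over $K$ can be multiplied by an algebraic RAM program with at most $\kappa N^{\omega}$ operations, for all $N\ge 1$. Consider the following problem. The input consists of an order $d=(d_1,\dots,d_n)\in\mathbb{Z}_{>0}^n$, a matrix $F\in K[x]^{m\times n}$ whose $j$-th column has degree less than $d_j$, a shift $s\in\mathbb{Z}^m$, a matrix $P\in K[x]^{m\times m}$ and a matrix $C\in K^{m\times n}$, where $m,n\ge 1$. Put $x^{\pm d}=\operatorname{diag}(x^{\pm d_1},\dots,x^{\pm d_n})$, $\sigma=d_1+\cdots+d_n$, $\operatorname{size}(P)=m^2+\sum_{i,j}\max(0,\deg P_{ij})$, and $$\mathcal A_d(F)=\{p\in K[x]^{1\times m} : pF=q\,x^{d}\text{ for some }q\in K[x]^{1\times n}\}.$$ The answer is True if $P$ is an $s$-minimal basis of $\mathcal A_d(F)$ and $C$ is the coefficient of degree $0$ of $PFx^{-d}$; otherwise it is False. Here $P$ is an $s$-minimal basis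 of $\mathcal A_d(F)$ if its rows form a basis of this $K[x]$-module and $P$ is $s$-reduced, that is, the $s$-leading matrix of $P$ in $K^{m\times m}$ is invertible; the entry $(i,j)$ of the latter is the coefficient of $P_{ij}$ of degree $r_i-s_j$, where $r_i=\max_j(\deg P_{ij}+s_j)$ (with $\deg 0=-\infty$; if row $i$ of $P$ is zero, row $i$ of the $s$-leading matrix is zero). Then there is a Monte Carlo algorithm (one algebraic RAM program over $K$ for all $m$, $n$ and all inputs) for this problem which draws $m+2$ elements uniformly and independently at random from a finite subset $S\subset K$, always halts with an answer True or False, and has the following properties. 1. For every constant $c$, on all inputs with $\operatorname{size}(P)\le c\,m\sigma$ it uses $O(m\sigma+m^{\omega-1}(m+n))$ operations in $K$, whatever elements are drawn; the constant in the $O(\cdot)$ depends only on $\omega$, $\kappa$ and $c$. 2. An answer False is always correct. 3. If $\#S\ge 2(\sigma+1)$, then on every input for which the correct answer is False, the algorithm answers True with probability less than $1/2$. -/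

import Mathlib

open Polynomial

noncomputable section

/-! ### The algebraic random access machine over a field

The machine has integer variables, an integer memory and a memory of field elements.  Both memories
are addressed by tuples of integers (multi-dimensional arrays).  Integer operations, addressing,
copying and loading constants are free; every arithmetic operation in the field and every zero test
of a field element costs one.  A program is a finite piece of syntax. -/

namespace AlgRAM

/-- Integer expressions over the integer variables. -/
inductive IExp : Type
  | const (z : ℤ)
  | var (v : ℕ)
  | add (e e' : IExp)
  | sub (e e' : IExp)
  | mul (e e' : IExp)
  | div (e e' : IExp)
  | mod (e e' : IExp)

/-- The value of an integer expression. -/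
def IExp.eval (ρ : ℕ → ℤ) : IExp → ℤ
  | .const z => z
  | .var v => ρ v
  | .add e e' => e.eval ρ + e'.eval ρ
  | .sub e e' => e.eval ρ - e'.eval ρ
  | .mul e e' => e.eval ρ * e'.eval ρ
  | .div e e' => e.eval ρ / e'.eval ρ
  | .mod e e' => e.eval ρ % e'.eval ρ

/-- The four field operations. -/
inductive Op : Type
  | add
  | sub
  | mul
  | div

/-- The value of a field operation. -/
def Op.eval {K : Type*} [Field K] : Op → K → K → K
  | .add, x, y => x + y
  | .sub, x, y => x - y
  | .mul, x, y => x * y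
  | .div, x, y => x / y

/-- Programs.  An address is a list of integer expressions. -/
inductive Cmd (K : Type*) : Type _
  /-- do nothing -/
  | skip
  /-- run two programs one after the other -/
  | seq (p q : Cmd K)
  /-- integer variable `v := e` -/
  | setVar (v : ℕ) (e : IExp)
  /-- integer variable `v := int[a]` -/
  | loadInt (v : ℕ) (a : List IExp)
  /-- integer memory `int[a] := e` -/
  | storeInt (a : List IExp) (e : IExp)
  /-- field memory `fld[a] := c` -/
  | setConst (a : List IExp) (c : K)
  /-- field memory `fld[a] := fld[b]` -/
  | copy (a b : List IExp)
  /-- field memory `fld[a] := fld[b] o fld[c]`, at cost one -/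
  | arith (o : Op) (a b c : List IExp)
  /-- branch on `0 < e` -/
  | ifPos (e : IExp) (p q : Cmd K)
  /-- branch on `fld[a] = 0`, at cost one -/
  | ifZero (a : List IExp) (p q : Cmd K)
  /-- repeat as long as `0 < e` -/
  | whilePos (e : IExp) (p : Cmd K)

/-- A state of the machine. -/
structure State (K : Type*) where
  var : ℕ → ℤ
  int : List ℤ → ℤ
  fld : List ℤ → K

/-- The value of an address. -/
def State.addr {K : Type*} (σ : State K) (a : List IExp) : List ℤ :=
  a.map (IExp.eval σ.var)

/-- `Exec p σ σ' t`: started in the state `σ`, the program `p` halts in the state `σ'` after `t`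
field operations.  A division by zero has no successor state. -/
inductive Exec {K : Type*} [Field K] : Cmd K → State K → State K → ℕ → Prop
  | skip (σ : State K) : Exec .skip σ σ 0
  | seq {p q : Cmd K} {σ σ' σ'' : State K} {t t' : ℕ} :
      Exec p σ σ' t → Exec q σ' σ'' t' → Exec (.seq p q) σ σ'' (t + t')
  | setVar (v : ℕ) (e : IExp) (σ : State K) :
      Exec (.setVar v e) σ { σ with var := Function.update σ.var v (e.eval σ.var) } 0
  | loadInt (v : ℕ) (a : List IExp) (σ : State K) :
      Exec (.loadInt v a) σ { σ with var := Function.update σ.var v (σ.int (σ.addr a)) } 0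
  | storeInt (a : List IExp) (e : IExp) (σ : State K) :
      Exec (.storeInt a e) σ
        { σ with int := Function.update σ.int (σ.addr a) (e.eval σ.var) } 0
  | setConst (a : List IExp) (c : K) (σ : State K) :
      Exec (.setConst a c) σ { σ with fld := Function.update σ.fld (σ.addr a) c } 0
  | copy (a b : List IExp) (σ : State K) :
      Exec (.copy a b) σ { σ with fld := Function.update σ.fld (σ.addr a) (σ.fld (σ.addr b)) } 0
  | arith (o : Op) (a b c : List IExp) (σ : State K) :
      (o = .div → σ.fld (σ.addr c) ≠ 0) →
      Exec (.arith o a b c) σ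
        { σ with fld := Function.update σ.fld (σ.addr a)
                    (o.eval (σ.fld (σ.addr b)) (σ.fld (σ.addr c))) } 1
  | ifPos_pos {e : IExp} {p q : Cmd K} {σ σ' : State K} {t : ℕ} :
      0 < e.eval σ.var → Exec p σ σ' t → Exec (.ifPos e p q) σ σ' t
  | ifPos_neg {e : IExp} {p q : Cmd K} {σ σ' : State K} {t : ℕ} :
      ¬ 0 < e.eval σ.var → Exec q σ σ' t → Exec (.ifPos e p q) σ σ' t
  | ifZero_pos {a : List IExp} {p q : Cmd K} {σ σ' : State K} {t : ℕ} :
      σ.fld (σ.addr a) = 0 → Exec p σ σ' t → Exec (.ifZero a p q) σ σ' (t + 1)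
  | ifZero_neg {a : List IExp} {p q : Cmd K} {σ σ' : State K} {t : ℕ} :
      σ.fld (σ.addr a) ≠ 0 → Exec q σ σ' t → Exec (.ifZero a p q) σ σ' (t + 1)
  | while_pos {e : IExp} {p : Cmd K} {σ σ' σ'' : State K} {t t' : ℕ} :
      0 < e.eval σ.var → Exec p σ σ' t → Exec (.whilePos e p) σ' σ'' t' →
      Exec (.whilePos e p) σ σ'' (t + t')
  | while_neg {e : IExp} {p : Cmd K} {σ : State K} :
      ¬ 0 < e.eval σ.var → Exec (.whilePos e p) σ σ 0

/-- A finite sequence laid out in memory: the cell `z` holds `f z` if `0 ≤ z < N`, otherwise `0`. -/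
def cells {α : Type*} [Zero α] {N : ℕ} (f : Fin N → α) (z : ℤ) : α :=
  if h : 0 ≤ z ∧ z < N then f ⟨z.toNat, by omega⟩ else 0

/-- The initial state for a matrix multiplication: `N` is in variable `0`, the factors are
`fld[0, i, j]` and `fld[1, i, j]`; everything else is zero. -/
def mulInit {K : Type*} [Field K] {N : ℕ} (A B : Matrix (Fin N) (Fin N) K) : State K where
  var v := if v = 0 then N else 0
  int _ := 0
  fld
    | [0, i, j] => cells (fun i => cells (A i) j) i
    | [1, i, j] => cells (fun i => cells (B i) j) i
    | _ => 0

/-- Two `N × N` matrices over `K` can be multiplied with at most `κ * N ^ ω` field operations: some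
program leaves the entries of the product in `fld[2, i, j]`. -/
def MatMulWithin (K : Type*) [Field K] (ω κ : ℝ) : Prop :=
  ∃ mm : Cmd K, ∀ N : ℕ, 0 < N → ∀ A B : Matrix (Fin N) (Fin N) K,
    ∃ (σ : State K) (t : ℕ), Exec mm (mulInit A B) σ t ∧ (t : ℝ) ≤ κ * (N : ℝ) ^ ω ∧
      ∀ i j : Fin N, σ.fld [2, (i : ℤ), (j : ℤ)] = (A * B) i j

end AlgRAM

/-! ### Minimal approximant bases -/

section Approximants

variable {K : Type*} [Field K] {m n : ℕ}

/-- The module of approximants: row vectors `p` with `p F = q X^d` for some polynomial row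
vector `q`, where `X^d` is the diagonal matrix of the `X ^ d j`. -/
def approximants (d : Fin n → ℕ) (F : Matrix (Fin m) (Fin n) K[X]) :
    Submodule K[X] (Fin m → K[X]) where
  carrier := {p | ∃ q : Fin n → K[X],
    Matrix.vecMul p F = Matrix.vecMul q (Matrix.diagonal fun j => (X : K[X]) ^ d j)}
  add_mem' := by
    rintro p p' ⟨q, hq⟩ ⟨q', hq'⟩
    exact ⟨q + q', by rw [Matrix.add_vecMul, Matrix.add_vecMul, hq, hq']⟩
  zero_mem' := ⟨0, by simp⟩
  smul_mem' := by
    rintro c p ⟨q, hq⟩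
    exact ⟨c • q, by rw [Matrix.smul_vecMul, Matrix.smul_vecMul, hq]⟩

/-- The rows of `P` form a basis of the submodule `M`. -/
def IsRowBasis (P : Matrix (Fin m) (Fin m) K[X]) (M : Submodule K[X] (Fin m → K[X])) : Prop :=
  LinearIndependent K[X] (fun i => P i) ∧ Submodule.span K[X] (Set.range fun i => P i) = M

/-- The `s`-degree of row `i`: the maximum of `deg (P i j) + s j`, where `deg 0 = -∞`. -/
def shiftedRowDegree (s : Fin m → ℤ) (P : Matrix (Fin m) (Fin m) K[X]) (i : Fin m) :
    WithBot ℤ :=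
  Finset.univ.sup fun j => (P i j).degree.map fun k : ℕ => (k : ℤ) + s j

/-- The `s`-leading matrix: its entry `i, j` is the coefficient of `P i j` of degree
`r - s j`, where `r` is the `s`-degree of row `i`; it is `0` if that degree is negative or `-∞`. -/
def leadingMatrix (s : Fin m → ℤ) (P : Matrix (Fin m) (Fin m) K[X]) : Matrix (Fin m) (Fin m) K :=
  fun i j =>
    match shiftedRowDegree s P i with
    | ⊥ => 0
    | (r : ℤ) => if 0 ≤ r - s j then (P i j).coeff (r - s j).toNat else 0

/-- `P` is `s`-reduced. -/
def IsShiftReduced (s : Fin m → ℤ) (P : Matrix (Fin m) (Fin m) K[X]) : Prop :=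
  IsUnit (leadingMatrix s P)

/-- `P` is an `s`-minimal basis of the approximant module of `F` at order `d`. -/
def IsMinimalApproximantBasis (d : Fin n → ℕ) (F : Matrix (Fin m) (Fin n) K[X])
    (s : Fin m → ℤ) (P : Matrix (Fin m) (Fin m) K[X]) : Prop :=
  IsRowBasis P (approximants d F) ∧ IsShiftReduced s P

/-- The number of field elements in the dense representation of `P`. -/
def matrixSize (P : Matrix (Fin m) (Fin m) K[X]) : ℕ :=
  m ^ 2 + ∑ i, ∑ j, (P i j).natDegree

end Approximants

/-- An instance of the certification problem. -/
structure CertInstance (K : Type*) [Field K] (m n : ℕ) where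
  /-- the order -/
  d : Fin n → ℕ
  d_pos : ∀ j, 0 < d j
  /-- the system -/
  F : Matrix (Fin m) (Fin n) K[X]
  F_deg : ∀ i j, (F i j).degree < d j
  /-- the shift -/
  s : Fin m → ℤ
  /-- the claimed basis -/
  P : Matrix (Fin m) (Fin m) K[X]
  /-- the certificate -/
  C : Matrix (Fin m) (Fin n) K

namespace CertInstance

variable {K : Type*} [Field K] {m n : ℕ}

/-- The sum of the order. -/
def sigma (I : CertInstance K m n) : ℕ := ∑ j, I.d j

/-- The answer should be True: `P` is an `s`-minimal basis, and `C` is the coefficient of degree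
`0` of `P F X^(-d)`, that is, its column `j` is the coefficient of degree `d j` of column `j` of
`P F`. -/
def IsYes (I : CertInstance K m n) : Prop :=
  IsMinimalApproximantBasis I.d I.F I.s I.P ∧ ∀ i j, I.C i j = ((I.P * I.F) i j).coeff (I.d j)

/-- The initial state for an instance and the random elements `r`.
Variables `0` and `1` hold `m` and `n`; the integer memory holds `d`, `s` and the degrees of the
entries of `P`; the field memory holds the coefficients of the entries of `P` up to the degree, those
of column `j` of `F` below `d j`, then `C` and `r`.  Everything else is zero. -/
def init (I : CertInstance K m n) (r : Fin (m + 2) → K) : AlgRAM.State K where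
  var v := if v = 0 then m else if v = 1 then n else 0
  int
    | [0, j] => AlgRAM.cells (fun j => (I.d j : ℤ)) j
    | [1, i] => AlgRAM.cells I.s i
    | [2, i, j] => AlgRAM.cells (fun i => AlgRAM.cells (fun j => ((I.P i j).natDegree : ℤ)) j) i
    | _ => 0
  fld
    | [0, i, j, k] =>
        AlgRAM.cells (fun i => AlgRAM.cells (fun j =>
          AlgRAM.cells (fun k : Fin ((I.P i j).natDegree + 1) => (I.P i j).coeff k) k) j) i
    | [1, i, j, k] =>
        AlgRAM.cells (fun i => AlgRAM.cells (fun j =>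
          AlgRAM.cells (fun k : Fin (I.d j) => (I.F i j).coeff k) k) j) i
    | [2, i, j] => AlgRAM.cells (fun i => AlgRAM.cells (I.C i) j) i
    | [3, i] => AlgRAM.cells r i
    | _ => 0

/-- On the instance `I` and the random elements `r`, the program halts after `t` field operations
and answers `b`: it leaves `1` for True and `0` for False in variable `0`. -/
def Answers (prog : AlgRAM.Cmd K) (I : CertInstance K m n) (r : Fin (m + 2) → K) (b : Bool)
    (t : ℕ) : Prop :=
  ∃ σ : AlgRAM.State K, AlgRAM.Exec prog (I.init r) σ t ∧ σ.var 0 = if b then 1 else 0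

end CertInstance

open Classical in
/-- The probability of the event `E` for `N` elements drawn uniformly and independently from the
finite set `S`. -/
def uniformProb {K : Type*} (S : Finset K) (N : ℕ) (E : (Fin N → K) → Prop) : ℝ :=
  (((Fintype.piFinset fun _ : Fin N => S).filter E).card : ℝ) / (S.card : ℝ) ^ N

end

open Polynomial

noncomputable section

set_option linter.unusedSectionVars false

namespace AlgRAM

variable {K : Type*} [Field K]

/-! ### Weakest preconditions -/

/-! Write L for the `s`-leading matrix of P and Δ for the sum of the r_i - s_i, where r_i are the
shifted row degrees. The answer True is equivalent to three conditions (`isYes_iff`): (a) column j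
of P F agrees with C X^(d j) in all degrees up to d j; (b) Δ ≤ σ, det L ≠ 0 and det P = det L · X^Δ;
(c) the constant matrix [P(0) C] has trivial left kernel.

Necessity of (b): the module contains m vectors with determinant X^k for some k ≤ σ
(`exists_approximants_det`), so the determinant of a basis divides X^k; and the coefficient of X^Δ
in det P is det L if this is not zero (`coeff_det`), which fixes exponent and constant. Necessity of
(c): if v kills P(0) and C, then v P = X p with p again an approximant, so p = w P, v = X w and v =
0. Sufficiency: (a) puts the rows of P into the module. By (b) and the adjugate, X^Δ p is a
combination of the rows of P for every p. If X^(k+1) p = w P with p an approximant, then w(0) kills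
P(0) and, by (a), also C; by (c) w is divisible by X, and one factor X cancels
(`mem_span_of_pow_smul`).

Condition (c) is tested exactly. Condition (b) is tested at one random point; both sides have degree
at most σ. For (a), the rows of P are combined by m random elements, and for each column the product
with F, truncated after degree d j, is evaluated at one more random point. A nonzero defect survives
the combination except for one value of some coefficient, and then gives a nonzero polynomial of
degree at most d j. True instances pass every test. A false one violates at least one condition and
passes with probability less than (σ + 1) / #S (`card_passes_lt`).

Combining and evaluating P costs O(size P). By accumulated sums the truncated products are evaluated
in O(m (σ + n)) operations (`sum_range_mul_sum_range`). Determinants and left kernels come from a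
Gaussian elimination of matrices padded to size W = 2^l < 2m. It works column by column, but delays
updates and applies blocks of 2^k columns by matrix multiplication; since ω > 2 the costs of the
levels are dominated by a geometric series and sum to O(m^ω) (`blockCost_le`). For (c), [P(0) C] is
cut into n / W + 2 square blocks, and the left kernel shrinks from block to block.

The programs are verified by weakest preconditions with cost, an invariant rule for counted loops
(`wp_forLoop`) and frames read off from the syntax (`Exec.frame`). The given multiplication program
is only specified on a memory that is otherwise zero, so each call runs a relocated copy in an
unused part of the memory (`Exec.reloc`, `wp_mulCall`). -/

/-- The program halts when started in `σ`, and its final state and cost satisfy `Q`. -/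
def wp (p : Cmd K) (Q : State K → ℕ → Prop) (σ : State K) : Prop :=
  ∃ σ' t, Exec p σ σ' t ∧ Q σ' t

theorem wp.mono {p : Cmd K} {Q R : State K → ℕ → Prop} {σ : State K} (h : wp p Q σ)
    (hQ : ∀ σ' t, Q σ' t → R σ' t) : wp p R σ := by
  obtain ⟨σ', t, he, hq⟩ := h
  exact ⟨σ', t, he, hQ _ _ hq⟩

theorem wp_skip (Q : State K → ℕ → Prop) (σ : State K) : wp .skip Q σ ↔ Q σ 0 := by
  constructor
  · rintro ⟨_, _, ⟨⟩, h⟩; exact h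
  · exact fun h => ⟨_, _, .skip σ, h⟩

theorem wp_seq (p q : Cmd K) (Q : State K → ℕ → Prop) (σ : State K) :
    wp (.seq p q) Q σ ↔ wp p (fun σ' t => wp q (fun σ'' t' => Q σ'' (t + t')) σ') σ := by
  constructor
  · rintro ⟨_, _, h', h⟩
    cases h' with
    | seq h₁ h₂ => exact ⟨_, _, h₁, _, _, h₂, h⟩
  · rintro ⟨_, _, h₁, _, _, h₂, h⟩; exact ⟨_, _, .seq h₁ h₂, h⟩

theorem wp_setVar (v : ℕ) (e : IExp) (Q : State K → ℕ → Prop) (σ : State K) :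
    wp (.setVar v e) Q σ ↔ Q { σ with var := Function.update σ.var v (e.eval σ.var) } 0 := by
  constructor
  · rintro ⟨_, _, ⟨⟩, h⟩; exact h
  · exact fun h => ⟨_, _, .setVar v e σ, h⟩

theorem wp_loadInt (v : ℕ) (a : List IExp) (Q : State K → ℕ → Prop) (σ : State K) :
    wp (.loadInt v a) Q σ ↔
      Q { σ with var := Function.update σ.var v (σ.int (σ.addr a)) } 0 := by
  constructor
  · rintro ⟨_, _, ⟨⟩, h⟩; exact h
  · exact fun h => ⟨_, _, .loadInt v a σ, h⟩

theorem wp_storeInt (a : List IExp) (e : IExp) (Q : State K → ℕ → Prop) (σ : State K) :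
    wp (.storeInt a e) Q σ ↔
      Q { σ with int := Function.update σ.int (σ.addr a) (e.eval σ.var) } 0 := by
  constructor
  · rintro ⟨_, _, ⟨⟩, h⟩; exact h
  · exact fun h => ⟨_, _, .storeInt a e σ, h⟩

theorem wp_setConst (a : List IExp) (c : K) (Q : State K → ℕ → Prop) (σ : State K) :
    wp (.setConst a c) Q σ ↔ Q { σ with fld := Function.update σ.fld (σ.addr a) c } 0 := by
  constructor
  · rintro ⟨_, _, ⟨⟩, h⟩; exact h
  · exact fun h => ⟨_, _, .setConst a c σ, h⟩

theorem wp_copy (a b : List IExp) (Q : State K → ℕ → Prop) (σ : State K) :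
    wp (.copy a b) Q σ ↔
      Q { σ with fld := Function.update σ.fld (σ.addr a) (σ.fld (σ.addr b)) } 0 := by
  constructor
  · rintro ⟨_, _, ⟨⟩, h⟩; exact h
  · exact fun h => ⟨_, _, .copy a b σ, h⟩

theorem wp_arith (o : Op) (a b c : List IExp) (Q : State K → ℕ → Prop) (σ : State K) :
    wp (.arith o a b c) Q σ ↔ (o = .div → σ.fld (σ.addr c) ≠ 0) ∧
      Q { σ with fld := Function.update σ.fld (σ.addr a)
                    (o.eval (σ.fld (σ.addr b)) (σ.fld (σ.addr c))) } 1 := by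
  constructor
  · rintro ⟨_, _, ⟨⟩, h⟩; exact ⟨by assumption, h⟩
  · exact fun h => ⟨_, _, .arith o a b c σ h.1, h.2⟩

theorem wp_ifPos (e : IExp) (p q : Cmd K) (Q : State K → ℕ → Prop) (σ : State K) :
    wp (.ifPos e p q) Q σ ↔ if 0 < e.eval σ.var then wp p Q σ else wp q Q σ := by
  constructor
  · rintro ⟨_, _, h', hq⟩
    cases h' with
    | ifPos_pos h h' => rw [if_pos h]; exact ⟨_, _, h', hq⟩
    | ifPos_neg h h' => rw [if_neg h]; exact ⟨_, _, h', hq⟩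
  · split_ifs with h
    · rintro ⟨_, _, h', hq⟩; exact ⟨_, _, .ifPos_pos h h', hq⟩
    · rintro ⟨_, _, h', hq⟩; exact ⟨_, _, .ifPos_neg h h', hq⟩

open Classical in
theorem wp_ifZero (a : List IExp) (p q : Cmd K) (Q : State K → ℕ → Prop) (σ : State K) :
    wp (.ifZero a p q) Q σ ↔ if σ.fld (σ.addr a) = 0 then wp p (fun σ' t => Q σ' (t + 1)) σ
      else wp q (fun σ' t => Q σ' (t + 1)) σ := by
  constructor
  · rintro ⟨_, _, h', hq⟩
    cases h' with
    | ifZero_pos h h' => rw [if_pos h]; exact ⟨_, _, h', hq⟩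
    | ifZero_neg h h' => rw [if_neg h]; exact ⟨_, _, h', hq⟩
  · split_ifs with h
    · rintro ⟨_, _, h', hq⟩; exact ⟨_, _, .ifZero_pos h h', hq⟩
    · rintro ⟨_, _, h', hq⟩; exact ⟨_, _, .ifZero_neg h h', hq⟩

theorem wp_while_pos {e : IExp} {p : Cmd K} {Q : State K → ℕ → Prop} {σ : State K}
    (h : 0 < e.eval σ.var)
    (hp : wp p (fun σ' t => wp (.whilePos e p) (fun σ'' t' => Q σ'' (t + t')) σ') σ) :
    wp (.whilePos e p) Q σ := by
  obtain ⟨_, _, h₁, _, _, h₂, hQ⟩ := hp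
  exact ⟨_, _, .while_pos h h₁ h₂, hQ⟩

theorem wp_while_neg {e : IExp} {p : Cmd K} {Q : State K → ℕ → Prop} {σ : State K}
    (h : ¬ 0 < e.eval σ.var) (hQ : Q σ 0) : wp (.whilePos e p) Q σ :=
  ⟨_, _, .while_neg h, hQ⟩

/-- The machine is deterministic. -/
theorem Exec.det {p : Cmd K} {σ σ₁ : State K} {t₁ : ℕ} (h₁ : Exec p σ σ₁ t₁) :
    ∀ {σ₂ : State K} {t₂ : ℕ}, Exec p σ σ₂ t₂ → σ₁ = σ₂ ∧ t₁ = t₂ := by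
  induction h₁ with
  | skip | setVar | loadInt | storeInt | setConst | copy => rintro _ _ ⟨⟩; exact ⟨rfl, rfl⟩
  | arith => rintro _ _ ⟨⟩; exact ⟨rfl, rfl⟩
  | seq _ _ ih ih' =>
    intro _ _ h₂
    cases h₂ with
    | seq h h' =>
      obtain ⟨rfl, rfl⟩ := ih h
      obtain ⟨rfl, rfl⟩ := ih' h'
      exact ⟨rfl, rfl⟩
  | ifPos_pos hc _ ih =>
    intro _ _ h₂
    cases h₂ with
    | ifPos_pos _ h => exact ih h
    | ifPos_neg h _ => exact absurd hc h
  | ifPos_neg hc _ ih =>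
    intro _ _ h₂
    cases h₂ with
    | ifPos_pos h _ => exact absurd h hc
    | ifPos_neg _ h => exact ih h
  | ifZero_pos hc _ ih =>
    intro _ _ h₂
    cases h₂ with
    | ifZero_pos _ h => obtain ⟨rfl, rfl⟩ := ih h; exact ⟨rfl, rfl⟩
    | ifZero_neg h _ => exact absurd hc h
  | ifZero_neg hc _ ih =>
    intro _ _ h₂
    cases h₂ with
    | ifZero_pos h _ => exact absurd h hc
    | ifZero_neg _ h => obtain ⟨rfl, rfl⟩ := ih h; exact ⟨rfl, rfl⟩
  | while_pos hc _ _ ih ih' =>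
    intro _ _ h₂
    cases h₂ with
    | while_pos _ h h' =>
      obtain ⟨rfl, rfl⟩ := ih h
      obtain ⟨rfl, rfl⟩ := ih' h'
      exact ⟨rfl, rfl⟩
    | while_neg h => exact absurd hc h
  | while_neg hc =>
    intro _ _ h₂
    cases h₂ with
    | while_pos h _ _ => exact absurd h hc
    | while_neg _ => exact ⟨rfl, rfl⟩

/-! ### Syntactic frames -/

/-- The address begins with a constant different from `z`. -/
@[simp] def avoids (z : ℤ) : List IExp → Bool
  | .const y :: _ => decide (y ≠ z)
  | _ => false

/-- The program does not assign the integer variable `v`. -/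
@[simp] def Cmd.keepsVar (v : ℕ) : Cmd K → Bool
  | .seq p q => p.keepsVar v && q.keepsVar v
  | .setVar w _ => decide (w ≠ v)
  | .loadInt w _ => decide (w ≠ v)
  | .ifPos _ p q => p.keepsVar v && q.keepsVar v
  | .ifZero _ p q => p.keepsVar v && q.keepsVar v
  | .whilePos _ p => p.keepsVar v
  | _ => true

/-- The program does not store into the integer array `z`. -/
@[simp] def Cmd.keepsInt (z : ℤ) : Cmd K → Bool
  | .seq p q => p.keepsInt z && q.keepsInt z
  | .storeInt a _ => avoids z a
  | .ifPos _ p q => p.keepsInt z && q.keepsInt z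
  | .ifZero _ p q => p.keepsInt z && q.keepsInt z
  | .whilePos _ p => p.keepsInt z
  | _ => true

/-- The program does not store into the field array `z`. -/
@[simp] def Cmd.keepsFld (z : ℤ) : Cmd K → Bool
  | .seq p q => p.keepsFld z && q.keepsFld z
  | .setConst a _ => avoids z a
  | .copy a _ => avoids z a
  | .arith _ a _ _ => avoids z a
  | .ifPos _ p q => p.keepsFld z && q.keepsFld z
  | .ifZero _ p q => p.keepsFld z && q.keepsFld z
  | .whilePos _ p => p.keepsFld z
  | _ => true

/-- `σ'` agrees with `σ` wherever the syntax of `p` shows that `p` does not write. -/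
structure Frame (p : Cmd K) (σ σ' : State K) : Prop where
  var : ∀ v, p.keepsVar v = true → σ'.var v = σ.var v
  int : ∀ z, p.keepsInt z = true → ∀ a, σ'.int (z :: a) = σ.int (z :: a)
  fld : ∀ z, p.keepsFld z = true → ∀ a, σ'.fld (z :: a) = σ.fld (z :: a)

theorem Frame.refl (p : Cmd K) (σ : State K) : Frame p σ σ :=
  ⟨fun _ _ => rfl, fun _ _ _ => rfl, fun _ _ _ => rfl⟩

theorem Frame.trans {p : Cmd K} {σ σ' σ'' : State K} (h : Frame p σ σ') (h' : Frame p σ' σ'') :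
    Frame p σ σ'' :=
  ⟨fun v hv => (h'.var v hv).trans (h.var v hv), fun z hz a => (h'.int z hz a).trans (h.int z hz a),
    fun z hz a => (h'.fld z hz a).trans (h.fld z hz a)⟩

theorem Frame.weaken {p q : Cmd K} {σ σ' : State K} (h : Frame p σ σ')
    (hv : ∀ v, q.keepsVar v = true → p.keepsVar v = true)
    (hi : ∀ z, q.keepsInt z = true → p.keepsInt z = true)
    (hf : ∀ z, q.keepsFld z = true → p.keepsFld z = true) : Frame q σ σ' :=
  ⟨fun v hq => h.var v (hv v hq), fun z hq => h.int z (hi z hq), fun z hq => h.fld z (hf z hq)⟩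

theorem addr_ne_of_avoids {z : ℤ} {a : List IExp} (h : avoids z a = true) (σ : State K)
    (b : List ℤ) : z :: b ≠ σ.addr a := by
  match a, h with
  | .const y :: l, h =>
    simp only [avoids, decide_eq_true_eq] at h
    intro h'
    simp only [State.addr, List.map_cons, IExp.eval, List.cons.injEq] at h'
    exact h h'.1.symm

/-- An address whose first component is a constant can only touch the array of that number, so the
syntax alone bounds what a program writes. Later specifications therefore list only the cells that
change, and `simp` settles the rest. -/
theorem Exec.frame {p : Cmd K} {σ σ' : State K} {t : ℕ} (h : Exec p σ σ' t) : Frame p σ σ' := by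
  induction h with
  | skip => exact Frame.refl _ _
  | setVar v e σ | loadInt v e σ =>
    refine ⟨fun w hw => ?_, fun _ _ _ => rfl, fun _ _ _ => rfl⟩
    simp only [Cmd.keepsVar, decide_eq_true_eq] at hw
    exact Function.update_of_ne (Ne.symm hw) _ _
  | storeInt a e σ =>
    exact ⟨fun _ _ => rfl, fun z hz b => Function.update_of_ne (addr_ne_of_avoids hz σ b) _ _,
      fun _ _ _ => rfl⟩
  | setConst a e σ | copy a _ σ =>
    exact ⟨fun _ _ => rfl, fun _ _ _ => rfl,
      fun z hz b => Function.update_of_ne (addr_ne_of_avoids hz σ b) _ _⟩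
  | arith o a b c σ _ =>
    exact ⟨fun _ _ => rfl, fun _ _ _ => rfl,
      fun z hz b => Function.update_of_ne (addr_ne_of_avoids hz σ b) _ _⟩
  | seq _ _ ih ih' =>
    refine Frame.trans (ih.weaken ?_ ?_ ?_) (ih'.weaken ?_ ?_ ?_) <;>
      simp +contextual [Cmd.keepsVar, Cmd.keepsInt, Cmd.keepsFld]
  | ifPos_pos _ _ ih | ifPos_neg _ _ ih | ifZero_pos _ _ ih | ifZero_neg _ _ ih =>
    refine ih.weaken ?_ ?_ ?_ <;>
      simp +contextual [Cmd.keepsVar, Cmd.keepsInt, Cmd.keepsFld]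
  | while_pos _ _ _ ih ih' =>
    refine Frame.trans (ih.weaken ?_ ?_ ?_) ih' <;>
      simp +contextual [Cmd.keepsVar, Cmd.keepsInt, Cmd.keepsFld]
  | while_neg => exact Frame.refl _ _

theorem wp.framed {p : Cmd K} {Q : State K → ℕ → Prop} {σ : State K} (h : wp p Q σ) :
    wp p (fun σ' t => Q σ' t ∧ Frame p σ σ') σ := by
  obtain ⟨σ', t, he, hq⟩ := h
  exact ⟨σ', t, he, hq, he.frame⟩

/-- Run `p`, of which only a specification and the frame are used, and then `q`. -/
theorem wp_seq_of {p q : Cmd K} {R Q : State K → ℕ → Prop} {σ : State K} (h : wp p R σ)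
    (h' : ∀ σ' t, R σ' t → Frame p σ σ' → wp q (fun σ'' t' => Q σ'' (t + t')) σ') :
    wp (.seq p q) Q σ :=
  (wp_seq p q Q σ).2 (h.framed.mono fun σ' t hr => h' σ' t hr.1 hr.2)

/-! ### Counted loops -/

/-- `for v = 0, …, e - 1 do body` -/
def forLoop (v : ℕ) (e : IExp) (body : Cmd K) : Cmd K :=
  .seq (.setVar v (.const 0))
    (.whilePos (.sub e (.var v)) (.seq body (.setVar v (.add (.var v) (.const 1)))))

@[simp] theorem keepsVar_forLoop (w v : ℕ) (e : IExp) (p : Cmd K) :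
    (forLoop v e p).keepsVar w = (decide (v ≠ w) && p.keepsVar w) := by
  simp only [forLoop, Cmd.keepsVar]
  cases decide (v ≠ w) <;> simp

@[simp] theorem keepsInt_forLoop (z : ℤ) (v : ℕ) (e : IExp) (p : Cmd K) :
    (forLoop v e p).keepsInt z = p.keepsInt z := by
  simp [forLoop, Cmd.keepsInt]

@[simp] theorem keepsFld_forLoop (z : ℤ) (v : ℕ) (e : IExp) (p : Cmd K) :
    (forLoop v e p).keepsFld z = p.keepsFld z := by
  simp [forLoop, Cmd.keepsFld]

/-- The entry `i, j` of the array `T` of field elements. -/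
def State.arr (σ : State K) (T : ℤ) (i j : ℕ) : K := σ.fld [T, (i : ℤ), (j : ℤ)]

/-- The state after an assignment of an integer variable. -/
def State.setVar (σ : State K) (v : ℕ) (z : ℤ) : State K :=
  { σ with var := Function.update σ.var v z }

@[simp] theorem State.setVar_int (σ : State K) (v : ℕ) (z : ℤ) : (σ.setVar v z).int = σ.int := rfl
@[simp] theorem State.setVar_fld (σ : State K) (v : ℕ) (z : ℤ) : (σ.setVar v z).fld = σ.fld := rfl
@[simp] theorem State.setVar_var (σ : State K) (v : ℕ) (z : ℤ) :
    (σ.setVar v z).var = Function.update σ.var v z := rfl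

/-- The bound `e` is evaluated again before each round, hence `he` asks for its value in every state
that the frame of the loop allows. The counter is raised after the body, so the invariant is
required for the state in which the counter has already been set to `i + 1`. -/
theorem wp_forLoop {v : ℕ} {e : IExp} {body : Cmd K} {σ₀ : State K} (n : ℕ)
    (I : ℕ → State K → Prop) (c : ℕ → ℕ) (hv : body.keepsVar v = true)
    (he : ∀ σ, Frame (forLoop v e body) σ₀ σ → e.eval σ.var = n)
    (h0 : I 0 (σ₀.setVar v 0))
    (hs : ∀ i < n, ∀ σ, Frame (forLoop v e body) σ₀ σ → σ.var v = i → I i σ →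
      wp body (fun σ' t => t ≤ c i ∧ I (i + 1) (σ'.setVar v (i + 1))) σ) :
    wp (forLoop v e body) (fun σ' t => t ≤ ∑ i ∈ Finset.range n, c i ∧ I n σ') σ₀ := by
  have hbv : ∀ w, (forLoop v e body).keepsVar w = true → w ≠ v ∧ body.keepsVar w = true := by
    intro w; simp only [keepsVar_forLoop, Bool.and_eq_true, decide_eq_true_eq]
    exact fun h => ⟨Ne.symm h.1, h.2⟩
  -- Induction on the number `k` of rounds that remain.
  have key : ∀ k i, i + k = n → ∀ σ, Frame (forLoop v e body) σ₀ σ → σ.var v = i → I i σ →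
      wp (.whilePos (.sub e (.var v)) (.seq body (.setVar v (.add (.var v) (.const 1)))))
        (fun σ' t => t ≤ ∑ j ∈ Finset.range k, c (i + j) ∧ I n σ') σ := by
    intro k
    induction k with
    | zero =>
      intro i hi σ hF hσ hI
      refine wp_while_neg ?_ ⟨by simp, ?_⟩
      · simp only [IExp.eval, he σ hF, hσ]; omega
      · rwa [← hi]
    | succ k ih =>
      intro i hi σ hF hσ hI
      refine wp_while_pos ?_ ?_
      · simp only [IExp.eval, he σ hF, hσ]; omega
      refine wp_seq_of (hs i (by omega) σ hF hσ hI) ?_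
      rintro σ' t ⟨ht, hI'⟩ hF'
      rw [wp_setVar]
      have hv' : σ'.var v = i := (hF'.var v hv).trans hσ
      have e1 : IExp.eval σ'.var (.add (.var v) (.const 1)) = i + 1 := by simp [IExp.eval, hv']
      rw [e1]
      refine (ih (i + 1) (by omega) _ ?_ (by simp) hI').mono ?_
      · refine hF.trans ⟨fun w hw => ?_, fun z hz a => ?_, fun z hz a => ?_⟩
        · obtain ⟨h1, h2⟩ := hbv w hw
          simp [Function.update_of_ne h1, hF'.var w h2]
        · refine hF'.int z ?_ a
          simpa [forLoop, Cmd.keepsInt] using hz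
        · refine hF'.fld z ?_ a
          simpa [forLoop, Cmd.keepsFld] using hz
      · rintro σ'' t' ⟨ht', h⟩
        refine ⟨?_, h⟩
        rw [Finset.sum_range_succ']; simp only [add_zero]
        have : ∑ j ∈ Finset.range k, c (i + (j + 1)) = ∑ j ∈ Finset.range k, c (i + 1 + j) :=
          Finset.sum_congr rfl fun j _ => by ring_nf
        omega
  unfold forLoop
  rw [wp_seq, wp_setVar]
  have := key n 0 (by omega) (σ₀.setVar v 0) ?_ (by simp) h0
  · simpa [State.setVar, IExp.eval] using this
  · refine ⟨fun w hw => ?_, fun _ _ _ => rfl, fun _ _ _ => rfl⟩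
    simp [Function.update_of_ne (hbv w hw).1]

/-! ### Running a program in a private part of the memory -/

/-- The variables of the expression are moved up by `100`. -/
def IExp.reloc : IExp → IExp
  | .const z => .const z
  | .var v => .var (v + 100)
  | .add e e' => .add e.reloc e'.reloc
  | .sub e e' => .sub e.reloc e'.reloc
  | .mul e e' => .mul e.reloc e'.reloc
  | .div e e' => .div e.reloc e'.reloc
  | .mod e f => .mod e.reloc f.reloc

/-- A bound for the variables of the expression. -/
def IExp.bound : IExp → ℕ
  | .const _ => 0
  | .var v => v + 1
  | .add e e' => max e.bound e'.bound
  | .sub e e' => max e.bound e'.bound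
  | .mul e e' => max e.bound e'.bound
  | .div e e' => max e.bound e'.bound
  | .mod e f => max e.bound f.bound

/-- A bound for the variables of an address. -/
def addrBound : List IExp → ℕ
  | [] => 0
  | e :: a => max e.bound (addrBound a)

/-- The address is moved to the part of the memory whose number is in variable `3`. -/
def relocAddr (a : List IExp) : List IExp :=
  .const 100 :: .var 3 :: a.map IExp.reloc

/-- The program, moved to the private variables from `100` on and to a private part of the
memories. -/
def Cmd.reloc : Cmd K → Cmd K
  | .skip => .skip
  | .seq p q => .seq p.reloc q.reloc
  | .setVar v e => .setVar (v + 100) e.reloc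
  | .loadInt v a => .loadInt (v + 100) (relocAddr a)
  | .storeInt a e => .storeInt (relocAddr a) e.reloc
  | .setConst a c => .setConst (relocAddr a) c
  | .copy a b => .copy (relocAddr a) (relocAddr b)
  | .arith o a b c => .arith o (relocAddr a) (relocAddr b) (relocAddr c)
  | .ifPos e p q => .ifPos e.reloc p.reloc q.reloc
  | .ifZero a p q => .ifZero (relocAddr a) p.reloc q.reloc
  | .whilePos e p => .whilePos e.reloc p.reloc

/-- A bound for the variables of the program. -/
def Cmd.bound : Cmd K → ℕ
  | .skip => 0
  | .seq p q => max p.bound q.bound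
  | .setVar v e => max (v + 1) e.bound
  | .loadInt v a => max (v + 1) (addrBound a)
  | .storeInt a e => max (addrBound a) e.bound
  | .setConst a _ => addrBound a
  | .copy a b => max (addrBound a) (addrBound b)
  | .arith _ a b c => max (addrBound a) (max (addrBound b) (addrBound c))
  | .ifPos e p q => max e.bound (max p.bound q.bound)
  | .ifZero a p q => max (addrBound a) (max p.bound q.bound)
  | .whilePos e p => max e.bound p.bound

@[simp] theorem keepsVar_reloc (p : Cmd K) {v : ℕ} (hv : v < 100) : p.reloc.keepsVar v = true := by
  induction p <;> simp_all [Cmd.reloc, Cmd.keepsVar] <;> omega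

@[simp] theorem keepsInt_reloc (p : Cmd K) {z : ℤ} (hz : z ≠ 100) : p.reloc.keepsInt z = true := by
  induction p <;> simp_all [Cmd.reloc, Cmd.keepsInt, avoids, relocAddr, hz.symm]

@[simp] theorem keepsFld_reloc (p : Cmd K) {z : ℤ} (hz : z ≠ 100) : p.reloc.keepsFld z = true := by
  induction p <;> simp_all [Cmd.reloc, Cmd.keepsFld, avoids, relocAddr, hz.symm]

/-- The private part `id` of the state `τ` is the state `σ`, as far as the variables below `B` are
concerned. -/
structure Simulates (id : ℤ) (B : ℕ) (σ τ : State K) : Prop where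
  part : τ.var 3 = id
  var : ∀ v < B, τ.var (v + 100) = σ.var v
  int : ∀ a, τ.int (100 :: id :: a) = σ.int a
  fld : ∀ a, τ.fld (100 :: id :: a) = σ.fld a

theorem eval_reloc {ρ ρ' : ℕ → ℤ} (e : IExp) (h : ∀ v < e.bound, ρ' (v + 100) = ρ v) :
    e.reloc.eval ρ' = e.eval ρ := by
  induction e with
  | const => rfl
  | var v => exact h v (Nat.lt_succ_self v)
  | _ e e' ih ih' =>
    simp only [IExp.reloc, IExp.eval]
    rw [ih fun v hv => h v (lt_of_lt_of_le hv (le_max_left _ _)),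
      ih' fun v hv => h v (lt_of_lt_of_le hv (le_max_right _ _))]

namespace Simulates

variable {id : ℤ} {B : ℕ} {σ τ : State K}

theorem eval (h : Simulates id B σ τ) {e : IExp} (he : e.bound ≤ B) :
    e.reloc.eval τ.var = e.eval σ.var :=
  eval_reloc e fun v hv => h.var v (lt_of_lt_of_le hv he)

theorem addr (h : Simulates id B σ τ) {a : List IExp} (ha : addrBound a ≤ B) :
    τ.addr (relocAddr a) = 100 :: id :: σ.addr a := by
  have : ∀ a : List IExp, addrBound a ≤ B →
      (a.map IExp.reloc).map (IExp.eval τ.var) = a.map (IExp.eval σ.var) := by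
    intro a
    induction a with
    | nil => intro; rfl
    | cons e a ih =>
      intro ha
      simp only [addrBound, max_le_iff] at ha
      simp only [List.map_cons, h.eval ha.1, ih ha.2]
  simp only [State.addr, relocAddr, List.map_cons, IExp.eval, h.part, this a ha]

theorem setVar (h : Simulates id B σ τ) (v : ℕ) (z : ℤ) :
    Simulates id B { σ with var := Function.update σ.var v z }
      { τ with var := Function.update τ.var (v + 100) z } where
  part := by
    have : (3 : ℕ) ≠ v + 100 := by omega
    simpa [Function.update_of_ne this] using h.part
  var w hw := by
    by_cases hwv : w = v
    · simp [hwv]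
    · have : w + 100 ≠ v + 100 := by omega
      simp [Function.update_of_ne this, Function.update_of_ne hwv, h.var w hw]
  int := h.int
  fld := h.fld

theorem setInt (h : Simulates id B σ τ) (a : List ℤ) (z : ℤ) :
    Simulates id B { σ with int := Function.update σ.int a z }
      { τ with int := Function.update τ.int (100 :: id :: a) z } where
  part := h.part
  var := h.var
  int b := by
    have := h.int b
    simp only [Function.update_apply, List.cons.injEq, true_and]
    split_ifs <;> simp_all
  fld := h.fld

theorem setFld (h : Simulates id B σ τ) (a : List ℤ) (z : K) :
    Simulates id B { σ with fld := Function.update σ.fld a z }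
      { τ with fld := Function.update τ.fld (100 :: id :: a) z } where
  part := h.part
  var := h.var
  int := h.int
  fld b := by
    have := h.fld b
    simp only [Function.update_apply, List.cons.injEq, true_and]
    split_ifs <;> simp_all

end Simulates

/-- The other private parts of the memories agree. -/
def OthersAgree (id : ℤ) (τ τ' : State K) : Prop :=
  ∀ z ≠ id, ∀ a, τ'.int (100 :: z :: a) = τ.int (100 :: z :: a) ∧
    τ'.fld (100 :: z :: a) = τ.fld (100 :: z :: a)

theorem OthersAgree.trans {id : ℤ} {τ τ' τ'' : State K} (h : OthersAgree id τ τ')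
    (h' : OthersAgree id τ' τ'') : OthersAgree id τ τ'' := fun z hz a =>
  ⟨(h' z hz a).1.trans (h z hz a).1, (h' z hz a).2.trans (h z hz a).2⟩

theorem OthersAgree.refl (id : ℤ) (τ : State K) : OthersAgree id τ τ := fun _ _ _ => ⟨rfl, rfl⟩

theorem OthersAgree.setInt (id : ℤ) (τ : State K) (a : List ℤ) (x : ℤ) :
    OthersAgree id τ { τ with int := Function.update τ.int (100 :: id :: a) x } := fun z hz b =>
  ⟨Function.update_of_ne (by simp [hz]) _ _, rfl⟩

theorem OthersAgree.setFld (id : ℤ) (τ : State K) (a : List ℤ) (x : K) :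
    OthersAgree id τ { τ with fld := Function.update τ.fld (100 :: id :: a) x } := fun z hz b =>
  ⟨rfl, Function.update_of_ne (by simp [hz]) _ _⟩

/-- Lockstep simulation: each command acts on `σ` as its relocated copy acts on part `id` of `τ`, so
both take the same branches at the same cost. Only variables below `B` are compared, because a
program can reset only finitely many variables before a call. -/
theorem Exec.reloc {id : ℤ} {B : ℕ} {p : Cmd K} {σ σ' : State K} {t : ℕ} (h : Exec p σ σ' t) :
    p.bound ≤ B → ∀ τ, Simulates id B σ τ →
      ∃ τ', Exec p.reloc τ τ' t ∧ Simulates id B σ' τ' ∧ OthersAgree id τ τ' := by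
  induction h with
  | skip σ => exact fun _ τ hs => ⟨τ, .skip τ, hs, .refl _ _⟩
  | seq _ _ ih ih' =>
    intro hB τ hs
    simp only [Cmd.bound, max_le_iff] at hB
    obtain ⟨τ₁, h₁, hs₁, ho₁⟩ := ih hB.1 τ hs
    obtain ⟨τ₂, h₂, hs₂, ho₂⟩ := ih' hB.2 τ₁ hs₁
    exact ⟨τ₂, .seq h₁ h₂, hs₂, ho₁.trans ho₂⟩
  | setVar v e σ =>
    intro hB τ hs
    simp only [Cmd.bound, max_le_iff] at hB
    refine ⟨_, .setVar _ _ τ, ?_, fun _ _ _ => ⟨rfl, rfl⟩⟩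
    rw [hs.eval hB.2]
    exact hs.setVar _ _
  | loadInt v a σ =>
    intro hB τ hs
    simp only [Cmd.bound, max_le_iff] at hB
    refine ⟨_, .loadInt _ _ τ, ?_, fun _ _ _ => ⟨rfl, rfl⟩⟩
    rw [hs.addr hB.2, hs.int]
    exact hs.setVar _ _
  | storeInt a e σ =>
    intro hB τ hs
    simp only [Cmd.bound, max_le_iff] at hB
    refine ⟨_, .storeInt _ _ τ, ?_⟩
    rw [hs.addr hB.1, hs.eval hB.2]
    exact ⟨hs.setInt _ _, .setInt _ _ _ _⟩
  | setConst a c σ =>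
    intro hB τ hs
    simp only [Cmd.bound] at hB
    refine ⟨_, .setConst _ _ τ, ?_⟩
    rw [hs.addr hB]
    exact ⟨hs.setFld _ _, .setFld _ _ _ _⟩
  | copy a b σ =>
    intro hB τ hs
    simp only [Cmd.bound, max_le_iff] at hB
    refine ⟨_, .copy _ _ τ, ?_⟩
    rw [hs.addr hB.1, hs.addr hB.2, hs.fld]
    exact ⟨hs.setFld _ _, .setFld _ _ _ _⟩
  | arith o a b c σ hd =>
    intro hB τ hs
    simp only [Cmd.bound, max_le_iff] at hB
    refine ⟨_, .arith _ _ _ _ τ ?_, ?_⟩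
    · rw [hs.addr hB.2.2, hs.fld]; exact hd
    · rw [hs.addr hB.1, hs.addr hB.2.1, hs.addr hB.2.2, hs.fld, hs.fld]
      exact ⟨hs.setFld _ _, .setFld _ _ _ _⟩
  | ifPos_pos hc _ ih =>
    intro hB τ hs
    simp only [Cmd.bound, max_le_iff] at hB
    obtain ⟨τ', h, hs', ho⟩ := ih hB.2.1 τ hs
    exact ⟨τ', .ifPos_pos (by rwa [hs.eval hB.1]) h, hs', ho⟩
  | ifPos_neg hc _ ih =>
    intro hB τ hs
    simp only [Cmd.bound, max_le_iff] at hB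
    obtain ⟨τ', h, hs', ho⟩ := ih hB.2.2 τ hs
    exact ⟨τ', .ifPos_neg (by rwa [hs.eval hB.1]) h, hs', ho⟩
  | ifZero_pos hc _ ih =>
    intro hB τ hs
    simp only [Cmd.bound, max_le_iff] at hB
    obtain ⟨τ', h, hs', ho⟩ := ih hB.2.1 τ hs
    exact ⟨τ', .ifZero_pos (by rwa [hs.addr hB.1, hs.fld]) h, hs', ho⟩
  | ifZero_neg hc _ ih =>
    intro hB τ hs
    simp only [Cmd.bound, max_le_iff] at hB
    obtain ⟨τ', h, hs', ho⟩ := ih hB.2.2 τ hs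
    exact ⟨τ', .ifZero_neg (by rwa [hs.addr hB.1, hs.fld]) h, hs', ho⟩
  | while_pos hc _ _ ih ih' =>
    intro hB τ hs
    have hB' := hB
    simp only [Cmd.bound, max_le_iff] at hB
    obtain ⟨τ₁, h₁, hs₁, ho₁⟩ := ih hB.2 τ hs
    obtain ⟨τ₂, h₂, hs₂, ho₂⟩ := ih' hB' τ₁ hs₁
    exact ⟨τ₂, .while_pos (by rwa [hs.eval hB.1]) h₁ h₂, hs₂, ho₁.trans ho₂⟩
  | while_neg hc =>
    intro hB τ hs
    simp only [Cmd.bound, max_le_iff] at hB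
    exact ⟨τ, .while_neg (by rwa [hs.eval hB.1]), hs, .refl _ _⟩

/-- Reset the first `B` private variables. -/
def resetVars : ℕ → Cmd K
  | 0 => .skip
  | B + 1 => .seq (resetVars B) (.setVar (B + 100) (.const 0))

@[simp] theorem keepsVar_resetVars (B : ℕ) {v : ℕ} (hv : v < 100) :
    (resetVars B : Cmd K).keepsVar v = true := by
  induction B with
  | zero => rfl
  | succ B ih => simp [resetVars, Cmd.keepsVar, ih]; omega

@[simp] theorem keepsInt_resetVars (B : ℕ) (z : ℤ) : (resetVars B : Cmd K).keepsInt z = true := by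
  induction B with
  | zero => rfl
  | succ B ih => simp [resetVars, Cmd.keepsInt, ih]

@[simp] theorem keepsFld_resetVars (B : ℕ) (z : ℤ) : (resetVars B : Cmd K).keepsFld z = true := by
  induction B with
  | zero => rfl
  | succ B ih => simp [resetVars, Cmd.keepsFld, ih]

theorem wp_resetVars (B : ℕ) (σ : State K) :
    wp (resetVars B) (fun σ' t => t = 0 ∧ ∀ v < B, σ'.var (v + 100) = 0) σ := by
  induction B with
  | zero => exact (wp_skip _ _).2 ⟨rfl, by simp⟩
  | succ B ih =>
    refine wp_seq_of ih ?_
    rintro σ' t ⟨rfl, h⟩ -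
    rw [wp_setVar]
    refine ⟨rfl, fun v hv => ?_⟩
    by_cases hvB : v = B
    · simp [hvB, IExp.eval]
    · have : v + 100 ≠ B + 100 := by omega
      simp [Function.update_of_ne this, h v (by omega)]

/-! ### Filling a rectangular part of an array -/

/-- Two nested counted loops. -/
def forLoops (v : ℕ) (e : IExp) (v' : ℕ) (e' : IExp) (body : Cmd K) : Cmd K :=
  forLoop v e (forLoop v' e' body)

@[simp] theorem keepsVar_forLoops (w v v' : ℕ) (e e' : IExp) (p : Cmd K) :
    (forLoops v e v' e' p).keepsVar w = (decide (v ≠ w) && (decide (v' ≠ w) && p.keepsVar w)) := by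
  rw [forLoops, keepsVar_forLoop, keepsVar_forLoop]

@[simp] theorem keepsInt_forLoops (z : ℤ) (v v' : ℕ) (e e' : IExp) (p : Cmd K) :
    (forLoops v e v' e' p).keepsInt z = p.keepsInt z := by
  rw [forLoops, keepsInt_forLoop, keepsInt_forLoop]

@[simp] theorem keepsFld_forLoops (z : ℤ) (v v' : ℕ) (e e' : IExp) (p : Cmd K) :
    (forLoops v e v' e' p).keepsFld z = p.keepsFld z := by
  rw [forLoops, keepsFld_forLoop, keepsFld_forLoop]

/-- A double loop whose body assigns the cell `a + i, b + j` of an array. -/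
theorem wp_fill_sum {v v' : ℕ} {e e' : IExp} {body : Cmd K} {σ₀ : State K} (n n' : ℕ)
    (c : ℕ → ℕ → ℕ) (T : List ℤ) (a b : ℤ) (f : ℕ → ℕ → K)
    (hv : body.keepsVar v = true) (hv' : body.keepsVar v' = true) (hvv : v' ≠ v)
    (he : ∀ σ, Frame (forLoops v e v' e' body) σ₀ σ → e.eval σ.var = n)
    (he' : ∀ σ, Frame (forLoops v e v' e' body) σ₀ σ → e'.eval σ.var = n')
    (hb : ∀ i < n, ∀ j < n', ∀ σ, Frame (forLoops v e v' e' body) σ₀ σ →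
      σ.var v = i → σ.var v' = j →
      σ.fld (T ++ [a + i, b + j]) = σ₀.fld (T ++ [a + i, b + j]) →
      (∀ l, (∀ i' < n, ∀ j' < n', l ≠ T ++ [a + (i' : ℕ), b + (j' : ℕ)]) → σ.fld l = σ₀.fld l) →
      wp body (fun σ' t => t ≤ c i j ∧
        σ'.fld = Function.update σ.fld (T ++ [a + i, b + j]) (f i j)) σ) :
    wp (forLoops v e v' e' body) (fun σ' t => t ≤ ∑ i ∈ Finset.range n, ∑ j ∈ Finset.range n', c i j ∧
      (∀ i < n, ∀ j < n', σ'.fld (T ++ [a + (i : ℕ), b + (j : ℕ)]) = f i j) ∧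
      (∀ l, (∀ i < n, ∀ j < n', l ≠ T ++ [a + (i : ℕ), b + (j : ℕ)]) → σ'.fld l = σ₀.fld l)) σ₀ := by
  have hfr : ∀ {σ σ'}, Frame (forLoops v e v' e' body) σ₀ σ → Frame (forLoop v' e' body) σ σ' →
      Frame (forLoops v e v' e' body) σ₀ σ' := by
    intro σ σ' h h'
    exact h.trans (h'.weaken (fun w hw => by rw [forLoops, keepsVar_forLoop] at hw; simp_all)
      (fun w hw => by rwa [forLoops, keepsInt_forLoop] at hw)
      (fun w hw => by rwa [forLoops, keepsFld_forLoop] at hw))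
  refine (wp_forLoop n (fun i σ =>
    (∀ i' < i, ∀ j < n', σ.fld (T ++ [a + (i' : ℕ), b + (j : ℕ)]) = f i' j) ∧
    (∀ l, (∀ i' < i, ∀ j < n', l ≠ T ++ [a + (i' : ℕ), b + (j : ℕ)]) → σ.fld l = σ₀.fld l))
    (fun i => ∑ j ∈ Finset.range n', c i j) ?_ he ⟨by simp, fun _ _ => rfl⟩ ?_).mono ?_
  · simp [keepsVar_forLoop, hv, hvv]
  · rintro i hi σ hF hσ ⟨hI, hI'⟩
    -- The inner invariant separates the finished rows, the finished part of row `i`, and all cells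
    -- not yet written, which keep their initial values.
    refine (wp_forLoop n' (fun j σ' =>
      (∀ i' < i, ∀ j < n', σ'.fld (T ++ [a + (i' : ℕ), b + (j : ℕ)]) = f i' j) ∧
      (∀ j' < j, σ'.fld (T ++ [a + i, b + (j' : ℕ)]) = f i j') ∧
      (∀ l, (∀ i' < i, ∀ j < n', l ≠ T ++ [a + (i' : ℕ), b + (j : ℕ)]) →
        (∀ j' < j, l ≠ T ++ [a + (i : ℕ), b + (j' : ℕ)]) → σ'.fld l = σ₀.fld l))
      (c i) hv' (fun σ' h => he' σ' (hfr hF h)) ⟨hI, by simp, fun l h _ => hI' l h⟩ ?_).mono ?_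
    · rintro j hj σ' hF' hσ' ⟨h1, h2, h3⟩
      refine (hb i hi j hj σ' (hfr hF hF') ?_ hσ' ?_ ?_).mono ?_
      · rw [hF'.var v, hσ]
        simp [keepsVar_forLoop, hv, hvv]
      · refine h3 _ (fun i' hi' j' hj' => ?_) (fun j' hj' => ?_) <;> simp <;> omega
      · exact fun l hl => h3 l (fun i' hi' j' hj' => hl i' (by omega) j' hj')
          (fun j' hj' => hl i hi j' (by omega))
      · rintro σ'' t ⟨ht, hf⟩
        refine ⟨ht, fun i' hi' j' hj' => ?_, fun j' hj' => ?_, fun l h h' => ?_⟩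
        · rw [State.setVar_fld, hf, Function.update_of_ne, h1 i' hi' j' hj']
          simp; omega
        · rw [State.setVar_fld, hf]
          by_cases hjj : j' = j
          · rw [hjj, Function.update_self]
          · rw [Function.update_of_ne, h2 j' (by omega)]
            simp; omega
        · rw [State.setVar_fld, hf, Function.update_of_ne (h' j (by omega)),
            h3 l h fun j' hj' => h' j' (by omega)]
    · rintro σ' t ⟨ht, h1, h2, h3⟩
      refine ⟨ht, fun i' hi' j hj => ?_, fun l h => ?_⟩
      · rcases Nat.lt_succ_iff_lt_or_eq.1 hi' with h | rfl
        · exact h1 i' h j hj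
        · exact h2 j hj
      · exact h3 l (fun i' hi' => h i' (by omega)) (h i (by omega))
  · rintro σ' t ⟨ht, h1, h2⟩
    exact ⟨ht, h1, h2⟩

/-- A double loop whose body assigns the cell `a + i, b + j` of an array, at cost at most `c`. -/
theorem wp_fill {v v' : ℕ} {e e' : IExp} {body : Cmd K} {σ₀ : State K} (n n' c : ℕ)
    (T : List ℤ) (a b : ℤ) (f : ℕ → ℕ → K)
    (hv : body.keepsVar v = true) (hv' : body.keepsVar v' = true) (hvv : v' ≠ v)
    (he : ∀ σ, Frame (forLoops v e v' e' body) σ₀ σ → e.eval σ.var = n)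
    (he' : ∀ σ, Frame (forLoops v e v' e' body) σ₀ σ → e'.eval σ.var = n')
    (hb : ∀ i < n, ∀ j < n', ∀ σ, Frame (forLoops v e v' e' body) σ₀ σ →
      σ.var v = i → σ.var v' = j →
      σ.fld (T ++ [a + i, b + j]) = σ₀.fld (T ++ [a + i, b + j]) →
      (∀ l, (∀ i' < n, ∀ j' < n', l ≠ T ++ [a + (i' : ℕ), b + (j' : ℕ)]) → σ.fld l = σ₀.fld l) →
      wp body (fun σ' t => t ≤ c ∧
        σ'.fld = Function.update σ.fld (T ++ [a + i, b + j]) (f i j)) σ) :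
    wp (forLoops v e v' e' body) (fun σ' t => t ≤ n * (n' * c) ∧
      (∀ i < n, ∀ j < n', σ'.fld (T ++ [a + (i : ℕ), b + (j : ℕ)]) = f i j) ∧
      (∀ l, (∀ i < n, ∀ j < n', l ≠ T ++ [a + (i : ℕ), b + (j : ℕ)]) → σ'.fld l = σ₀.fld l)) σ₀ :=
  (wp_fill_sum n n' (fun _ _ => c) T a b f hv hv' hvv he he' hb).mono fun _ _ h => by
    simpa using h

/-! ### Calling the matrix multiplication -/

/-- The private parts of the memories that have not been used yet are zero. -/
def Fresh (σ : State K) : Prop :=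
  ∀ z ≥ σ.var 3, ∀ a, σ.int (100 :: z :: a) = 0 ∧ σ.fld (100 :: z :: a) = 0

theorem Fresh.of_frame {p : Cmd K} {σ σ' : State K} (h : Fresh σ) (hF : Frame p σ σ')
    (hv : p.keepsVar 3 = true) (hi : p.keepsInt 100 = true) (hf : p.keepsFld 100 = true) :
    Fresh σ' := fun z hz a => by
  rw [hF.var 3 hv] at hz
  rw [hF.int 100 hi, hF.fld 100 hf]
  exact h z hz a

/-- Multiply the matrices of size variable `7` in the arrays `14` and `15`; the product goes into
the array `16`. -/
def mulCall (mm : Cmd K) : Cmd K :=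
  .seq (forLoops 20 (.var 7) 21 (.var 7)
    (.copy [.const 100, .var 3, .const 0, .var 20, .var 21] [.const 14, .var 20, .var 21])) <|
  .seq (forLoops 20 (.var 7) 21 (.var 7)
    (.copy [.const 100, .var 3, .const 1, .var 20, .var 21] [.const 15, .var 20, .var 21])) <|
  .seq (resetVars mm.bound) <|
  .seq (.setVar 100 (.var 7)) <|
  .seq mm.reloc <|
  .seq (forLoops 20 (.var 7) 21 (.var 7)
    (.copy [.const 16, .var 20, .var 21] [.const 100, .var 3, .const 2, .var 20, .var 21])) <|
  .setVar 3 (.add (.var 3) (.const 1))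

@[simp] theorem keepsVar_mulCall (mm : Cmd K) {v : ℕ} (hv : v < 100) :
    (mulCall mm).keepsVar v = (decide (v ≠ 3) && (decide (v ≠ 20) && decide (v ≠ 21))) := by
  have h : 100 ≠ v := by omega
  simp only [mulCall, Cmd.keepsVar, keepsVar_forLoops, keepsVar_resetVars _ hv,
    keepsVar_reloc _ hv]
  rw [Bool.eq_iff_iff]
  simp [h, eq_comm (b := v)]
  tauto

@[simp] theorem keepsInt_mulCall (mm : Cmd K) {z : ℤ} (hz : z ≠ 100) :
    (mulCall mm).keepsInt z = true := by
  simp [mulCall, Cmd.keepsInt, keepsInt_forLoops, keepsInt_resetVars, keepsInt_reloc _ hz]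

@[simp] theorem keepsFld_mulCall (mm : Cmd K) {z : ℤ} (hz : z ≠ 100) (hz' : z ≠ 16) :
    (mulCall mm).keepsFld z = true := by
  simp [mulCall, Cmd.keepsFld, keepsFld_forLoops, keepsFld_resetVars, keepsFld_reloc _ hz, avoids,
    hz.symm, hz'.symm]

theorem cells_natCast {α : Type*} [Zero α] {N : ℕ} (f : Fin N → α) (i : Fin N) :
    cells f (i : ℤ) = f i := by
  simp [cells]

theorem cells_eq_zero {α : Type*} [Zero α] {N : ℕ} (f : Fin N → α) {z : ℤ}
    (h : ¬ (0 ≤ z ∧ z < N)) : cells f z = 0 := dif_neg h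

/-- `mm` multiplies matrices of size `N` at cost at most `μ N`. -/
def Multiplies (mm : Cmd K) (μ : ℕ → ℕ) : Prop :=
  ∀ N : ℕ, 0 < N → ∀ A B : Matrix (Fin N) (Fin N) K,
    ∃ (σ : State K) (t : ℕ), Exec mm (mulInit A B) σ t ∧ t ≤ μ N ∧
      ∀ i j : Fin N, σ.fld [2, (i : ℤ), (j : ℤ)] = (A * B) i j

/-- `mm` is only specified on the states `mulInit`, where everything but the size and the two
factors is zero. Each call therefore uses a part of the memories that was never written, and then
raises the number of the first unused part; the private variables, of which `mm` uses finitely many,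
are reset instead. Copying is free, so only `mm` itself costs. -/
theorem wp_mulCall {mm : Cmd K} {μ : ℕ → ℕ} (hmm : Multiplies mm μ) {σ₀ : State K} {w : ℕ}
    (hw : 0 < w) (h7 : σ₀.var 7 = w) (hf : Fresh σ₀) :
    wp (mulCall mm) (fun σ t => t ≤ μ w ∧ Fresh σ ∧ ∀ i < w, ∀ j < w,
      σ.fld [16, (i : ℕ), (j : ℕ)] =
        ∑ k ∈ Finset.range w, σ₀.fld [14, (i : ℕ), k] * σ₀.fld [15, (k : ℤ), (j : ℕ)]) σ₀ := by
  obtain ⟨id, hid⟩ : ∃ id, σ₀.var 3 = id := ⟨_, rfl⟩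
  have hkv : ∀ v, v ≠ 20 → v ≠ 21 → ∀ a b : List IExp,
      (forLoops 20 (.var 7) 21 (.var 7) (Cmd.copy a b : Cmd K)).keepsVar v = true := by
    intro v h h' a b; rw [keepsVar_forLoops]; simp [Cmd.keepsVar, h.symm, h'.symm]
  refine wp_seq_of (wp_fill w w 0 [100, id, 0] 0 0
    (fun i j => σ₀.fld [14, (i : ℕ), (j : ℕ)]) rfl rfl (by decide) ?_ ?_ ?_) ?_
  · intro σ h; exact (h.var 7 (hkv 7 (by decide) (by decide) _ _)).trans h7
  · intro σ h; exact (h.var 7 (hkv 7 (by decide) (by decide) _ _)).trans h7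
  · intro i hi j hj σ hF hσ hσ' _ _
    rw [wp_copy]
    have h3 := hF.var 3 (hkv 3 (by decide) (by decide) _ _)
    have h14 := hF.fld 14 (by rw [keepsFld_forLoops]; rfl)
    simp [State.addr, IExp.eval, hσ, hσ', h3, hid, h14]
  rintro σ₁ t₁ ⟨ht₁, hA, hA'⟩ hF₁
  have h71 : σ₁.var 7 = w := (hF₁.var 7 (hkv 7 (by decide) (by decide) _ _)).trans h7
  have h31 : σ₁.var 3 = id := (hF₁.var 3 (hkv 3 (by decide) (by decide) _ _)).trans hid
  have h15 := hF₁.fld 15 (by rw [keepsFld_forLoops]; rfl)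
  refine wp_seq_of (wp_fill w w 0 [100, id, 1] 0 0
    (fun i j => σ₀.fld [15, (i : ℕ), (j : ℕ)]) rfl rfl (by decide) ?_ ?_ ?_) ?_
  · intro σ h; exact (h.var 7 (hkv 7 (by decide) (by decide) _ _)).trans h71
  · intro σ h; exact (h.var 7 (hkv 7 (by decide) (by decide) _ _)).trans h71
  · intro i hi j hj σ hF hσ hσ' _ _
    rw [wp_copy]
    have h3 := hF.var 3 (hkv 3 (by decide) (by decide) _ _)
    have h15' := hF.fld 15 (by rw [keepsFld_forLoops]; rfl)
    simp [State.addr, IExp.eval, hσ, hσ', h3, h31, h15', h15]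
  rintro σ₂ t₂ ⟨ht₂, hB, hB'⟩ hF₂
  have h72 : σ₂.var 7 = w := (hF₂.var 7 (hkv 7 (by decide) (by decide) _ _)).trans h71
  have h32 : σ₂.var 3 = id := (hF₂.var 3 (hkv 3 (by decide) (by decide) _ _)).trans h31
  refine wp_seq_of (wp_resetVars _ _) ?_
  rintro σ₃ t₃ ⟨rfl, hz⟩ hF₃
  rw [wp_seq, wp_setVar]
  have h73 : σ₃.var 7 = w := (hF₃.var 7 (keepsVar_resetVars _ (by decide))).trans h72
  have h33 : σ₃.var 3 = id := (hF₃.var 3 (keepsVar_resetVars _ (by decide))).trans h32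
  set σ₄ : State K := { σ₃ with
    var := Function.update σ₃.var 100 (IExp.eval σ₃.var (IExp.var 7)) } with hσ₄
  obtain ⟨σm, tm, hm, htm, hprod⟩ := hmm w hw
    (Matrix.of fun i j : Fin w => σ₀.fld [14, (i : ℕ), (j : ℕ)])
    (Matrix.of fun i j : Fin w => σ₀.fld [15, (i : ℕ), (j : ℕ)])
  have hi2 : ∀ a, σ₂.int (100 :: a) = σ₀.int (100 :: a) := fun a =>
    (hF₂.int 100 (by rw [keepsInt_forLoops]; rfl) a).trans
      (hF₁.int 100 (by rw [keepsInt_forLoops]; rfl) a)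
  have hfr0 : ∀ a, σ₀.fld (100 :: id :: a) = 0 := fun a => (hf id hid.le a).2
  have hsim : Simulates id mm.bound
      (mulInit (Matrix.of fun i j : Fin w => σ₀.fld [14, (i : ℕ), (j : ℕ)])
        (Matrix.of fun i j : Fin w => σ₀.fld [15, (i : ℕ), (j : ℕ)])) σ₄ := by
    refine ⟨?_, ?_, ?_, ?_⟩
    · simp [hσ₄, h33]
    · intro v hv
      by_cases h0 : v = 0
      · simp [hσ₄, mulInit, h0, IExp.eval, h73]
      · simp [hσ₄, mulInit, h0, hz v hv]
    · intro a
      change σ₃.int _ = 0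
      rw [hF₃.int 100 (keepsInt_resetVars _ _), hi2]
      exact (hf id hid.le a).1
    · intro a
      change σ₃.fld _ = _
      rw [hF₃.fld 100 (keepsFld_resetVars _ _)]
      -- The part `id` was fresh, so all of its cells outside the two copied factors are zero, as
      -- `mulInit` demands.
      have hout : ∀ a, (∀ i < w, ∀ j < w, a ≠ [(0 : ℤ), (i : ℕ), (j : ℕ)]) →
          (∀ i < w, ∀ j < w, a ≠ [(1 : ℤ), (i : ℕ), (j : ℕ)]) → σ₂.fld (100 :: id :: a) = 0 := by
        intro a ha ha'
        rw [hB' _ (by simpa using ha'), hA' _ (by simpa using ha), hfr0]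
      have hin : ∀ i < w, ∀ j < w, σ₂.fld [100, id, 0, (i : ℕ), (j : ℕ)] =
          σ₀.fld [14, (i : ℕ), (j : ℕ)] := by
        intro i hi j hj
        rw [hB' _ (by simp), ← hA i hi j hj]
        simp
      unfold mulInit
      dsimp only
      split
      · rename_i _ i j
        by_cases hi : 0 ≤ i ∧ i < w
        · lift i to ℕ using hi.1
          rw [cells, dif_pos hi]
          by_cases hj : 0 ≤ j ∧ j < w
          · lift j to ℕ using hj.1
            rw [cells, dif_pos hj, hin i (by omega) j (by omega)]; rfl
          · rw [cells_eq_zero _ hj]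
            exact hout _ (by simp; intros; omega) (by simp)
        · rw [cells_eq_zero _ hi]
          exact hout _ (by simp; intros; omega) (by simp)
      · rename_i _ i j
        by_cases hi : 0 ≤ i ∧ i < w
        · lift i to ℕ using hi.1
          rw [cells, dif_pos hi]
          by_cases hj : 0 ≤ j ∧ j < w
          · lift j to ℕ using hj.1
            have := hB i (by omega) j (by omega)
            simp only [List.cons_append, List.nil_append, zero_add] at this
            rw [cells, dif_pos hj, this]; rfl
          · rw [cells_eq_zero _ hj]
            exact hout _ (by simp) (by simp; intros; omega)
        · rw [cells_eq_zero _ hi]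
          exact hout _ (by simp) (by simp; intros; omega)
      · rename_i h0 h1
        exact hout _ (fun i _ j _ => h0 _ _) (fun i _ j _ => h1 _ _)
  obtain ⟨σ₅, hex, hs5, ho5⟩ := hm.reloc le_rfl σ₄ hsim
  rw [wp_seq]
  refine ⟨σ₅, tm, hex, ?_⟩
  have hF₅ := hex.frame
  have h75 : σ₅.var 7 = w := by
    rw [hF₅.var 7 (keepsVar_reloc _ (by decide))]; simp [hσ₄, h73]
  have h35 : σ₅.var 3 = id := hs5.part
  refine wp_seq_of (wp_fill w w 0 [16] 0 0
    (fun i j => σ₅.fld [100, id, 2, (i : ℕ), (j : ℕ)]) rfl rfl (by decide) ?_ ?_ ?_) ?_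
  · intro σ h; exact (h.var 7 (hkv 7 (by decide) (by decide) _ _)).trans h75
  · intro σ h; exact (h.var 7 (hkv 7 (by decide) (by decide) _ _)).trans h75
  · intro i hi j hj σ hF hσ hσ' _ _
    rw [wp_copy]
    have h3 := hF.var 3 (hkv 3 (by decide) (by decide) _ _)
    have h100 := hF.fld 100 (by rw [keepsFld_forLoops]; rfl)
    simp [State.addr, IExp.eval, hσ, hσ', h3, h35, h100]
  rintro σ₆ t₆ ⟨ht₆, hC, _⟩ hF₆
  have h36 : σ₆.var 3 = id := (hF₆.var 3 (hkv 3 (by decide) (by decide) _ _)).trans h35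
  rw [wp_setVar]
  refine ⟨by omega, ?_, ?_⟩
  · intro z hz a
    simp only [IExp.eval, h36, Function.update_self] at hz
    have hzid : z ≠ id := by omega
    have hf6 := hF₆.fld 100 (by rw [keepsFld_forLoops]; rfl) (z :: a)
    have hi6 := hF₆.int 100 (by rw [keepsInt_forLoops]; rfl) (z :: a)
    have hf0 := hf z (by omega) a
    refine ⟨hi6.trans ((ho5 z hzid a).1.trans ?_), hf6.trans ((ho5 z hzid a).2.trans ?_)⟩
    · change σ₃.int _ = 0
      rw [hF₃.int 100 (keepsInt_resetVars _ _), hi2]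
      exact hf0.1
    · change σ₃.fld _ = 0
      rw [hF₃.fld 100 (keepsFld_resetVars _ _), hB' _ (by simp [hzid]), hA' _ (by simp [hzid])]
      exact hf0.2
  · intro i hi j hj
    have := hC i hi j hj
    simp only [List.cons_append, List.nil_append, zero_add] at this
    rw [this, hs5.fld, hprod ⟨i, hi⟩ ⟨j, hj⟩, Matrix.mul_apply, Finset.sum_range]
    rfl

/-! ### Updating a block of columns -/

/-- Let `w` be in variable `7`, `b` in variable `6`, `J` in variable `10`, and let `p c` be entry `c` of
the integer array `20`. In the array `10`, subtract from the `w` columns from `J` on the product of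
the `w` columns from `b` on and of the rows `p b, …, p (b + w - 1)` of the `w` columns from `J` on. -/
def blockUpdate (mm : Cmd K) : Cmd K :=
  .seq (forLoops 22 (.var 7) 23 (.var 7)
    (.seq (.loadInt 9 [.const 20, .add (.var 6) (.var 22)])
      (.copy [.const 15, .var 22, .var 23] [.const 10, .var 9, .add (.var 10) (.var 23)]))) <|
  forLoop 24 (.div (.var 2) (.var 7)) <|
  .seq (forLoops 22 (.var 7) 23 (.var 7)
    (.copy [.const 14, .var 22, .var 23]
      [.const 10, .add (.mul (.var 24) (.var 7)) (.var 22), .add (.var 6) (.var 23)])) <|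
  .seq (mulCall mm) <|
  forLoops 22 (.var 7) 23 (.var 7)
    (.arith .sub [.const 10, .add (.mul (.var 24) (.var 7)) (.var 22), .add (.var 10) (.var 23)]
      [.const 10, .add (.mul (.var 24) (.var 7)) (.var 22), .add (.var 10) (.var 23)]
      [.const 16, .var 22, .var 23])

/-- With G in the columns from `b` on and V in those from `J` on, V becomes V - G V_p, where V_p
consists of the rows `p k` of V. This is done in `N` strips of `w` rows, each by one square product
of size `w`. The same formula serves to apply an eliminated block to later columns and to merge it
with the block on its left. -/
theorem wp_blockUpdate {mm : Cmd K} {μ : ℕ → ℕ} (hmm : Multiplies mm μ) {σ₀ : State K}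
    {w W N b J : ℕ} (p : ℕ → ℕ) (hw : 0 < w) (hW : W = N * w) (h2 : σ₀.var 2 = W)
    (h7 : σ₀.var 7 = w) (h6 : σ₀.var 6 = b) (h10 : σ₀.var 10 = J) (hf : Fresh σ₀)
    (hp : ∀ c < w, σ₀.int [20, (b : ℤ) + (c : ℕ)] = p c) :
    wp (blockUpdate mm) (fun σ t => t ≤ N * (μ w + w * w) ∧ Fresh σ ∧
      (∀ i < W, ∀ c < w, σ.arr 10 i (J + c) = σ₀.arr 10 i (J + c) -
        ∑ k ∈ Finset.range w, σ₀.arr 10 i (b + k) * σ₀.arr 10 (p k) (J + c)) ∧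
      ∀ i j, j < J ∨ J + w ≤ j → σ.arr 10 i j = σ₀.arr 10 i j) σ₀ := by
  -- The rows `p k` of the target columns are saved before the loop, which overwrites them.
  refine wp_seq_of (wp_fill w w 0 [15] 0 0 (fun k c => σ₀.arr 10 (p k) (J + c)) rfl rfl (by decide)
    ?_ ?_ ?_) ?_
  · intro σ h; exact (h.var 7 (by simp)).trans h7
  · intro σ h; exact (h.var 7 (by simp)).trans h7
  · intro i hi j hj σ hF hσ hσ' _ _
    rw [wp_seq, wp_loadInt, wp_copy]
    have e6 := hF.var 6 (by simp)
    have e10 := hF.var 10 (by simp)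
    have ei := hF.int 20 (by simp)
    have ef := hF.fld 10 (by simp)
    simp [State.addr, IExp.eval, hσ, hσ', e6, h6, e10, h10, ei, ef, hp i hi, State.arr]
  rintro σ₁ t₁ ⟨ht₁, hR, -⟩ hF₁
  have h15 : ∀ k < w, ∀ c < w, σ₁.arr 15 k c = σ₀.arr 10 (p k) (J + c) := by
    intro k hk c hc; simpa [State.arr] using hR k hk c hc
  have a10 : ∀ i j, σ₁.arr 10 i j = σ₀.arr 10 i j := fun i j => hF₁.fld 10 (by simp) _
  have h71 : σ₁.var 7 = w := (hF₁.var 7 (by simp)).trans h7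
  have h21 : σ₁.var 2 = W := (hF₁.var 2 (by simp)).trans h2
  have h61 : σ₁.var 6 = b := (hF₁.var 6 (by simp)).trans h6
  have h101 : σ₁.var 10 = J := (hF₁.var 10 (by simp)).trans h10
  have hf1 : Fresh σ₁ := hf.of_frame hF₁ (by simp) (by simp) (by simp)
  -- A strip reads only its own rows and the saved ones, and the rows from `n * w` on still have
  -- their initial values when strip `n` begins.
  refine (wp_forLoop N (fun n σ => Fresh σ ∧
    (∀ i < n * w, ∀ c < w, σ.arr 10 i (J + c) = σ₀.arr 10 i (J + c) -
        ∑ k ∈ Finset.range w, σ₀.arr 10 i (b + k) * σ₀.arr 10 (p k) (J + c)) ∧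
    ∀ i j, n * w ≤ i ∨ j < J ∨ J + w ≤ j → σ.arr 10 i j = σ₀.arr 10 i j)
    (fun _ => μ w + w * w) (by simp) ?_ ?_ ?_).mono ?_
  · intro σ hF
    have e7 := (hF.var 7 (by simp)).trans h71
    have e2 := (hF.var 2 (by simp)).trans h21
    simp only [IExp.eval, e7, e2]
    rw [← Int.natCast_div, hW, Nat.mul_div_cancel _ hw]
  · exact ⟨fun z hz a => hf1 z (by simpa using hz) a, by simp, fun i j _ => a10 i j⟩
  · rintro n hn σ₂ hF₂ h24 ⟨hf2, hI, hI'⟩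
    have h72 : σ₂.var 7 = w := (hF₂.var 7 (by simp)).trans h71
    have h62 : σ₂.var 6 = b := (hF₂.var 6 (by simp)).trans h61
    have h102 : σ₂.var 10 = J := (hF₂.var 10 (by simp)).trans h101
    have h152 : ∀ k < w, ∀ c < w, σ₂.arr 15 k c = σ₀.arr 10 (p k) (J + c) := by
      intro k hk c hc; rw [← h15 k hk c hc]; exact hF₂.fld 15 (by simp) _
    refine wp_seq_of (wp_fill w w 0 [14] 0 0 (fun i k => σ₀.arr 10 (n * w + i) (b + k)) rfl rfl
      (by decide) ?_ ?_ ?_) ?_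
    · intro σ h; exact (h.var 7 (by simp)).trans h72
    · intro σ h; exact (h.var 7 (by simp)).trans h72
    · intro i hi k hk σ hF hσ hσ' _ _
      rw [wp_copy]
      have e6 := hF.var 6 (by simp)
      have e7 := hF.var 7 (by simp)
      have e24 := hF.var 24 (by simp)
      have ef := hF.fld 10 (by simp)
      have := hI' (n * w + i) (b + k) (by omega)
      simp only [State.arr] at this
      push_cast at this
      simp [State.addr, IExp.eval, hσ, hσ', e6, h62, e7, h72, e24, h24, ef, State.arr, this]
    rintro σ₃ t₃ ⟨ht₃, hG, -⟩ hF₃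
    have h73 : σ₃.var 7 = w := (hF₃.var 7 (by simp)).trans h72
    have hf3 : Fresh σ₃ := hf2.of_frame hF₃ (by simp) (by simp) (by simp)
    refine wp_seq_of (wp_mulCall hmm hw h73 hf3) ?_
    rintro σ₄ t₄ ⟨ht₄, hf4, hprod⟩ hF₄
    have h74 : σ₄.var 7 = w := (hF₄.var 7 (by simp)).trans h73
    have h64 : σ₄.var 6 = b := (hF₄.var 6 (by simp)).trans ((hF₃.var 6 (by simp)).trans h62)
    have h104 : σ₄.var 10 = J := (hF₄.var 10 (by simp)).trans ((hF₃.var 10 (by simp)).trans h102)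
    have h244 : σ₄.var 24 = n := (hF₄.var 24 (by simp)).trans ((hF₃.var 24 (by simp)).trans h24)
    have a4 : ∀ i j, σ₄.arr 10 i j = σ₂.arr 10 i j := fun i j =>
      (hF₄.fld 10 (by simp) _).trans (hF₃.fld 10 (by simp) _)
    have hprod' : ∀ i < w, ∀ c < w, σ₄.arr 16 i c =
        ∑ k ∈ Finset.range w, σ₀.arr 10 (n * w + i) (b + k) * σ₀.arr 10 (p k) (J + c) := by
      intro i hi c hc
      refine (hprod i hi c hc).trans (Finset.sum_congr rfl fun k hk => ?_)
      have hk := Finset.mem_range.1 hk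
      have e1 := hG i hi k hk
      simp only [List.cons_append, List.nil_append, zero_add] at e1
      rw [e1, ← h152 k hk c hc]
      congr 1
      exact hF₃.fld 15 (by simp) _
    refine (wp_fill w w 1 [10] (n * w) J (fun i c => σ₀.arr 10 (n * w + i) (J + c) -
        ∑ k ∈ Finset.range w, σ₀.arr 10 (n * w + i) (b + k) * σ₀.arr 10 (p k) (J + c)) rfl rfl
      (by decide) ?_ ?_ ?_).framed.mono ?_
    · intro σ h; exact (h.var 7 (by simp)).trans h74
    · intro σ h; exact (h.var 7 (by simp)).trans h74
    · intro i hi c hc σ hF hσ hσ' hold _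
      rw [wp_arith]
      have e10 := hF.var 10 (by simp)
      have e7 := hF.var 7 (by simp)
      have e24 := hF.var 24 (by simp)
      have ef := hF.fld 16 (by simp)
      have h16 := hprod' i hi c hc
      have e0 := hI' (n * w + i) (J + c) (by omega)
      rw [← a4] at e0
      rw [← e0, ← h16]
      simp only [List.cons_append, List.nil_append] at hold
      simp [State.addr, IExp.eval, hσ, hσ', e7, h74, e10, h104, e24, h244, ef, State.arr, hold,
        Op.eval]
    · rintro σ₅ t₅ ⟨⟨ht₅, hnew, hsame⟩, hF₅⟩
      refine ⟨?_, ?_, ?_, ?_⟩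
      · have : w * (w * 1) = w * w := by ring
        simp only [mul_zero] at ht₃
        omega
      · have := hf4.of_frame hF₅ (by simp) (by simp) (by simp)
        exact fun z hz a => this z (by simpa using hz) a
      · intro i hi c hc
        change σ₅.arr 10 i (J + c) = _
        by_cases hin : i < n * w
        · rw [← hI i hin c hc, ← a4]
          refine hsame _ fun i' hi' c' hc' => ?_
          simp; intro; omega
        · obtain ⟨i', rfl⟩ := Nat.exists_eq_add_of_le (Nat.le_of_not_lt hin)
          have hi' : i' < w := by
            have : (n + 1) * w = n * w + w := by ring
            omega
          rw [← hnew i' hi' c hc]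
          simp [State.arr]
      · intro i j hij
        change σ₅.arr 10 i j = _
        rw [← hI' i j ?_, ← a4]
        · refine hsame _ fun i' hi' c' hc' => ?_
          have : (n + 1) * w = n * w + w := by ring
          simp only [List.cons_append, List.nil_append, ne_eq, List.cons.injEq, true_and, and_true,
            not_and]
          intro e
          have : i = n * w + i' := by exact_mod_cast e
          omega
        · have : (n + 1) * w = n * w + w := by ring
          omega
  · rintro σ t ⟨ht, hfr, h1, h2⟩
    refine ⟨?_, hfr, by rwa [hW], fun i j h => h2 i j (Or.inr h)⟩
    simp only [mul_zero] at ht₁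
    simp at ht
    omega

/-! ### Gaussian elimination, column by column -/

open Classical in
/-- The last among the first `n` rows that is not used and where `b` is not zero. -/
def findPivot (used : ℕ → Bool) (b : ℕ → K) : ℕ → Option ℕ
  | 0 => none
  | i + 1 => if used i = false ∧ b i ≠ 0 then some i else findPivot used b i

theorem findPivot_eq_none {used : ℕ → Bool} {b : ℕ → K} {n : ℕ} (h : findPivot used b n = none) :
    ∀ i < n, used i = false → b i = 0 := by
  induction n with
  | zero => simp
  | succ n ih =>
    intro i hi hu
    rw [findPivot] at h
    split_ifs at h with hc
    rcases Nat.lt_succ_iff_lt_or_eq.1 hi with hi | rfl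
    · exact ih h i hi hu
    · by_contra hb; exact hc ⟨hu, hb⟩

theorem findPivot_eq_some {used : ℕ → Bool} {b : ℕ → K} {n p : ℕ}
    (h : findPivot used b n = some p) : p < n ∧ used p = false ∧ b p ≠ 0 := by
  induction n with
  | zero => simp [findPivot] at h
  | succ n ih =>
    rw [findPivot] at h
    split_ifs at h with hc
    · cases h; exact ⟨Nat.lt_succ_self _, hc⟩
    · exact ⟨(ih h).1.trans (Nat.lt_succ_self _), (ih h).2⟩

/-- The state of an elimination: the rows used as pivot rows, the transformation of columns,
and the determinant up to a sign, and the sign. -/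
structure Elim (K : Type*) where
  used : ℕ → Bool
  T : (ℕ → K) → ℕ → K
  det : K
  sgn : ℤ

namespace Elim

variable (W : ℕ) (S : Elim K) (b : ℕ → K)

/-- The pivot row for the column `b`. -/
def pivot : Option ℕ := findPivot S.used b W

/-- The multiple of the pivot row that is subtracted from row `i`. -/
def mult (i : ℕ) : K :=
  match S.pivot W b with
  | none => 0
  | some p => if S.used i = true ∨ i = p then 0 else b i / b p

/-- One step of the elimination, for a column which has become `b`. -/
def step : Elim K where
  used := match S.pivot W b with
    | none => S.used
    | some p => Function.update S.used p true
  T v i := S.T v i - S.mult W b i * S.T v ((S.pivot W b).getD 0)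
  det := match S.pivot W b with
    | none => 0
    | some p => S.det * b p
  sgn := match S.pivot W b with
    | none => S.sgn
    | some p => S.sgn * ∏ i ∈ Finset.range W, if S.used i = true ∧ p < i then -1 else 1

end Elim

/-- The elimination of the first `u` columns of `A`. -/
def elim (W : ℕ) (A : ℕ → ℕ → K) : ℕ → Elim K
  | 0 => ⟨fun _ => false, fun v => v, 1, 1⟩
  | u + 1 => (elim W A u).step W ((elim W A u).T fun i => A i u)

/-- Column `u` of `A` at the time when it is eliminated. -/
def elimCol (W : ℕ) (A : ℕ → ℕ → K) (u : ℕ) : ℕ → K := (elim W A u).T fun i => A i u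

/-- The row used as pivot row for column `u`, if any. -/
def elimPivot (W : ℕ) (A : ℕ → ℕ → K) (u : ℕ) : Option ℕ :=
  (elim W A u).pivot W (elimCol W A u)

/-- The state `σ` holds the elimination state `S`. -/
structure Holds (W : ℕ) (S : Elim K) (σ : State K) : Prop where
  used : ∀ i < W, σ.int [21, (i : ℕ)] = if S.used i = true then 1 else 0
  det : σ.fld [12, 0] = S.det
  sgn : σ.var 5 = S.sgn

/-- Eliminate the column whose index is in variable `6`. -/
def eliminateColumn : Cmd K :=
  .seq (.setVar 8 (.const (-1))) <|
  .seq (forLoop 22 (.var 2) (.seq (.loadInt 9 [.const 21, .var 22])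
    (.ifPos (.sub (.const 1) (.var 9))
      (.ifZero [.const 10, .var 22, .var 6] .skip (.setVar 8 (.var 22))) .skip))) <|
  .seq (.ifPos (.add (.var 8) (.const 1))
    (.seq (forLoop 22 (.var 2) (.seq (.loadInt 9 [.const 21, .var 22])
        (.ifPos (.var 9) (.ifPos (.sub (.var 22) (.var 8)) (.setVar 5 (.sub (.const 0) (.var 5)))
          .skip) .skip))) <|
      .seq (.copy [.const 12, .const 1] [.const 10, .var 8, .var 6]) <|
      .seq (.arith .mul [.const 12, .const 0] [.const 12, .const 0] [.const 12, .const 1]) <|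
      .seq (.storeInt [.const 21, .var 8] (.const 1)) (.storeInt [.const 20, .var 6] (.var 8)))
    (.seq (.setConst [.const 12, .const 1] 1) <|
      .seq (.setConst [.const 12, .const 0] 0) (.storeInt [.const 20, .var 6] (.const 0)))) <|
  forLoop 22 (.var 2) (.seq (.loadInt 9 [.const 21, .var 22])
    (.ifPos (.var 9) (.setConst [.const 10, .var 22, .var 6] 0)
      (.arith .div [.const 10, .var 22, .var 6] [.const 10, .var 22, .var 6]
        [.const 12, .const 1])))

/-- There are at most W zero tests for the pivot, one multiplication for the determinant and at most
W divisions; flags, pivot indices and the sign are integers and hence free. The column is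
overwritten by its multipliers, which is all that is needed to apply the step to other columns
later. -/
theorem wp_eliminateColumn {W u : ℕ} {S : Elim K} {b : ℕ → K} {σ₀ : State K} (h2 : σ₀.var 2 = W)
    (h6 : σ₀.var 6 = u) (hS : Holds W S σ₀) (hb : ∀ i < W, σ₀.arr 10 i u = b i) :
    wp eliminateColumn (fun σ t => t ≤ 2 * W + 1 ∧ Holds W (S.step W b) σ ∧
      σ.int [20, (u : ℤ)] = ((S.pivot W b).getD 0 : ℕ) ∧
      (∀ c : ℕ, c ≠ u → σ.int [20, (c : ℤ)] = σ₀.int [20, (c : ℤ)]) ∧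
      (∀ i < W, σ.arr 10 i u = S.mult W b i) ∧
      ∀ i j, j ≠ u → σ.arr 10 i j = σ₀.arr 10 i j) σ₀ := by
  classical
  unfold eliminateColumn
  rw [wp_seq, wp_setVar]
  -- search for the pivot
  refine wp_seq_of (wp_forLoop W (fun n σ => σ.fld = σ₀.fld ∧ σ.var 8 =
    match findPivot S.used b n with | none => (-1 : ℤ) | some p => (p : ℤ)) (fun _ => 1) (by simp)
    ?_ ?_ ?_) ?_
  · intro σ hF
    have := hF.var 2 (by simp)
    simpa [IExp.eval, h2] using this
  · simp [findPivot, IExp.eval]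
  · rintro n hn σ hF hσ ⟨hfld, h8⟩
    have e6 := hF.var 6 (by simp)
    have ei := hF.int 21 (by simp)
    have hbn := hb n hn
    simp only [State.arr] at hbn
    simp only [wp_seq, wp_loadInt, wp_ifPos, wp_ifZero, wp_skip, wp_setVar, State.addr,
      List.map_cons, List.map_nil, IExp.eval, Function.update_self, hσ, ei, hS.used n hn, findPivot]
    by_cases hu : S.used n = true
    · simp [hu, hfld, h8]
    · by_cases hbz : b n = 0
      · simp [hu, hfld, h8, e6, h6, hbn, hbz, hσ]
      · simp [hu, hfld, e6, h6, hbn, hbz, hσ]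
  rintro σ₁ t₁ ⟨ht₁, hfld₁, h8₁⟩ hF₁
  have hint₁ : ∀ z a, σ₁.int (z :: a) = σ₀.int (z :: a) := fun z a => hF₁.int z (by simp) a
  have h21 : σ₁.var 2 = W := by
    have := hF₁.var 2 (by simp)
    simpa [h2] using this
  have h61 : σ₁.var 6 = u := by
    have := hF₁.var 6 (by simp)
    simpa [h6] using this
  have h51 : σ₁.var 5 = S.sgn := by
    have := hF₁.var 5 (by simp)
    simpa [hS.sgn] using this
  -- record the pivot
  refine wp_seq_of (R := fun σ t => t ≤ 1 ∧ Holds W (S.step W b) σ ∧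
    σ.int [20, (u : ℤ)] = ((S.pivot W b).getD 0 : ℕ) ∧
    (∀ c : ℕ, c ≠ u → σ.int [20, (c : ℤ)] = σ₀.int [20, (c : ℤ)]) ∧
    σ.fld [12, 1] = (match S.pivot W b with | none => 1 | some p => b p) ∧
    σ.var 2 = W ∧ σ.var 6 = u ∧
    ∀ i j, σ.arr 10 i j = σ₀.arr 10 i j) ?_ ?_
  · change σ₁.var 8 = match S.pivot W b with | none => (-1 : ℤ) | some p => (p : ℤ) at h8₁
    rw [wp_ifPos]
    cases hp : S.pivot W b with
    | none =>
      rw [hp] at h8₁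
      simp only at h8₁
      simp only [IExp.eval, h8₁]
      rw [if_neg (by norm_num)]
      simp only [wp_seq, wp_setConst, wp_storeInt]
      refine ⟨by simp, ⟨?_, ?_, ?_⟩, ?_⟩
      · intro i hi
        have := hS.used i hi
        simp [Elim.step, hp, State.addr, IExp.eval, hint₁, this]
      · simp [Elim.step, hp, State.addr, IExp.eval]
      · simp [Elim.step, hp, h51]
      · refine ⟨by simp [State.addr, IExp.eval, h61], ?_, ?_, h21, h61, ?_⟩
        · intro c hc
          simp [State.addr, IExp.eval, h61, hc, hint₁]
        · simp [State.addr, IExp.eval]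
        · intro i j
          simp [State.addr, IExp.eval, State.arr, hfld₁]
    | some p =>
      obtain ⟨hpW, hpu, hbp⟩ := findPivot_eq_some hp
      rw [hp] at h8₁
      simp only at h8₁
      rw [if_pos (by simp only [IExp.eval, h8₁]; omega)]
      refine wp_seq_of (wp_forLoop W (fun n σ => σ.fld = σ₀.fld ∧ σ.var 5 =
        S.sgn * ∏ i ∈ Finset.range n, if S.used i = true ∧ p < i then -1 else 1) (fun _ => 0)
        (by simp) ?_ ?_ ?_) ?_
      · intro σ hF
        exact (hF.var 2 (by simp)).trans h21
      · simp [hfld₁, h51]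
      · rintro n hn σ hF hσ ⟨hfld, h5⟩
        have e8 := hF.var 8 (by simp)
        have ei := hF.int 21 (by simp)
        simp only [wp_seq, wp_loadInt, wp_ifPos, wp_skip, wp_setVar, State.addr,
          List.map_cons, List.map_nil, IExp.eval, Function.update_self, hσ, ei, hint₁,
          hS.used n hn, Finset.prod_range_succ]
        by_cases hu : S.used n = true
        · by_cases hpn : p < n
          · simp [hu, hfld, h5, e8, h8₁, hσ, hpn]
          · simp [hu, hfld, h5, e8, h8₁, hσ, hpn]
        · simp [hu, hfld, h5]
      rintro σ₂ t₂ ⟨ht₂, hfld₂, h5₂⟩ hF₂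
      have h62 := (hF₂.var 6 (by simp)).trans h61
      have h82 := (hF₂.var 8 (by simp)).trans h8₁
      have h22 := (hF₂.var 2 (by simp)).trans h21
      have hint₂ : ∀ z a, σ₂.int (z :: a) = σ₀.int (z :: a) := fun z a =>
        (hF₂.int z (by simp) a).trans (hint₁ z a)
      have hbp' := hb p hpW
      simp only [State.arr] at hbp'
      have ht₂' : t₂ = 0 := by simpa using ht₂
      simp only [wp_seq, wp_copy, wp_arith, wp_storeInt]
      refine ⟨by simp, by simp [ht₂'], ⟨?_, ?_, ?_⟩, ?_, ?_, ?_, h22, h62, ?_⟩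
      · intro i hi
        have := hS.used i hi
        by_cases hip : i = p
        · simp [Elim.step, hp, State.addr, IExp.eval, hip, h82]
        · simp [Elim.step, hp, State.addr, IExp.eval, h82, hip, hint₂, this]
      · simp [Elim.step, hp, State.addr, IExp.eval, Op.eval, hfld₂, hS.det, h82, h62, hbp']
      · simp [Elim.step, hp, h5₂]
      · simp [State.addr, IExp.eval, h62, h82]
      · intro c hc
        simp [State.addr, IExp.eval, h62, h82, hc, hint₂]
      · simp [State.addr, IExp.eval, h62, h82, hfld₂, hbp']
      · intro i j
        simp [State.addr, IExp.eval, State.arr, hfld₂]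
  -- compute the multipliers
  rintro σ₂ t₂ ⟨ht₂, hS₂, h20, h20', h12, h22, h62, ha⟩ -
  refine (wp_forLoop W (fun n σ => σ.fld [12, 0] = σ₂.fld [12, 0] ∧ σ.fld [12, 1] = σ₂.fld [12, 1] ∧
    (∀ i < n, σ.arr 10 i u = S.mult W b i) ∧
    ∀ i j, n ≤ i ∨ j ≠ u → σ.arr 10 i j = σ₀.arr 10 i j) (fun _ => 1) (by simp) ?_ ?_ ?_).framed.mono ?_
  · intro σ hF
    exact (hF.var 2 (by simp)).trans h22
  · exact ⟨rfl, rfl, by simp, fun i j _ => ha i j⟩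
  · rintro n hn σ hF hσ ⟨h0, h1, hI, hI'⟩
    have e6 := (hF.var 6 (by simp)).trans h62
    have ei := hF.int 21 (by simp)
    have hnu := hI' n u (Or.inl le_rfl)
    rw [hb n hn] at hnu
    -- The flag of the pivot row is already set, so that row gets the multiplier 0. Without a pivot
    -- the column vanishes in the unused rows, and dividing by the substitute 1 gives 0.
    have hmult : S.mult W b n = if (S.step W b).used n = true then 0 else b n / σ₂.fld [12, 1] := by
      rw [h12, Elim.mult, Elim.step]
      cases hp : S.pivot W b with
      | none =>
        simp only
        split_ifs with hu
        · rfl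
        · rw [findPivot_eq_none hp n hn (by simpa using hu), zero_div]
      | some p =>
        simp only [Function.update_apply]
        by_cases hnp : n = p <;> simp [hnp]
    have hne : σ₂.fld [12, 1] ≠ 0 := by
      rw [h12]
      cases hp : S.pivot W b with
      | none => exact one_ne_zero
      | some p => exact (findPivot_eq_some hp).2.2
    have hrest : ∀ (x : K), x = S.mult W b n → ∀ τ : State K,
        τ.fld = Function.update σ.fld [10, (n : ℤ), (u : ℤ)] x →
        (τ.fld [12, 0] = σ₂.fld [12, 0] ∧ τ.fld [12, 1] = σ₂.fld [12, 1] ∧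
        (∀ i < n + 1, τ.arr 10 i u = S.mult W b i) ∧
        ∀ i j, n + 1 ≤ i ∨ j ≠ u → τ.arr 10 i j = σ₀.arr 10 i j) := by
      intro x hx τ hτ
      refine ⟨by simpa [hτ] using h0, by simpa [hτ] using h1, fun i hi => ?_, fun i j hij => ?_⟩
      · by_cases hin : i = n
        · simp [State.arr, hτ, hin, hx]
        · rw [← hI i (by omega)]
          simp [State.arr, hτ, hin]
      · rw [← hI' i j (by omega)]
        simp only [State.arr, hτ]
        refine Function.update_of_ne ?_ _ _
        simp; omega
    have hF2 := hS₂.used n hn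
    simp only [State.arr] at hnu
    simp only [wp_seq, wp_loadInt, wp_ifPos, wp_setConst, wp_arith, State.addr,
      List.map_cons, List.map_nil, IExp.eval, Function.update_self, hσ, ei, hF2]
    by_cases hu : (S.step W b).used n = true
    · simp only [hu, if_true, zero_lt_one]
      refine ⟨by simp, hrest 0 (by rw [hmult, if_pos hu]) _ ?_⟩
      simp [hσ, e6]
    · simp only [hu, if_false, lt_irrefl, Bool.false_eq_true]
      refine ⟨fun _ => by rwa [h1], by simp, hrest (b n / σ₂.fld [12, 1])
        (by rw [hmult, if_neg hu]) _ ?_⟩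
      simp [hσ, e6, Op.eval, hnu, h1]
  · rintro σ₃ t₃ ⟨⟨ht₃, h0, h1, hI, hI'⟩, hF₃⟩
    have e21 := hF₃.int 21 (by simp)
    have e20 := hF₃.int 20 (by simp)
    simp only [Finset.sum_const, Finset.card_range, smul_eq_mul, mul_one] at ht₁ ht₃
    refine ⟨by omega, ⟨fun i hi => ?_, ?_, ?_⟩, ?_, fun c hc => ?_, hI, fun i j h => hI' i j (.inr h)⟩
    · rw [e21]; exact hS₂.used i hi
    · rw [h0]; exact hS₂.det
    · rw [hF₃.var 5 (by simp)]; exact hS₂.sgn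
    · rw [e20]; exact h20
    · rw [e20]; exact h20' c hc

theorem elim_succ_T (W : ℕ) (A : ℕ → ℕ → K) (u : ℕ) (v : ℕ → K) (i : ℕ) :
    (elim W A (u + 1)).T v i = (elim W A u).T v i -
      (elim W A u).mult W (elimCol W A u) i * (elim W A u).T v ((elimPivot W A u).getD 0) := rfl

/-! ### Elimination of all columns, with delayed updates -/

/-- As long as the block of the `w` columns from `u` on, which have been eliminated, is not everything:
merge it with the block to the left if this has the same size; otherwise apply it to the next
`w` columns, and eliminate column `u + w`. -/
def eliminateLoop (mm : Cmd K) : Cmd K :=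
  .whilePos (.sub (.var 2) (.var 7)) <|
    .ifPos (.mod (.div (.var 6) (.var 7)) (.const 2))
      (.seq (.setVar 10 (.sub (.var 6) (.var 7))) <|
        .seq (blockUpdate mm) <|
        .seq (.setVar 6 (.var 10)) (.setVar 7 (.add (.var 7) (.var 7))))
      (.seq (.setVar 10 (.add (.var 6) (.var 7))) <|
        .seq (blockUpdate mm) <|
        .seq (.setVar 6 (.var 10)) <|
        .seq (.setVar 7 (.const 1)) eliminateColumn)

/-- A bound for the cost of the elimination of `2 ^ k` columns. -/
def blockCost (μ : ℕ → ℕ) (W : ℕ) : ℕ → ℕ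
  | 0 => 2 * W + 1
  | k + 1 => 2 * blockCost μ W k + 2 * (W / 2 ^ k * (μ (2 ^ k) + 2 ^ k * 2 ^ k))

/-- The `w` columns from `u` on are ready for elimination. -/
structure BlockReady (W : ℕ) (A : ℕ → ℕ → K) (u w : ℕ) (σ : State K) : Prop where
  size : σ.var 2 = W
  col : σ.var 6 = u
  width : σ.var 7 = 1
  fresh : Fresh σ
  holds : Holds W (elim W A u) σ
  cols : ∀ c < w, ∀ i < W, σ.arr 10 i (u + c) = (elim W A u).T (fun i => A i (u + c)) i

/-- The `w` columns from `u` on have been eliminated, starting in the state `σ₀`. They now hold the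
transformation of this block. -/
structure BlockDone (W : ℕ) (A : ℕ → ℕ → K) (u w : ℕ) (σ₀ σ : State K) : Prop where
  size : σ.var 2 = W
  col : σ.var 6 = u
  width : σ.var 7 = w
  fresh : Fresh σ
  holds : Holds W (elim W A (u + w)) σ
  pivots : ∀ c < w, σ.int [20, ((u + c : ℕ) : ℤ)] = ((elimPivot W A (u + c)).getD 0 : ℕ)
  block : ∀ v, ∀ i < W, (elim W A (u + w)).T v i = (elim W A u).T v i -
    ∑ c ∈ Finset.range w, σ.arr 10 i (u + c) * (elim W A u).T v ((elimPivot W A (u + c)).getD 0)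
  other : ∀ i j, j < u ∨ u + w ≤ j → σ.arr 10 i j = σ₀.arr 10 i j
  otherPivots : ∀ c : ℕ, c < u ∨ u + w ≤ c → σ.int [20, (c : ℤ)] = σ₀.int [20, (c : ℤ)]

/-- A column without a pivot refers to row 0 as a dummy; its multipliers all vanish, so only the
range of the index matters. -/
theorem elimPivot_lt {W : ℕ} (hW : 0 < W) (A : ℕ → ℕ → K) (u : ℕ) :
    (elimPivot W A u).getD 0 < W := by
  cases h : elimPivot W A u with
  | none => simpa using hW
  | some p => exact (findPivot_eq_some h).1

/-- The loop is a binary counter which unrolls the recursion: eliminate the left half, apply it to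
the right half, eliminate the right half, merge. Since the same loop goes on after a block is
finished, the induction is stated for an arbitrary postcondition `Q`: it is enough that the rest of
the loop reaches `Q` from every state in which the block is done. -/
theorem wp_eliminateBlock {mm : Cmd K} {μ : ℕ → ℕ} (hmm : Multiplies mm μ) {W l : ℕ}
    (hW : W = 2 ^ l) (A : ℕ → ℕ → K) (k : ℕ) :
    ∀ {u : ℕ} {σ₀ : State K}, 2 ^ k ∣ u → u + 2 ^ k ≤ W → BlockReady W A u (2 ^ k) σ₀ →
    ∀ Q : State K → ℕ → Prop,
    (∀ σ t, t ≤ blockCost μ W k → BlockDone W A u (2 ^ k) σ₀ σ →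
      wp (eliminateLoop mm) (fun σ' t' => Q σ' (t + t')) σ) →
    wp (.seq eliminateColumn (eliminateLoop mm)) Q σ₀ := by
  induction k with
  | zero =>
    intro u σ₀ _ huW hr Q hQ
    have hc := hr.cols 0 (by norm_num)
    rw [add_zero] at hc
    refine wp_seq_of (wp_eliminateColumn hr.size hr.col hr.holds hc) ?_
    rintro σ t ⟨ht, hh, hq, hq', hm, hother⟩ hF
    refine hQ σ t ht ⟨?_, ?_, ?_, ?_, hh, ?_, ?_, ?_, ?_⟩
    · exact (hF.var 2 (by simp [eliminateColumn])).trans hr.size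
    · exact (hF.var 6 (by simp [eliminateColumn])).trans hr.col
    · exact (hF.var 7 (by simp [eliminateColumn])).trans (by simpa using hr.width)
    · exact hr.fresh.of_frame hF (by simp [eliminateColumn]) (by simp [eliminateColumn])
        (by simp [eliminateColumn])
    · intro c hc
      obtain rfl : c = 0 := by simpa using hc
      rw [add_zero]
      exact hq
    · intro v i hi
      rw [pow_zero, Finset.sum_range_one, add_zero, hm i hi]
      rfl
    · exact fun i j hj => hother i j (by simp at hj; omega)
    · exact fun c hc => hq' c (by simp at hc; omega)
  | succ k ih =>
    intro u σ₀ hu huW hr Q hQ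
    have hw : 0 < 2 ^ k := by positivity
    have hpow : 2 ^ (k + 1) = 2 ^ k + 2 ^ k := by ring
    obtain ⟨w, hwk⟩ : ∃ w, w = 2 ^ k := ⟨_, rfl⟩
    have hkl : k < l := by
      rw [← Nat.pow_lt_pow_iff_right (a := 2) (by norm_num), ← hW]; omega
    have hWN : W = W / w * w := by
      rw [Nat.div_mul_cancel]; rw [hwk, hW]; exact Nat.pow_dvd_pow _ hkl.le
    obtain ⟨m, rfl⟩ := hu
    have hum : 2 ^ (k + 1) * m = 2 * m * w := by rw [hpow, hwk]; ring
    rw [hum] at huW hr hQ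
    rw [hpow, ← hwk] at hQ huW hr
    rw [← hwk] at ih hw
    set u := 2 * m * w with hudef
    -- Divisibility of the start by `2 * w` makes parity distinguish the halves: the left half has
    -- an even block number and is applied to the right, the right half an odd one (`hdiv'`) and is
    -- merged.
    have hdiv : ((u : ℤ) / (w : ℤ)) % 2 = 0 := by
      rw [← Int.natCast_div, hudef, Nat.mul_div_cancel _ hw]; omega
    have hdiv' : ((u + w : ℕ) : ℤ) / (w : ℤ) % 2 = 1 := by
      rw [← Int.natCast_div, hudef, show 2 * m * w + w = (2 * m + 1) * w by ring,
        Nat.mul_div_cancel _ hw]; omega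
    refine ih ⟨2 * m, by rw [hudef]; ring⟩ (by omega)
      ⟨hr.size, hr.col, hr.width, hr.fresh, hr.holds, fun c hc => hr.cols c (by omega)⟩ Q ?_
    intro σ₁ t₁ ht₁ hd₁
    -- apply the first half to the second half
    refine wp_while_pos (by simp only [IExp.eval, hd₁.size, hd₁.width]; omega) ?_
    rw [wp_ifPos, if_neg (by simp only [IExp.eval, hd₁.col, hd₁.width, hdiv]; norm_num), wp_seq,
      wp_setVar]
    refine wp_seq_of (wp_blockUpdate hmm (b := u) (J := u + w)
      (fun c => (elimPivot W A (u + c)).getD 0) hw hWN ?_ ?_ ?_ ?_ ?_ ?_) ?_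
    · simpa using hd₁.size
    · simpa using hd₁.width
    · simpa using hd₁.col
    · simp [IExp.eval, hd₁.col, hd₁.width]
    · exact fun z hz a => hd₁.fresh z (by simpa using hz) a
    · intro c hc; simpa using hd₁.pivots c hc
    rintro σ₂ t₂ ⟨ht₂, hf₂, hnew₂, hold₂⟩ hF₂
    simp only [wp_seq, wp_setVar]
    -- eliminate the second half
    have h10 : σ₂.var 10 = (u + w : ℕ) := by
      have := hF₂.var 10 (by simp [blockUpdate])
      simpa [IExp.eval, hd₁.col, hd₁.width] using this
    have hint₂ : ∀ z ≠ 100, ∀ a, σ₂.int (z :: a) = σ₁.int (z :: a) := fun z hz a =>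
      hF₂.int z (by simp [blockUpdate, hz]) a
    set σ₃ : State K := { σ₂ with
      var := Function.update (Function.update σ₂.var 6 (IExp.eval σ₂.var (.var 10))) 7
        (IExp.eval (Function.update σ₂.var 6 (IExp.eval σ₂.var (.var 10))) (.const 1)) } with hσ₃
    have hready : BlockReady W A (u + w) w σ₃ := by
      refine ⟨?_, ?_, ?_, ?_, ⟨?_, ?_, ?_⟩, ?_⟩
      · have := hF₂.var 2 (by simp [blockUpdate])
        simpa [hσ₃, hd₁.size] using this
      · simpa [hσ₃, IExp.eval] using h10
      · simp [hσ₃, IExp.eval]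
      · exact fun z hz a => hf₂ z (by simpa [hσ₃] using hz) a
      · intro i hi
        rw [← hd₁.holds.used i hi]
        exact hint₂ 21 (by norm_num) _
      · rw [← hd₁.holds.det]
        exact hF₂.fld 12 (by simp [blockUpdate]) _
      · have := hF₂.var 5 (by simp [blockUpdate])
        simpa [hσ₃, hd₁.holds.sgn] using this
      · intro c hc i hi
        have e1 : ∀ i, σ₁.arr 10 i (u + w + c) = σ₀.arr 10 i (u + w + c) := fun i =>
          hd₁.other i _ (by omega)
        have e2 : ∀ i < W, σ₀.arr 10 i (u + w + c) = (elim W A u).T (fun i => A i (u + w + c)) i :=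
          fun i hi => by
            have := hr.cols (w + c) (by omega) i hi
            rwa [← add_assoc] at this
        change σ₂.arr 10 i (u + w + c) = _
        -- The columns of the first half hold exactly the matrix of its transformation, so the block
        -- update carries the next `w` columns from stage `u` to stage `u + w`.
        rw [hnew₂ i hi c hc, hd₁.block _ i hi]
        change σ₁.arr 10 i (u + w + c) - _ = _
        rw [e1, e2 i hi]
        congr 1
        refine Finset.sum_congr rfl fun k hk => ?_
        change σ₁.arr 10 i (u + k) * σ₁.arr 10 _ (u + w + c) = _
        rw [e1, e2 _ (elimPivot_lt (by omega) A _)]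
    have hrec := ih (u := u + w) (σ₀ := σ₃) ⟨2 * m + 1, by rw [hudef]; ring⟩ (by omega) hready
      (fun σ t => Q σ (t₁ + (t₂ + t))) ?_
    · rw [wp_seq] at hrec
      refine hrec.mono fun σ t h => h.mono fun σ' t' h' => ?_
      convert h' using 1
      ring
    intro σ₄ t₄ ht₄ hd₄
    -- merge
    refine wp_while_pos (by simp only [IExp.eval, hd₄.size, hd₄.width]; omega) ?_
    rw [wp_ifPos, if_pos (by simp only [IExp.eval, hd₄.col, hd₄.width, hdiv']; norm_num), wp_seq,
      wp_setVar]
    refine wp_seq_of (wp_blockUpdate hmm (b := u + w) (J := u)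
      (fun c => (elimPivot W A (u + w + c)).getD 0) hw hWN ?_ ?_ ?_ ?_ ?_ ?_) ?_
    · simpa using hd₄.size
    · simpa using hd₄.width
    · simpa using hd₄.col
    · simp [IExp.eval, hd₄.col, hd₄.width]
    · exact fun z hz a => hd₄.fresh z (by simpa using hz) a
    · intro c hc; simpa using hd₄.pivots c hc
    rintro σ₅ t₅ ⟨ht₅, hf₅, hnew₅, hold₅⟩ hF₅
    simp only [wp_seq, wp_setVar]
    have h105 : σ₅.var 10 = u := by
      have := hF₅.var 10 (by simp [blockUpdate])
      simpa [IExp.eval, hd₄.col, hd₄.width] using this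
    have h75 : σ₅.var 7 = w := by
      have := hF₅.var 7 (by simp [blockUpdate])
      simpa [IExp.eval, hd₄.col, hd₄.width] using this
    have hint₅ : ∀ z ≠ 100, ∀ a, σ₅.int (z :: a) = σ₄.int (z :: a) := fun z hz a =>
      hF₅.int z (by simp [blockUpdate, hz]) a
    have ha4 : ∀ c < w, ∀ i, σ₄.arr 10 i (u + c) = σ₁.arr 10 i (u + c) := fun c hc i =>
      (hd₄.other i _ (by omega)).trans (hold₂ i _ (by omega))
    refine (hQ _ (t₁ + (t₂ + (t₄ + t₅))) ?_ ⟨?_, ?_, ?_, ?_, ⟨?_, ?_, ?_⟩, ?_, ?_, ?_, ?_⟩).mono ?_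
    · rw [blockCost, ← hwk]; omega
    · have := hF₅.var 2 (by simp [blockUpdate])
      simpa [hd₄.size] using this
    · simp [IExp.eval, h105]
    · simp [IExp.eval, h75]
    · exact fun z hz a => hf₅ z (by simpa using hz) a
    · intro i hi
      rw [← add_assoc, ← hd₄.holds.used i hi]
      exact hint₅ 21 (by norm_num) _
    · rw [← add_assoc, ← hd₄.holds.det]
      exact hF₅.fld 12 (by simp [blockUpdate]) _
    · have := hF₅.var 5 (by simp [blockUpdate])
      rw [← add_assoc, ← hd₄.holds.sgn]
      simpa using this
    · intro c hc
      refine (hint₅ 20 (by norm_num) _).trans ?_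
      by_cases hcw : c < w
      · refine (hd₄.otherPivots _ (Or.inl (by omega))).trans ((hint₂ 20 (by norm_num) _).trans ?_)
        exact hd₁.pivots c hcw
      · obtain ⟨c', rfl⟩ := Nat.exists_eq_add_of_le (Nat.le_of_not_lt hcw)
        rw [← add_assoc]
        exact hd₄.pivots c' (by omega)
    · intro v i hi
      rw [← add_assoc, hd₄.block v i hi, hd₁.block v i hi, Finset.sum_range_add]
      -- If the left block acts by v ↦ v - G v_p and the right one by v ↦ v - G' v_p', then both
      -- together act by v ↦ v - (G - G' G_p') v_p - G' v_p'. The second block update has written G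
      -- - G' G_p' into the columns of the left block.
      have e1 : ∀ c ∈ Finset.range w, σ₄.arr 10 i (u + w + c) *
          (elim W A (u + w)).T v ((elimPivot W A (u + w + c)).getD 0) =
          σ₄.arr 10 i (u + w + c) * (elim W A u).T v ((elimPivot W A (u + w + c)).getD 0) -
          ∑ c' ∈ Finset.range w, σ₄.arr 10 i (u + w + c) *
            (σ₁.arr 10 ((elimPivot W A (u + w + c)).getD 0) (u + c') *
              (elim W A u).T v ((elimPivot W A (u + c')).getD 0)) := by
        intro c _
        rw [hd₁.block v _ (elimPivot_lt (by omega) A _), mul_sub, Finset.mul_sum]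
      have e2 : ∀ c ∈ Finset.range w, σ₅.arr 10 i (u + c) *
          (elim W A u).T v ((elimPivot W A (u + c)).getD 0) =
          σ₁.arr 10 i (u + c) * (elim W A u).T v ((elimPivot W A (u + c)).getD 0) -
          ∑ c' ∈ Finset.range w, σ₄.arr 10 i (u + w + c') *
            (σ₁.arr 10 ((elimPivot W A (u + w + c')).getD 0) (u + c) *
              (elim W A u).T v ((elimPivot W A (u + c)).getD 0)) := by
        intro c hc
        have hc := Finset.mem_range.1 hc
        rw [hnew₅ i hi c hc]
        change (σ₄.arr 10 i (u + c) - ∑ k ∈ Finset.range w, σ₄.arr 10 i (u + w + k) *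
          σ₄.arr 10 _ (u + c)) * _ = _
        rw [ha4 c hc, sub_mul, Finset.sum_mul]
        congr 1
        refine Finset.sum_congr rfl fun k _ => ?_
        rw [ha4 c hc, mul_assoc]
      have e3 : ∀ c ∈ Finset.range w, σ₅.arr 10 i (u + (w + c)) *
          (elim W A u).T v ((elimPivot W A (u + (w + c))).getD 0) = σ₄.arr 10 i (u + w + c) *
          (elim W A u).T v ((elimPivot W A (u + w + c)).getD 0) := by
        intro c hc
        rw [← add_assoc, hold₅ i _ (by omega)]
        rfl
      change _ = _ - (∑ c ∈ Finset.range w, σ₅.arr 10 i (u + c) * _ +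
        ∑ c ∈ Finset.range w, σ₅.arr 10 i (u + (w + c)) * _)
      rw [Finset.sum_congr rfl e1, Finset.sum_congr rfl e2, Finset.sum_congr rfl e3,
        Finset.sum_sub_distrib, Finset.sum_sub_distrib, Finset.sum_comm]
      ring
    · intro i j hj
      refine (hold₅ i j (by omega)).trans ((hd₄.other i j (by omega)).trans
        ((hold₂ i j (by omega)).trans (hd₁.other i j (by omega))))
    · intro c hc
      refine (hint₅ 20 (by norm_num) _).trans ((hd₄.otherPivots c (by omega)).trans
        ((hint₂ 20 (by norm_num) _).trans (hd₁.otherPivots c (by omega))))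
    · intro σ' t' h
      convert h using 1
      ring

/-- Eliminate the matrix in the array `10`. -/
def eliminate (mm : Cmd K) : Cmd K :=
  .seq (forLoop 22 (.var 2) (.storeInt [.const 21, .var 22] (.const 0))) <|
  .seq (.setConst [.const 12, .const 0] 1) <|
  .seq (.setVar 5 (.const 1)) <|
  .seq (.setVar 6 (.const 0)) <|
  .seq (.setVar 7 (.const 1)) <|
  .seq eliminateColumn (eliminateLoop mm)

theorem wp_eliminate {mm : Cmd K} {μ : ℕ → ℕ} (hmm : Multiplies mm μ) {W l : ℕ}
    (hW : W = 2 ^ l) {A : ℕ → ℕ → K} {σ₀ : State K} (h2 : σ₀.var 2 = W) (hf : Fresh σ₀)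
    (hA : ∀ i < W, ∀ j < W, σ₀.arr 10 i j = A i j) :
    wp (eliminate mm) (fun σ t => t ≤ blockCost μ W l ∧ BlockDone W A 0 W σ₀ σ) σ₀ := by
  refine wp_seq_of (wp_forLoop W (fun n σ => σ.fld = σ₀.fld ∧ (∀ i < n, σ.int [21, (i : ℕ)] = 0) ∧
    ∀ z ≠ 21, ∀ a, σ.int (z :: a) = σ₀.int (z :: a)) (fun _ => 0) (by simp) ?_ ?_ ?_) ?_
  · intro σ hF
    exact (hF.var 2 (by simp)).trans h2
  · exact ⟨rfl, by simp, fun _ _ _ => rfl⟩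
  · rintro n hn σ hF hσ ⟨h0, h1, h3⟩
    rw [wp_storeInt]
    refine ⟨by simp, h0, fun i hi => ?_, fun z hz a => ?_⟩
    · by_cases hin : i = n
      · simp [State.addr, IExp.eval, hσ, hin]
      · simp [State.addr, IExp.eval, hσ, hin, h1 i (by omega)]
    · simp [State.addr, IExp.eval, hz, h3 z hz]
  rintro σ₁ t₁ ⟨ht₁, hfld, h21, hint⟩ hF
  have ht₁' : t₁ = 0 := by simpa using ht₁
  rw [wp_seq, wp_setConst, wp_seq, wp_setVar, wp_seq, wp_setVar, wp_seq, wp_setVar]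
  have hf₁ : Fresh σ₁ := by
    intro z hz a
    rw [hF.var 3 (by simp)] at hz
    rw [hint 100 (by norm_num), hfld]
    exact hf z hz a
  have hW0 : 2 ^ l = W := hW.symm
  refine wp_eliminateBlock hmm hW A l (u := 0) (by simp) (by omega) ?_ _ ?_
  · refine ⟨?_, ?_, ?_, ?_, ⟨?_, ?_, ?_⟩, ?_⟩
    · have := hF.var 2 (by simp)
      simpa [h2] using this
    · simp [IExp.eval]
    · simp [IExp.eval]
    · intro z hz a
      have := hf₁ z (by simpa using hz) a
      simpa [State.addr, IExp.eval] using this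
    · intro i hi
      simpa [elim] using h21 i hi
    · simp [State.addr, IExp.eval, elim]
    · simp [IExp.eval, elim]
    · intro c hc i hi
      rw [hW0] at hc
      rw [zero_add, elim]
      simp only [State.arr, State.addr]
      rw [← hA i hi c hc, State.arr, Function.update_of_ne (by simp [IExp.eval]), hfld]
  · intro σ t ht hd
    rw [hW0] at hd
    refine wp_while_neg ?_ ⟨by omega, ?_⟩
    · simp [IExp.eval, hd.size, hd.width]
    · refine ⟨hd.size, hd.col, hd.width, hd.fresh, hd.holds, hd.pivots, hd.block, fun i j hj => ?_,
        fun c hc => ?_⟩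
      · rw [hd.other i j hj]
        simp only [State.arr, State.addr]
        rw [Function.update_of_ne (by simp [IExp.eval]), hfld]
      · rw [hd.otherPivots c hc]
        exact hint 20 (by norm_num) _

/-! ### What the elimination computes -/

section ElimTheory

variable (W : ℕ) (A : ℕ → ℕ → K)

theorem elim_succ_used (u i : ℕ) : (elim W A (u + 1)).used i = true ↔
    (elim W A u).used i = true ∨ elimPivot W A u = some i := by
  change (match elimPivot W A u with
    | none => (elim W A u).used
    | some p => Function.update (elim W A u).used p true) i = true ↔ _
  cases h : elimPivot W A u with
  | none => simp
  | some p =>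
    by_cases hip : i = p
    · simp [hip]
    · simp [hip, Ne.symm hip]

theorem elim_used_iff (u i : ℕ) : (elim W A u).used i = true ↔ ∃ c < u, elimPivot W A c = some i := by
  induction u with
  | zero => simp [elim]
  | succ u ih =>
    rw [elim_succ_used, ih]
    constructor
    · rintro (⟨c, hc, h⟩ | h)
      · exact ⟨c, by omega, h⟩
      · exact ⟨u, by omega, h⟩
    · rintro ⟨c, hc, h⟩
      rcases Nat.lt_succ_iff_lt_or_eq.1 hc with hc | rfl
      · exact Or.inl ⟨c, hc, h⟩
      · exact Or.inr h

variable {W A}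

theorem elimPivot_spec {u p : ℕ} (h : elimPivot W A u = some p) :
    p < W ∧ (elim W A u).used p = false ∧ elimCol W A u p ≠ 0 := findPivot_eq_some h

theorem elim_mult_of_used {u i : ℕ} (h : (elim W A (u + 1)).used i = true) :
    (elim W A u).mult W (elimCol W A u) i = 0 := by
  rw [elim_succ_used] at h
  change (match elimPivot W A u with
    | none => (0 : K)
    | some p => if (elim W A u).used i = true ∨ i = p then 0 else _) = 0
  cases hp : elimPivot W A u with
  | none => rfl
  | some p =>
    rw [hp] at h
    simp only
    rw [if_pos]
    exact h.imp_right fun h => (Option.some.inj h).symm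

/-- Rows that have been used are not changed any more. -/
theorem elim_T_of_used {c u i : ℕ} (hcu : c + 1 ≤ u) (h : (elim W A (c + 1)).used i = true)
    (v : ℕ → K) : (elim W A u).T v i = (elim W A c).T v i := by
  induction u, hcu using Nat.le_induction with
  | base => rw [elim_succ_T, elim_mult_of_used h, zero_mul, sub_zero]
  | succ u hu ih =>
    rw [elim_succ_T, elim_mult_of_used, zero_mul, sub_zero, ih]
    rw [elim_used_iff] at h ⊢
    obtain ⟨d, hd, hp⟩ := h
    exact ⟨d, by omega, hp⟩

theorem elim_unused_of_le {c u i : ℕ} (hcu : c ≤ u) (h : (elim W A u).used i = false) :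
    (elim W A c).used i = false := by
  rw [← Bool.not_eq_true, elim_used_iff] at h ⊢
  rintro ⟨d, hd, hp⟩
  exact h ⟨d, by omega, hp⟩

/-- Column `c` has become zero in the rows that are not used for the columns up to `c`. -/
theorem elim_T_eq_zero {c u i : ℕ} (hcu : c + 1 ≤ u) (hi : i < W)
    (h : (elim W A (c + 1)).used i = false) : (elim W A u).T (fun j => A j c) i = 0 := by
  induction u, hcu using Nat.le_induction generalizing i with
  | base =>
    rw [elim_succ_T]
    change elimCol W A c i - (match elimPivot W A c with
      | none => (0 : K)
      | some p => if (elim W A c).used i = true ∨ i = p then 0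
        else elimCol W A c i / elimCol W A c p) * elimCol W A c ((elimPivot W A c).getD 0) = 0
    have hu := elim_unused_of_le (Nat.le_succ c) h
    cases hp : elimPivot W A c with
    | none => simp [findPivot_eq_none hp i hi hu]
    | some p =>
      have hip : i ≠ p := by
        rintro rfl
        rw [← Bool.not_eq_true, elim_succ_used] at h
        exact h (Or.inr hp)
      simp [hu, hip, (elimPivot_spec hp).2.2]
  | succ u hu ih =>
    rw [elim_succ_T, ih hi h, zero_sub, neg_eq_zero]
    cases hp : elimPivot W A u with
    | none =>
      have : (elim W A u).mult W (elimCol W A u) i = 0 := by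
        change (match elimPivot W A u with
          | none => (0 : K)
          | some p => _) = 0
        rw [hp]
      rw [this, zero_mul]
    | some p =>
      -- The later pivot row `p` was itself unused after step `c`, so its entry in column `c` is
      -- zero and subtracting a multiple of it does no harm.
      obtain ⟨hpW, hpu, -⟩ := elimPivot_spec hp
      rw [Option.getD_some, ih hpW (elim_unused_of_le hu hpu), mul_zero]

theorem elim_T_pivot {c u p : ℕ} (hcu : c + 1 ≤ u) (h : elimPivot W A c = some p) :
    (elim W A u).T (fun j => A j c) p = elimCol W A c p :=
  elim_T_of_used hcu (by rw [elim_succ_used]; exact Or.inr h) _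

theorem elimPivot_injective {c c' p : ℕ} (h : elimPivot W A c = some p)
    (h' : elimPivot W A c' = some p) : c = c' := by
  have aux : ∀ {c c' : ℕ}, elimPivot W A c = some p → elimPivot W A c' = some p → ¬ c < c' := by
    intro c c' h h' hlt
    have := (elimPivot_spec h').2.1
    rw [← Bool.not_eq_true, elim_used_iff] at this
    exact this ⟨c, hlt, h⟩
  exact le_antisymm (not_lt.1 (aux h' h)) (not_lt.1 (aux h h'))

variable (W A)

/-- The matrix of the transformation. -/
def elimMatrix (u : ℕ) : Matrix (Fin W) (Fin W) K :=
  Matrix.of fun i j => (elim W A u).T (Pi.single (j : ℕ) 1) i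

/-- The multipliers depend on `A` but not on the vector transformed, so each stage is linear and
determined by the unit vectors. -/
theorem elim_T_eq_sum (hW : 0 < W) (u : ℕ) (v : ℕ → K) (i : Fin W) :
    (elim W A u).T v i = ∑ j, elimMatrix W A u i j * v j := by
  induction u generalizing i with
  | zero =>
    change v i = ∑ j : Fin W, (Pi.single (j : ℕ) 1 : ℕ → K) i * v j
    rw [Finset.sum_eq_single i]
    · simp
    · intro j _ hj
      rw [Pi.single_eq_of_ne (fun h => hj (Fin.ext h.symm)), zero_mul]
    · simp
  | succ u ih =>
    have hp := elimPivot_lt hW A u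
    simp only [elimMatrix, Matrix.of_apply, elim_succ_T] at ih ⊢
    rw [ih i, ih ⟨_, hp⟩, Finset.mul_sum, ← Finset.sum_sub_distrib]
    refine Finset.sum_congr rfl fun j _ => ?_
    ring

theorem elim_mult_pivot (u : ℕ) :
    (elim W A u).mult W (elimCol W A u) ((elimPivot W A u).getD 0) = 0 := by
  cases hp : elimPivot W A u with
  | none =>
    change (match elimPivot W A u with
      | none => (0 : K)
      | some p => _) = 0
    rw [hp]
  | some p => exact elim_mult_of_used (by rw [elim_succ_used]; exact Or.inr hp)

/-- A step multiplies from the left by the identity minus a rank one matrix, (multipliers) times the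
unit row of the pivot. Its determinant is 1 minus the multiplier of the pivot row, which is 0. -/
theorem det_elimMatrix (hW : 0 < W) (u : ℕ) : (elimMatrix W A u).det = 1 := by
  induction u with
  | zero =>
    have : elimMatrix W A 0 = 1 := by
      ext i j
      change (Pi.single (j : ℕ) 1 : ℕ → K) i = _
      rw [Matrix.one_apply, Pi.single_apply]
      simp [Fin.ext_iff]
    rw [this, Matrix.det_one]
  | succ u ih =>
    have hp := elimPivot_lt hW A u
    have : elimMatrix W A (u + 1) =
        (1 + Matrix.replicateCol Unit (fun i : Fin W => - (elim W A u).mult W (elimCol W A u) i) *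
          Matrix.replicateRow Unit (Pi.single (⟨_, hp⟩ : Fin W) (1 : K))) * elimMatrix W A u := by
      ext i j
      rw [add_mul, one_mul, Matrix.add_apply, Matrix.mul_assoc]
      simp only [elimMatrix, Matrix.of_apply, elim_succ_T]
      simp [Matrix.mul_apply, Pi.single_apply]
      ring
    rw [this, Matrix.det_mul, ih, Matrix.det_one_add_replicateCol_mul_replicateRow]
    simp [elim_mult_pivot]

/-- The matrix to which the elimination is applied. -/
def elimInput : Matrix (Fin W) (Fin W) K := Matrix.of fun i j => A i j

theorem elimMatrix_mul_apply (hW : 0 < W) (u : ℕ) (i c : Fin W) :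
    (elimMatrix W A u * elimInput W A) i c = (elim W A u).T (fun j => A j c) i := by
  rw [elim_T_eq_sum W A hW, Matrix.mul_apply]
  rfl

/-- The rows of this matrix generate the left kernel. -/
def elimKernel : Matrix (Fin W) (Fin W) K :=
  Matrix.of fun i j => if (elim W A W).used i = true then 0 else elimMatrix W A W i j

/-- The transformation T is invertible, so the left kernel may be studied for T A. There the rows
that were never used are zero, hence unconstrained, and the pivot columns, taken from left to right,
force the coefficients of all used rows to vanish. -/
theorem vecMul_elimInput_eq_zero_iff (hW : 0 < W) (v : Fin W → K) :
    Matrix.vecMul v (elimInput W A) = 0 ↔ ∃ w, v = Matrix.vecMul w (elimKernel W A) := by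
  set T := elimMatrix W A W
  have hdet : IsUnit T.det := by rw [det_elimMatrix W A hW]; exact isUnit_one
  constructor
  · intro hv
    set w := Matrix.vecMul v T⁻¹ with hwdef
    have hvw : v = Matrix.vecMul w T := by
      rw [hwdef, Matrix.vecMul_vecMul, Matrix.nonsing_inv_mul _ hdet, Matrix.vecMul_one]
    have hw : Matrix.vecMul w (T * elimInput W A) = 0 := by
      rw [← Matrix.vecMul_vecMul, ← hvw, hv]
    -- In column `c` of T A, rows used earlier have coefficient 0 by induction and rows still unused
    -- afterwards have entry 0. What remains is the pivot entry, which is not zero.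
    have key : ∀ c < W, ∀ p : Fin W, elimPivot W A c = some (p : ℕ) → w p = 0 := by
      intro c
      induction c using Nat.strong_induction_on with
      | _ c ih =>
        intro hc p hp
        have h0 := congrFun hw ⟨c, hc⟩
        rw [Matrix.vecMul, dotProduct, Finset.sum_eq_single p] at h0
        · rw [elimMatrix_mul_apply W A hW] at h0
          simp only at h0
          rw [elim_T_pivot hc hp] at h0
          exact (mul_eq_zero.1 h0).resolve_right (elimPivot_spec hp).2.2
        · intro i _ hip
          rw [elimMatrix_mul_apply W A hW]
          by_cases hu : (elim W A (c + 1)).used i = true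
          · rw [elim_succ_used, elim_used_iff] at hu
            rcases hu with ⟨c', hc', hpi⟩ | hpi
            · rw [ih c' hc' (by omega) i hpi, zero_mul]
            · rw [hp] at hpi
              exact absurd (Fin.ext (Option.some.inj hpi).symm) hip
          · rw [elim_T_eq_zero hc i.2 (by simpa using hu), mul_zero]
        · simp
    refine ⟨w, ?_⟩
    rw [hvw]
    ext j
    simp only [Matrix.vecMul, dotProduct]
    refine Finset.sum_congr rfl fun i _ => ?_
    simp only [elimKernel, Matrix.of_apply]
    split_ifs with hu
    · rw [elim_used_iff] at hu
      obtain ⟨c, hc, hp⟩ := hu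
      rw [key c hc i hp, zero_mul, zero_mul]
    · rfl
  · rintro ⟨w, rfl⟩
    rw [Matrix.vecMul_vecMul]
    have : elimKernel W A * elimInput W A = 0 := by
      ext i c
      rw [Matrix.mul_apply, Matrix.zero_apply]
      by_cases hu : (elim W A W).used i = true
      · simp [elimKernel, hu]
      · have h0 := elim_T_eq_zero (c := c) (u := W) c.2 i.2
          (elim_unused_of_le (show (c : ℕ) + 1 ≤ W from c.2) (by simpa using hu))
        rw [← elimMatrix_mul_apply W A hW, Matrix.mul_apply] at h0
        simpa [elimKernel, hu] using h0
    rw [this, Matrix.vecMul_zero]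

theorem elim_succ_det (u : ℕ) : (elim W A (u + 1)).det = match elimPivot W A u with
    | none => 0
    | some p => (elim W A u).det * elimCol W A u p := rfl

theorem elim_succ_sgn (u : ℕ) : (elim W A (u + 1)).sgn = match elimPivot W A u with
    | none => (elim W A u).sgn
    | some p => (elim W A u).sgn *
        ∏ i ∈ Finset.range W, if (elim W A u).used i = true ∧ p < i then -1 else 1 := rfl

variable {W A} in
theorem elim_det_eq_zero {c u : ℕ} (hcu : c + 1 ≤ u) (h : elimPivot W A c = none) :
    (elim W A u).det = 0 := by
  induction u, hcu using Nat.le_induction with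
  | base => rw [elim_succ_det, h]
  | succ u hu ih =>
    rw [elim_succ_det]
    cases elimPivot W A u with
    | none => rfl
    | some p => simp [ih]

/-- Rows are never exchanged: T A becomes triangular only after the permutation π that sends each
column to its pivot row, so the determinant is the product of the pivots times the sign of π. The
sign is collected as inversions. If some column has no pivot, then some row is never used and is
zero in T A. -/
theorem det_elimInput (hW : 0 < W) :
    (elimInput W A).det = (elim W A W).sgn * (elim W A W).det := by
  have hV : (elimInput W A).det = (elimMatrix W A W * elimInput W A).det := by
    rw [Matrix.det_mul, det_elimMatrix W A hW, one_mul]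
  rw [hV]
  by_cases hall : ∀ c : Fin W, ∃ p : Fin W, elimPivot W A c = some (p : ℕ)
  · choose p hp using hall
    have hinj : Function.Injective p := fun c c' h => Fin.ext
      (elimPivot_injective (hp c) (by rw [h]; exact hp c'))
    set π : Equiv.Perm (Fin W) := Equiv.ofBijective p (Finite.injective_iff_bijective.1 hinj)
    have hπ : ∀ c, π c = p c := fun c => rfl
    have hdet : ∀ u ≤ W, (elim W A u).det = ∏ c : Fin W,
        if (c : ℕ) < u then elimCol W A c (p c) else 1 := by
      intro u hu
      induction u with
      | zero => simp [elim]
      | succ u ih =>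
        rw [elim_succ_det, hp ⟨u, hu⟩]
        simp only
        rw [ih (by omega), ← Finset.prod_erase_mul Finset.univ _ (Finset.mem_univ (⟨u, hu⟩ : Fin W)),
          ← Finset.prod_erase_mul Finset.univ _ (Finset.mem_univ (⟨u, hu⟩ : Fin W))]
        simp only [lt_irrefl, if_false, mul_one, Nat.lt_succ_self, if_true]
        congr 1
        refine Finset.prod_congr rfl fun c hc => ?_
        have : (c : ℕ) ≠ u := fun h => (Finset.ne_of_mem_erase hc) (Fin.ext h)
        have h2 : ((c : ℕ) < u) ↔ (c : ℕ) < u + 1 := by omega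
        simp [h2]
    -- When column `c` is treated, the used rows below its pivot row are the π i with i < c and π i
    -- > π c, that is, the inversions that end in `c`.
    have hsgn : ∀ u ≤ W, (elim W A u).sgn = ∏ c : Fin W,
        if (c : ℕ) < u then ∏ i ∈ Finset.Iio c, (if π i < π c then (1 : ℤ) else -1) else 1 := by
      intro u hu
      induction u with
      | zero => simp [elim]
      | succ u ih =>
        rw [elim_succ_sgn, hp ⟨u, hu⟩]
        simp only
        rw [ih (by omega), ← Finset.prod_erase_mul Finset.univ _ (Finset.mem_univ (⟨u, hu⟩ : Fin W)),
          ← Finset.prod_erase_mul Finset.univ _ (Finset.mem_univ (⟨u, hu⟩ : Fin W))]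
        simp only [lt_irrefl, if_false, mul_one, Nat.lt_succ_self, if_true]
        congr 1
        · refine Finset.prod_congr rfl fun c hc => ?_
          have : (c : ℕ) ≠ u := fun h => (Finset.ne_of_mem_erase hc) (Fin.ext h)
          have h2 : ((c : ℕ) < u) ↔ (c : ℕ) < u + 1 := by omega
          simp [h2]
        · rw [Finset.prod_range (fun i => if (elim W A u).used i = true ∧ (p ⟨u, hu⟩ : ℕ) < i
            then (-1 : ℤ) else 1), ← Equiv.prod_comp π, ← Finset.prod_subset
            (Finset.subset_univ (Finset.Iio (⟨u, hu⟩ : Fin W)))]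
          · refine Finset.prod_congr rfl fun c hc => ?_
            have hcu : (c : ℕ) < u := by simpa [Fin.lt_def] using hc
            have hu1 : (elim W A u).used (p c) = true := (elim_used_iff W A u _).2 ⟨c, hcu, hp c⟩
            have hne : (p c : ℕ) ≠ p ⟨u, hu⟩ := fun h => by
              have := hinj (Fin.ext h)
              rw [this] at hcu
              simp at hcu
            simp only [hπ, hu1, true_and, Fin.lt_def]
            split_ifs <;> first | rfl | omega
          · intro c _ hc
            rw [if_neg]
            rintro ⟨h1, -⟩
            rw [hπ, elim_used_iff] at h1
            obtain ⟨d, hd, hpd⟩ := h1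
            have := elimPivot_injective hpd (hp c)
            exact hc (by simp [Fin.lt_def]; omega)
    have htri : ((elimMatrix W A W * elimInput W A).submatrix π id).BlockTriangular id := by
      intro c' c (hcc : c < c')
      rw [Matrix.submatrix_apply, id, elimMatrix_mul_apply W A hW]
      refine elim_T_eq_zero c.2 (π c').2 ?_
      rw [hπ]
      exact elim_unused_of_le hcc (elimPivot_spec (hp c')).2.1
    have h1 := Matrix.det_permute π (elimMatrix W A W * elimInput W A)
    rw [Matrix.det_of_isUpperTriangular htri] at h1
    have h2 : ∏ c, ((elimMatrix W A W * elimInput W A).submatrix π id) c c = (elim W A W).det := by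
      rw [hdet W le_rfl]
      refine Finset.prod_congr rfl fun c _ => ?_
      rw [Matrix.submatrix_apply, id, elimMatrix_mul_apply W A hW, if_pos c.2]
      exact elim_T_pivot c.2 (hp c)
    have h3 : (elim W A W).sgn = ((Equiv.Perm.sign π : ℤˣ) : ℤ) := by
      rw [hsgn W le_rfl, Equiv.Perm.sign_eq_prod_prod_Iio]
      simp [apply_ite]
    rw [← h2, h1, h3, ← mul_assoc]
    rcases Int.units_eq_one_or (Equiv.Perm.sign π) with h | h <;> simp [h]
  · push Not at hall
    obtain ⟨c, hc⟩ := hall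
    have hnone : elimPivot W A c = none := by
      cases h : elimPivot W A c with
      | none => rfl
      | some p => exact absurd h (hc ⟨p, (elimPivot_spec h).1⟩)
    rw [elim_det_eq_zero c.2 hnone, mul_zero]
    -- If all rows were used, then sending a row to its column would be injective, hence surjective,
    -- and would reach the column `c` without pivot.
    obtain ⟨i, hi⟩ : ∃ i : Fin W, (elim W A W).used i = false := by
      by_contra hcon
      push Not at hcon
      have : ∀ i : Fin W, ∃ c : Fin W, elimPivot W A c = some (i : ℕ) := fun i => by
        obtain ⟨d, hd, h⟩ := (elim_used_iff W A W i).1 (by simpa using hcon i)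
        exact ⟨⟨d, hd⟩, h⟩
      choose f hf using this
      have hfi : Function.Injective f := fun i j h => by
        have := hf i
        rw [h, hf j] at this
        exact Fin.ext (Option.some.inj this).symm
      obtain ⟨i, hi⟩ := (Finite.injective_iff_surjective.1 hfi) c
      have := hf i
      rw [hi, hnone] at this
      exact absurd this (by simp)
    refine Matrix.det_eq_zero_of_row_eq_zero i fun c => ?_
    rw [elimMatrix_mul_apply W A hW]
    exact elim_T_eq_zero c.2 i.2 (elim_unused_of_le c.2 hi)

end ElimTheory

/-! ### Determinant, left kernel and rank -/

/-- The leading square part of an array. -/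
def State.mat (σ : State K) (T : ℤ) (W : ℕ) : Matrix (Fin W) (Fin W) K :=
  Matrix.of fun i j => σ.arr T i j

theorem State.mat_congr {σ τ : State K} {T T' : ℤ} {W : ℕ}
    (h : ∀ i < W, ∀ j < W, σ.arr T i j = τ.arr T' i j) : σ.mat T W = τ.mat T' W := by
  ext i j; exact h i i.2 j j.2

theorem wp_mulCall_mat {mm : Cmd K} {μ : ℕ → ℕ} (hmm : Multiplies mm μ) {σ₀ : State K} {w : ℕ}
    (hw : 0 < w) (h7 : σ₀.var 7 = w) (hf : Fresh σ₀) :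
    wp (mulCall mm) (fun σ t => t ≤ μ w ∧ Fresh σ ∧ σ.mat 16 w = σ₀.mat 14 w * σ₀.mat 15 w) σ₀ := by
  refine (wp_mulCall hmm hw h7 hf).mono ?_
  rintro σ t ⟨ht, hf', h⟩
  refine ⟨ht, hf', ?_⟩
  ext i j
  rw [Matrix.mul_apply]
  refine (h i i.2 j j.2).trans ?_
  rw [Finset.sum_range]
  rfl

/-- Copy a square array of size variable `2`. -/
def copyArray (T T' : ℤ) : Cmd K :=
  forLoops 22 (.var 2) 23 (.var 2) (.copy [.const T, .var 22, .var 23] [.const T', .var 22, .var 23])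

theorem wp_copyArray {T T' : ℤ} (hT : T ≠ T') {W : ℕ} {σ₀ : State K} (h2 : σ₀.var 2 = W) :
    wp (copyArray T T') (fun σ t => t = 0 ∧ σ.mat T W = σ₀.mat T' W) σ₀ := by
  refine (wp_fill W W 0 [T] 0 0 (fun i j => σ₀.arr T' i j) rfl rfl (by decide) ?_ ?_ ?_).mono ?_
  · intro σ h; exact (h.var 2 (by simp)).trans h2
  · intro σ h; exact (h.var 2 (by simp)).trans h2
  · intro i hi j hj σ hF hσ hσ' _ _
    rw [wp_copy]
    have ef := hF.fld T' (by simp [hT])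
    simp [State.addr, IExp.eval, hσ, hσ', ef, State.arr]
  · rintro σ t ⟨ht, h, -⟩
    refine ⟨by simpa using ht, State.mat_congr fun i hi j hj => ?_⟩
    simpa [State.arr] using h i hi j hj

theorem elim_sgn (W : ℕ) (A : ℕ → ℕ → K) (u : ℕ) :
    (elim W A u).sgn = 1 ∨ (elim W A u).sgn = -1 := by
  rw [← Int.isUnit_iff]
  induction u with
  | zero => exact isUnit_one
  | succ u ih =>
    rw [elim_succ_sgn]
    cases elimPivot W A u with
    | none => exact ih
    | some p =>
      refine ih.mul ?_
      rw [Int.isUnit_iff]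
      refine Finset.prod_induction _ (fun x : ℤ => x = 1 ∨ x = -1) ?_ (Or.inl rfl) ?_
      · rintro _ _ (rfl | rfl) (rfl | rfl) <;> simp
      · intro i _; split_ifs <;> simp

/-- The determinant of the matrix in the array `10` goes into `fld[12, 0]`. -/
def determinant (mm : Cmd K) : Cmd K :=
  .seq (eliminate mm) <|
  .seq (.setConst [.const 12, .const 2] 0) <|
  .ifPos (.var 5) .skip (.arith .sub [.const 12, .const 0] [.const 12, .const 2] [.const 12, .const 0])

theorem elimInput_arr (σ : State K) (T : ℤ) (W : ℕ) : elimInput W (σ.arr T) = σ.mat T W := rfl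

theorem wp_determinant {mm : Cmd K} {μ : ℕ → ℕ} (hmm : Multiplies mm μ) {W l : ℕ}
    (hW : W = 2 ^ l) {σ₀ : State K} (h2 : σ₀.var 2 = W) (hf : Fresh σ₀) :
    wp (determinant mm) (fun σ t => t ≤ blockCost μ W l + 1 ∧ Fresh σ ∧ σ.var 2 = W ∧
      σ.fld [12, 0] = (σ₀.mat 10 W).det) σ₀ := by
  refine wp_seq_of (wp_eliminate hmm hW (A := σ₀.arr 10) h2 hf fun _ _ _ _ => rfl) ?_
  rintro σ t ⟨ht, hd⟩ -
  have hW0 : 0 < W := by rw [hW]; positivity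
  have hdet := det_elimInput W (σ₀.arr 10) hW0
  rw [elimInput_arr] at hdet
  have h12 : σ.fld [12, 0] = (elim W (σ₀.arr 10) W).det := by simpa using hd.holds.det
  have h5 : σ.var 5 = (elim W (σ₀.arr 10) W).sgn := by simpa using hd.holds.sgn
  rw [wp_seq, wp_setConst, wp_ifPos, wp_skip, wp_arith]
  have hfr : ∀ x y : K, Fresh { σ with fld := Function.update (Function.update σ.fld [12, 2] x) [12, 0] y } :=
    fun x y z hz a => by simpa using hd.fresh z hz a
  have hfr' : ∀ x : K, Fresh { σ with fld := Function.update σ.fld [12, 2] x } :=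
    fun x z hz a => by simpa using hd.fresh z hz a
  simp only [State.addr, List.map_cons, List.map_nil, IExp.eval, h5]
  rcases elim_sgn W (σ₀.arr 10) W with h | h
  · rw [h, if_pos (by norm_num)]
    refine ⟨by omega, hfr' 0, hd.size, ?_⟩
    simp [h12, hdet, h]
  · rw [h, if_neg (by norm_num)]
    refine ⟨by simp, by omega, hfr 0 _, hd.size, ?_⟩
    simp [h12, hdet, h, Op.eval]

/-- After an elimination, write the matrix whose rows generate the left kernel into the array `14`. -/
def kernelRows : Cmd K :=
  .seq (forLoops 22 (.var 2) 23 (.var 2) (.setConst [.const 14, .var 22, .var 23] 0)) <|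
  forLoop 22 (.var 2) <|
  .seq (.loadInt 9 [.const 21, .var 22]) <|
  .ifPos (.var 9) .skip <|
  .seq (.setConst [.const 14, .var 22, .var 22] 1) <|
  forLoop 23 (.var 2) <|
  .seq (.loadInt 8 [.const 20, .var 23]) <|
  .arith .sub [.const 14, .var 22, .var 8] [.const 14, .var 22, .var 8] [.const 10, .var 22, .var 23]

/-- For the block of all columns, the formula in `BlockDone.block`, applied to unit vectors, gives
the matrix of the transformation: the identity, with the stored entry (i, c) subtracted in the
column numbered by the pivot row of c. Each unused row thus costs W subtractions and no product is
needed. Several c may share the dummy row 0, so the entries are accumulated. -/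
theorem wp_kernelRows {W : ℕ} {A : ℕ → ℕ → K} {σ' σ₀ : State K} (hd : BlockDone W A 0 W σ' σ₀) :
    wp kernelRows (fun σ t => t ≤ W * W ∧ σ.mat 14 W = elimKernel W A) σ₀ := by
  refine wp_seq_of (wp_fill W W 0 [14] 0 0 (fun _ _ => 0) rfl rfl (by decide) ?_ ?_ ?_) ?_
  · intro σ h; exact (h.var 2 (by simp)).trans hd.size
  · intro σ h; exact (h.var 2 (by simp)).trans hd.size
  · intro i hi j hj σ hF hσ hσ' _ _
    rw [wp_setConst]
    simp [State.addr, IExp.eval, hσ, hσ']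
  rintro σ₁ t₁ ⟨ht₁, hz, -⟩ hF₁
  have h21 : σ₁.var 2 = W := (hF₁.var 2 (by simp)).trans hd.size
  have hflag : ∀ i < W, σ₁.int [21, (i : ℕ)] = if (elim W A W).used i = true then 1 else 0 := by
    intro i hi
    rw [hF₁.int 21 (by simp), hd.holds.used i hi, zero_add]
  have hpiv : ∀ c < W, σ₁.int [20, (c : ℕ)] = ((elimPivot W A c).getD 0 : ℕ) := by
    intro c hc
    rw [hF₁.int 20 (by simp)]
    simpa using hd.pivots c hc
  have hz' : ∀ i < W, ∀ j < W, σ₁.arr 14 i j = 0 := by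
    intro i hi j hj; simpa [State.arr] using hz i hi j hj
  refine (wp_forLoop W (fun n σ =>
    (∀ i < n, ∀ j < W, σ.arr 14 i j = if (elim W A W).used i = true then 0 else
      (Pi.single j 1 : ℕ → K) i -
        ∑ c ∈ Finset.range W, σ₁.arr 10 i c * (Pi.single j 1 : ℕ → K) ((elimPivot W A c).getD 0)) ∧
    ∀ i j, n ≤ i → σ.arr 14 i j = σ₁.arr 14 i j) (fun _ => W) (by simp) ?_ ?_ ?_).mono ?_
  · intro σ h; exact (h.var 2 (by simp)).trans h21
  · exact ⟨by simp, fun i j _ => rfl⟩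
  · rintro n hn σ₂ hF₂ hσ₂ ⟨hI, hI'⟩
    rw [wp_seq, wp_loadInt, wp_ifPos]
    have e21 := hF₂.int 21 (by simp) [(n : ℤ)]
    simp only [IExp.eval, State.addr, List.map_cons, List.map_nil, hσ₂, Function.update_self, e21,
      hflag n hn]
    by_cases hu : (elim W A W).used n = true
    · rw [if_pos (by simp [hu]), wp_skip]
      refine ⟨by simp, fun i hi j hj => ?_, fun i j hi => hI' i j (by omega)⟩
      rcases Nat.lt_succ_iff_lt_or_eq.1 hi with hi | rfl
      · exact hI i hi j hj
      · exact ((hI' i j le_rfl).trans (hz' i hn j hj)).trans (if_pos hu).symm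
    · rw [if_neg (by simp [hu]), wp_seq, wp_setConst]
      refine (wp_forLoop W (fun k σ =>
        (∀ j < W, σ.arr 14 n j = (Pi.single j 1 : ℕ → K) n -
          ∑ c ∈ Finset.range k, σ₁.arr 10 n c * (Pi.single j 1 : ℕ → K) ((elimPivot W A c).getD 0)) ∧
        ∀ i j, i ≠ n → σ.arr 14 i j = σ₂.arr 14 i j) (fun _ => 1) (by simp) ?_ ?_ ?_).mono ?_
      · intro σ h
        have e1 := (h.var 2 (by simp))
        have e2 := (hF₂.var 2 (by simp)).trans h21
        simpa [e2, IExp.eval] using e1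
      · refine ⟨fun j hj => ?_, fun i j hi => ?_⟩
        · by_cases hjn : j = n
          · simp [State.arr, State.addr, IExp.eval, hσ₂, hjn]
          · have := hI' n j le_rfl
            rw [hz' n hn j hj] at this
            simp only [State.arr] at this
            simp [State.arr, State.addr, IExp.eval, hσ₂, hjn, this, Ne.symm hjn]
        · simp [State.arr, State.addr, IExp.eval, hσ₂, hi]
      · rintro k hk σ₃ hF₃ hσ₃ ⟨hJ, hJ'⟩
        have e20 : σ₃.int [20, (k : ℤ)] = ((elimPivot W A k).getD 0 : ℕ) := by
          rw [hF₃.int 20 (by simp), ← hpiv k hk]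
          exact hF₂.int 20 (by simp) _
        have e22 : σ₃.var 22 = n := by
          have := hF₃.var 22 (by simp)
          simpa [hσ₂] using this
        have e10 : σ₃.fld [10, (n : ℤ), (k : ℤ)] = σ₁.arr 10 n k := by
          have := (hF₃.fld 10 (by simp)) [(n : ℤ), (k : ℤ)]
          rw [this]
          simpa [State.arr, State.addr, IExp.eval] using hF₂.fld 10 (by simp) [(n : ℤ), (k : ℤ)]
        rw [wp_seq, wp_loadInt, wp_arith]
        have hpW := elimPivot_lt (by omega : 0 < W) A k
        have hJp := hJ _ hpW
        simp only [State.arr] at hJp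
        refine ⟨by simp, by simp, fun j hj => ?_, fun i j hi => ?_⟩
        · rw [Finset.sum_range_succ]
          by_cases hjp : j = (elimPivot W A k).getD 0
          · rw [hjp]
            simp only [State.arr] at e10
            simp [State.arr, State.addr, IExp.eval, Op.eval, hσ₃, e20, e22, hJp, e10]
            ring
          · have := hJ j hj
            simp only [State.arr] at this
            simp [State.arr, State.addr, IExp.eval, hσ₃, e20, e22, hjp, this, Ne.symm hjp]
        · rw [← hJ' i j hi]
          simp [State.arr, State.addr, IExp.eval, hσ₃, e20, e22, hi]
      · rintro σ₃ t₃ ⟨ht₃, hJ, hJ'⟩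
        refine ⟨by simpa using ht₃, fun i hi j hj => ?_, fun i j hi => ?_⟩
        · rcases Nat.lt_succ_iff_lt_or_eq.1 hi with hi | rfl
          · rw [← hI i hi j hj]
            exact hJ' i j (by omega)
          · rw [if_neg hu]
            exact hJ j hj
        · exact (hJ' i j (by omega)).trans (hI' i j (by omega))
  · rintro σ t ⟨ht, hI, -⟩
    refine ⟨by simp at ht ht₁; omega, ?_⟩
    ext i j
    refine (hI i i.2 j j.2).trans ?_
    simp only [elimKernel, Matrix.of_apply, elimMatrix]
    refine if_congr Iff.rfl rfl ?_
    have hb := hd.block (Pi.single (j : ℕ) 1) i i.2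
    simp only [zero_add] at hb
    rw [hb]
    have e10 : ∀ c, σ₁.arr 10 i c = σ₀.arr 10 i c := fun c => hF₁.fld 10 (by simp) _
    simp only [e10]
    rfl

/-- Replace the matrix in the array `11`, whose rows generate a left kernel, by a matrix whose rows
generate the part of it that is annihilated by the matrix in the array `15`. -/
def shrinkKernel (mm : Cmd K) : Cmd K :=
  .seq (copyArray 14 11) <|
  .seq (.setVar 7 (.var 2)) <|
  .seq (mulCall mm) <|
  .seq (copyArray 10 16) <|
  .seq (eliminate mm) <|
  .seq kernelRows <|
  .seq (copyArray 15 11) <|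
  .seq (mulCall mm) <|
  copyArray 11 16

/-- Let K be in the array `11` and B in the array `15`. If the rows of N generate the left kernel of
K B, then the row space of N K consists of the vectors w K with w K B = 0. This takes two products
and one elimination. -/
theorem wp_shrinkKernel {mm : Cmd K} {μ : ℕ → ℕ} (hmm : Multiplies mm μ) {W l : ℕ}
    (hW : W = 2 ^ l) {σ₀ : State K} (h2 : σ₀.var 2 = W) (hf : Fresh σ₀) :
    wp (shrinkKernel mm) (fun σ t => t ≤ 2 * μ W + blockCost μ W l + W * W ∧ Fresh σ ∧
      ∀ v, (∃ w, v = Matrix.vecMul w (σ.mat 11 W)) ↔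
        (∃ w, v = Matrix.vecMul w (σ₀.mat 11 W)) ∧ Matrix.vecMul v (σ₀.mat 15 W) = 0) σ₀ := by
  have hW0 : 0 < W := by rw [hW]; positivity
  refine wp_seq_of (wp_copyArray (by decide) h2) ?_
  rintro σ₁ t₁ ⟨rfl, h1⟩ hF₁
  rw [wp_seq, wp_setVar]
  have h21 : σ₁.var 2 = W := (hF₁.var 2 (by simp [copyArray])).trans h2
  have hf1 : Fresh σ₁ := hf.of_frame hF₁ (by simp [copyArray]) (by simp [copyArray])
    (by simp [copyArray])
  have a1 : ∀ T, T ≠ 14 → σ₁.mat T W = σ₀.mat T W := fun T hT => State.mat_congr fun i _ j _ =>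
    hF₁.fld T (by simp [copyArray, hT.symm]) _
  refine wp_seq_of (wp_mulCall_mat hmm hW0 (by simp [IExp.eval, h21])
    (fun z hz a => hf1 z (by simpa using hz) a)) ?_
  rintro σ₂ t₂ ⟨ht₂, hf2, hp2⟩ hF₂
  have h22 : σ₂.var 2 = W := by
    have := hF₂.var 2 (by simp)
    simpa [h21] using this
  have a2 : ∀ T, T ≠ 14 → T ≠ 16 → T ≠ 100 → σ₂.mat T W = σ₀.mat T W := fun T hT hT' hT'' => by
    rw [← a1 T hT]
    exact State.mat_congr fun i _ j _ => hF₂.fld T (keepsFld_mulCall mm hT'' hT') _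
  change σ₂.mat 16 W = σ₁.mat 14 W * σ₁.mat 15 W at hp2
  rw [h1, a1 15 (by decide)] at hp2
  refine wp_seq_of (wp_copyArray (by decide) h22) ?_
  rintro σ₃ t₃ ⟨rfl, h3⟩ hF₃
  have h23 : σ₃.var 2 = W := (hF₃.var 2 (by simp [copyArray])).trans h22
  have hf3 : Fresh σ₃ := hf2.of_frame hF₃ (by simp [copyArray]) (by simp [copyArray])
    (by simp [copyArray])
  rw [hp2] at h3
  refine wp_seq_of (wp_eliminate hmm hW (A := σ₃.arr 10) h23 hf3 fun _ _ _ _ => rfl) ?_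
  rintro σ₄ t₄ ⟨ht₄, hd⟩ hF₄
  refine wp_seq_of (wp_kernelRows hd) ?_
  rintro σ₅ t₅ ⟨ht₅, hk⟩ hF₅
  have h25 : σ₅.var 2 = W := (hF₅.var 2 (by simp [kernelRows])).trans hd.size
  have h75 : σ₅.var 7 = W := (hF₅.var 7 (by simp [kernelRows])).trans hd.width
  have hf5 : Fresh σ₅ := hd.fresh.of_frame hF₅ (by simp [kernelRows]) (by simp [kernelRows])
    (by simp [kernelRows])
  have a5 : σ₅.mat 11 W = σ₀.mat 11 W := by
    rw [← a2 11 (by decide) (by decide) (by decide)]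
    refine State.mat_congr fun i _ j _ => (hF₅.fld 11 (by simp [kernelRows]) _).trans
      ((hF₄.fld 11 ?_ _).trans (hF₃.fld 11 (by simp [copyArray]) _))
    simp [eliminate, eliminateColumn, eliminateLoop, blockUpdate]
  refine wp_seq_of (wp_copyArray (by decide) h25) ?_
  rintro σ₆ t₆ ⟨rfl, h6⟩ hF₆
  have h26 : σ₆.var 2 = W := (hF₆.var 2 (by simp [copyArray])).trans h25
  have h76 : σ₆.var 7 = W := (hF₆.var 7 (by simp [copyArray])).trans h75
  have hf6 : Fresh σ₆ := hf5.of_frame hF₆ (by simp [copyArray]) (by simp [copyArray])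
    (by simp [copyArray])
  have a6 : σ₆.mat 14 W = elimKernel W (σ₃.arr 10) := by
    rw [← hk]
    exact State.mat_congr fun i _ j _ => hF₆.fld 14 (by simp [copyArray]) _
  refine wp_seq_of (wp_mulCall_mat hmm hW0 h76 hf6) ?_
  rintro σ₇ t₇ ⟨ht₇, hf7, hp7⟩ hF₇
  have h27 : σ₇.var 2 = W := (hF₇.var 2 (by simp)).trans h26
  refine (wp_copyArray (by decide) h27).framed.mono ?_
  rintro σ₈ t₈ ⟨⟨rfl, h8⟩, hF₈⟩
  refine ⟨by omega, hf7.of_frame hF₈ (by simp [copyArray]) (by simp [copyArray])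
    (by simp [copyArray]), fun v => ?_⟩
  have hker := vecMul_elimInput_eq_zero_iff W (σ₃.arr 10) hW0
  rw [elimInput_arr, h3] at hker
  rw [h8, hp7, a6, h6, a5]
  constructor
  · rintro ⟨w, rfl⟩
    rw [← Matrix.vecMul_vecMul]
    refine ⟨⟨_, rfl⟩, ?_⟩
    rw [Matrix.vecMul_vecMul]
    exact (hker _).2 ⟨w, rfl⟩
  · rintro ⟨⟨w, rfl⟩, hv⟩
    rw [Matrix.vecMul_vecMul] at hv
    obtain ⟨w', rfl⟩ := (hker w).1 hv
    exact ⟨w', by rw [Matrix.vecMul_vecMul]⟩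

/-! ### Padding -/

section Padding

variable {m n : ℕ}

/-- A square matrix, enlarged to size `W` by an identity matrix. -/
def padded (W : ℕ) (M : Matrix (Fin m) (Fin m) K) : Matrix (Fin W) (Fin W) K :=
  Matrix.of fun i j => if h : (i : ℕ) < m ∧ (j : ℕ) < m then M ⟨i, h.1⟩ ⟨j, h.2⟩
    else if i = j then 1 else 0

theorem det_padded {W : ℕ} (hmW : m ≤ W) (M : Matrix (Fin m) (Fin m) K) :
    (padded W M).det = M.det := by
  obtain ⟨k, rfl⟩ := Nat.exists_eq_add_of_le hmW
  rw [← Matrix.det_submatrix_equiv_self finSumFinEquiv]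
  have : (padded (m + k) M).submatrix finSumFinEquiv finSumFinEquiv = Matrix.fromBlocks M 0 0 1 := by
    ext (i | i) (j | j)
    · simp [padded]
    · have : (i : ℕ) ≠ m + j := by omega
      simp [padded, Fin.ext_iff, this]
    · have : m + (i : ℕ) ≠ j := by omega
      simp [padded, Fin.ext_iff, this]
    · simp [padded, Matrix.one_apply, Fin.ext_iff]
  rw [this, Matrix.det_fromBlocks_zero₂₁, Matrix.det_one, mul_one]

theorem sum_dite_lt {W : ℕ} (hmW : m ≤ W) (g : Fin m → K) :
    ∑ i : Fin W, (if h : (i : ℕ) < m then g ⟨i, h⟩ else 0) = ∑ i, g i := by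
  obtain ⟨k, rfl⟩ := Nat.exists_eq_add_of_le hmW
  simp [Fin.sum_univ_add]

theorem vecMul_padded_eq_zero_iff {W : ℕ} (hmW : m ≤ W) (M : Matrix (Fin m) (Fin m) K)
    (v : Fin W → K) : Matrix.vecMul v (padded W M) = 0 ↔
      Matrix.vecMul (fun i : Fin m => v (Fin.castLE hmW i)) M = 0 ∧
        ∀ i : Fin W, m ≤ (i : ℕ) → v i = 0 := by
  have hlow : ∀ j : Fin m, Matrix.vecMul v (padded W M) (Fin.castLE hmW j) =
      Matrix.vecMul (fun i : Fin m => v (Fin.castLE hmW i)) M j := by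
    intro j
    simp only [Matrix.vecMul, dotProduct]
    rw [← sum_dite_lt hmW]
    refine Finset.sum_congr rfl fun i _ => ?_
    by_cases hi : (i : ℕ) < m
    · simp [padded, hi]
    · have : i ≠ Fin.castLE hmW j := fun h => hi (by rw [h]; exact j.2)
      simp [padded, hi, this]
  have hhigh : ∀ j : Fin W, m ≤ (j : ℕ) → Matrix.vecMul v (padded W M) j = v j := by
    intro j hj
    simp only [Matrix.vecMul, dotProduct]
    rw [Finset.sum_eq_single j]
    · simp [padded, Nat.not_lt.2 hj]
    · intro i _ hij
      simp [padded, Nat.not_lt.2 hj, hij]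
    · simp
  constructor
  · intro h
    refine ⟨funext fun j => ?_, fun i hi => ?_⟩
    · rw [← hlow, h]; rfl
    · rw [← hhigh i hi, h]; rfl
  · rintro ⟨h, h'⟩
    ext j
    by_cases hj : (j : ℕ) < m
    · exact (hlow ⟨j, hj⟩).trans (congrFun h _)
    · rw [hhigh j (by omega), h' j (by omega)]; rfl

/-- The matrix `[A B]`, with `A` padded, is cut into square blocks of size `W`. -/
def chunk (W : ℕ) (A : Matrix (Fin m) (Fin m) K) (B : Matrix (Fin m) (Fin n) K) :
    ℕ → Matrix (Fin W) (Fin W) K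
  | 0 => padded W A
  | l + 1 => Matrix.of fun i j =>
      if h : (i : ℕ) < m ∧ l * W + j < n then B ⟨i, h.1⟩ ⟨l * W + j, h.2⟩ else 0

/-- The identity that pads A forces the additional coordinates of v to be zero; on the other
coordinates the chunks are made of the columns of A and B and of zero columns. One chunk holds A,
and `n / W + 1` chunks suffice for the columns of B. -/
theorem forall_chunk_iff {W : ℕ} (hmW : m ≤ W) (hW : 0 < W) (A : Matrix (Fin m) (Fin m) K)
    (B : Matrix (Fin m) (Fin n) K) :
    (∀ v, (∀ l < n / W + 2, Matrix.vecMul v (chunk W A B l) = 0) → v = 0) ↔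
      ∀ v, Matrix.vecMul v A = 0 → Matrix.vecMul v B = 0 → v = 0 := by
  have hcol : ∀ (v : Fin W → K) (l : ℕ) (j : Fin W) (h : l * W + j < n),
      Matrix.vecMul v (chunk W A B (l + 1)) j =
        Matrix.vecMul (fun i : Fin m => v (Fin.castLE hmW i)) B ⟨l * W + j, h⟩ := by
    intro v l j h
    simp only [Matrix.vecMul, dotProduct]
    rw [← sum_dite_lt hmW]
    refine Finset.sum_congr rfl fun i _ => ?_
    by_cases hi : (i : ℕ) < m <;> simp [chunk, hi, h]
  constructor
  · intro h v hA hB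
    set v' : Fin W → K := fun i => if hi : (i : ℕ) < m then v ⟨i, hi⟩ else 0 with hv'
    have hres : (fun i : Fin m => v' (Fin.castLE hmW i)) = v := by
      ext i; simp [hv']
    have h0 := h v' ?_
    · rw [← hres, h0]; rfl
    · rintro (_ | l) _
      · rw [chunk, vecMul_padded_eq_zero_iff hmW, hres]
        exact ⟨hA, fun i hi => by simp [hv', Nat.not_lt.2 hi]⟩
      · ext j
        by_cases hj : l * W + j < n
        · rw [hcol v' l j hj, hres, hB]; rfl
        · simp [Matrix.vecMul, dotProduct, chunk, hj]
  · intro h v hv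
    have h0 := hv 0 (Nat.succ_pos _)
    rw [chunk, vecMul_padded_eq_zero_iff hmW] at h0
    have := h _ h0.1 ?_
    · ext i
      by_cases hi : (i : ℕ) < m
      · exact congrFun this ⟨i, hi⟩
      · exact h0.2 i (by omega)
    · ext c
      have hc : (c : ℕ) / W * W + c % W = c := by rw [mul_comm]; exact Nat.div_add_mod _ _
      have h1 := hcol v (c / W) ⟨c % W, Nat.mod_lt _ hW⟩ (by simp only [hc]; exact c.2)
      simp only [hc] at h1
      rw [← h1, hv _ (by have := Nat.div_le_div_right (c := W) c.2.le; omega)]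
      rfl

end Padding

/-- Write the identity matrix of size variable `2` into the array `T`. -/
def identityArray (T : ℤ) : Cmd K :=
  forLoops 22 (.var 2) 23 (.var 2) <|
    .seq (.setConst [.const T, .var 22, .var 23] 0) <|
    -- Integer branches only test positivity; 1 - (i - j)^2 is positive exactly on the diagonal.
    .ifPos (.sub (.const 1) (.mul (.sub (.var 22) (.var 23)) (.sub (.var 22) (.var 23))))
      (.setConst [.const T, .var 22, .var 23] 1) .skip

theorem wp_identityArray (T : ℤ) {W : ℕ} {σ₀ : State K} (h2 : σ₀.var 2 = W) :
    wp (identityArray T) (fun σ t => t = 0 ∧ σ.mat T W = 1) σ₀ := by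
  refine (wp_fill W W 0 [T] 0 0 (fun i j => if i = j then 1 else 0) (by simp) (by simp) (by decide)
    ?_ ?_ ?_).mono ?_
  · intro σ h; exact (h.var 2 (by simp)).trans h2
  · intro σ h; exact (h.var 2 (by simp)).trans h2
  · intro i hi j hj σ hF hσ hσ' _ _
    rw [wp_seq, wp_setConst, wp_ifPos, wp_setConst, wp_skip]
    simp only [State.addr, IExp.eval, List.map_cons, List.map_nil, hσ, hσ', List.cons_append,
      List.nil_append, zero_add]
    by_cases hij : i = j
    · simp [hij]
    · have h0 : ((i : ℤ) - j) ≠ 0 := by omega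
      have : ¬ (0 : ℤ) < 1 - ((i : ℤ) - j) * (i - j) := by
        have : 0 < ((i : ℤ) - j) * (i - j) := mul_self_pos.2 h0
        omega
      rw [if_neg this]
      simp [hij]
  · rintro σ t ⟨ht, h, -⟩
    refine ⟨by simpa using ht, ?_⟩
    ext i j
    have := h i i.2 j j.2
    simp only [List.cons_append, List.nil_append, zero_add] at this
    simp [State.mat, State.arr, this, Matrix.one_apply, Fin.ext_iff]

/-- A double loop that writes a matrix into the corner of an array that holds the identity. -/
theorem mat_eq_padded {m W : ℕ} {σ σ₀ : State K} {T : ℤ} (M : Matrix (Fin m) (Fin m) K)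
    (h0 : σ₀.mat T W = 1) (h : ∀ i j : Fin m, σ.arr T i j = M i j)
    (h' : ∀ l, (∀ i < m, ∀ j < m, l ≠ [T] ++ [(0 : ℤ) + (i : ℕ), 0 + (j : ℕ)]) → σ.fld l = σ₀.fld l) :
    σ.mat T W = padded W M := by
  ext i j
  by_cases hij : (i : ℕ) < m ∧ (j : ℕ) < m
  · rw [padded, Matrix.of_apply, dif_pos hij]
    exact h ⟨i, hij.1⟩ ⟨j, hij.2⟩
  · rw [padded, Matrix.of_apply, dif_neg hij, ← Matrix.one_apply, ← h0]
    refine h' _ fun i' hi' j' hj' => ?_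
    simp
    omega

/-- If the matrix in the array `11` is not zero, variable `4` is set to zero. -/
def zeroTest : Cmd K :=
  forLoop 22 (.var 2) <| forLoop 23 (.var 2) <|
    .ifZero [.const 11, .var 22, .var 23] .skip (.setVar 4 (.const 0))

open Classical in
theorem wp_zeroTest {W : ℕ} {σ₀ : State K} (h2 : σ₀.var 2 = W) :
    wp zeroTest (fun σ t => t ≤ W * W ∧ σ.var 4 = if σ₀.mat 11 W = 0 then σ₀.var 4 else 0) σ₀ := by
  refine (wp_forLoop W (fun n σ => σ.fld = σ₀.fld ∧ σ.var 4 =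
    if ∀ i < n, ∀ j < W, σ₀.arr 11 i j = 0 then σ₀.var 4 else 0) (fun _ => W) (by simp) ?_ ?_ ?_).mono ?_
  · intro σ h; exact (h.var 2 (by simp)).trans h2
  · simp
  · rintro i hi σ hF hσ ⟨hf, h4⟩
    have e2 := (hF.var 2 (by simp)).trans h2
    refine (wp_forLoop W (fun k σ' => σ'.fld = σ₀.fld ∧ σ'.var 4 =
      if (∀ i' < i, ∀ j < W, σ₀.arr 11 i' j = 0) ∧ ∀ j < k, σ₀.arr 11 i j = 0 then σ₀.var 4 else 0)
      (fun _ => 1) (by simp) ?_ ?_ ?_).mono ?_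
    · intro σ' h; exact (h.var 2 (by simp)).trans e2
    · simp [hf, h4]
    · rintro j hj σ' hF' hσ' ⟨hf', h4'⟩
      have e22 := (hF'.var 22 (by simp)).trans hσ
      have hsucc : (∀ j' < j + 1, σ₀.arr 11 i j' = 0) ↔
          (∀ j' < j, σ₀.arr 11 i j' = 0) ∧ σ₀.arr 11 i j = 0 := by
        constructor
        · exact fun h => ⟨fun j' hj' => h j' (by omega), h j (by omega)⟩
        · rintro ⟨h, h'⟩ j' hj'
          rcases Nat.lt_succ_iff_lt_or_eq.1 hj' with h1 | rfl
          · exact h j' h1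
          · exact h'
      rw [wp_ifZero, wp_skip, wp_setVar]
      simp only [State.addr, IExp.eval, List.map_cons, List.map_nil, e22, hσ', hf', hsucc]
      by_cases h0 : σ₀.arr 11 i j = 0
      · rw [if_pos (by exact h0)]
        simp [hf', h4', h0]
      · rw [if_neg (by exact h0)]
        simp [h0]
    · rintro σ' t ⟨ht, hf', h4'⟩
      refine ⟨by simpa using ht, hf', ?_⟩
      simp only [State.setVar_var]
      rw [Function.update_of_ne (by decide), h4']
      refine if_congr ?_ rfl rfl
      constructor
      · rintro ⟨h, h'⟩ i' hi'
        rcases Nat.lt_succ_iff_lt_or_eq.1 hi' with h1 | rfl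
        · exact h i' h1
        · exact h'
      · exact fun h => ⟨fun i' hi' => h i' (by omega), h i (by omega)⟩
  · rintro σ t ⟨ht, -, h4⟩
    refine ⟨by simpa using ht, h4.trans (if_congr ?_ rfl rfl)⟩
    constructor
    · intro h; ext i j; exact h i i.2 j j.2
    · intro h i hi j hj
      exact congrFun (congrFun h ⟨i, hi⟩) ⟨j, hj⟩

/-! ### The certification program and its specification on encoded instances -/

variable {m n : ℕ}

/-! ### Reading the input -/

/-- The state still contains the input, and `W` is in variable `2`. -/
structure Input (I : CertInstance K m n) (r : Fin (m + 2) → K) (W : ℕ) (σ : State K) : Prop where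
  rows : σ.var 0 = m
  cols : σ.var 1 = n
  size : σ.var 2 = W
  fresh : Fresh σ
  int : ∀ z, 0 ≤ z ∧ z ≤ 2 → ∀ a, σ.int (z :: a) = (I.init r).int (z :: a)
  fld : ∀ z, 0 ≤ z ∧ z ≤ 3 → ∀ a, σ.fld (z :: a) = (I.init r).fld (z :: a)

/-- The program does not change the input. -/
structure KeepsInput (p : Cmd K) : Prop where
  var : ∀ v ≤ 2, p.keepsVar v = true
  int : ∀ z : ℤ, 0 ≤ z ∧ z ≤ 2 → p.keepsInt z = true
  fld : ∀ z : ℤ, 0 ≤ z ∧ z ≤ 3 → p.keepsFld z = true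

theorem KeepsInput.of_bool {p : Cmd K} (h : (p.keepsVar 0 = true ∧ p.keepsVar 1 = true ∧
    p.keepsVar 2 = true) ∧ (p.keepsInt 0 = true ∧ p.keepsInt 1 = true ∧ p.keepsInt 2 = true) ∧
    (p.keepsFld 0 = true ∧ p.keepsFld 1 = true ∧ p.keepsFld 2 = true ∧ p.keepsFld 3 = true)) :
    KeepsInput p := by
  obtain ⟨⟨h0, h1, h2⟩, ⟨h3, h4, h5⟩, h6, h7, h8, h9⟩ := h
  refine ⟨fun v hv => ?_, fun z hz => ?_, fun z hz => ?_⟩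
  · interval_cases v <;> assumption
  · obtain ⟨hz, hz'⟩ := hz
    interval_cases z <;> assumption
  · obtain ⟨hz, hz'⟩ := hz
    interval_cases z <;> assumption

namespace Input

variable {I : CertInstance K m n} {r : Fin (m + 2) → K} {W : ℕ} {σ σ' : State K}

theorem of_frame {p : Cmd K} (h : Input I r W σ) (hF : Frame p σ σ') (hp : KeepsInput p)
    (hf : Fresh σ') : Input I r W σ' where
  rows := (hF.var 0 (hp.var 0 (by decide))).trans h.rows
  cols := (hF.var 1 (hp.var 1 (by decide))).trans h.cols
  size := (hF.var 2 (hp.var 2 (by decide))).trans h.size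
  fresh := hf
  int z hz a := (hF.int z (hp.int z hz) a).trans (h.int z hz a)
  fld z hz a := (hF.fld z (hp.fld z hz) a).trans (h.fld z hz a)

theorem of_frame_fresh {p : Cmd K} (h : Input I r W σ) (hF : Frame p σ σ') (hp : KeepsInput p)
    (hf : p.keepsVar 3 = true ∧ p.keepsInt 100 = true ∧ p.keepsFld 100 = true) : Input I r W σ' :=
  h.of_frame hF hp (h.fresh.of_frame hF hf.1 hf.2.1 hf.2.2)

theorem order (h : Input I r W σ) (j : Fin n) : σ.int [0, ((j : ℕ) : ℤ)] = I.d j := by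
  rw [h.int 0 (by decide)]
  change cells (fun j => (I.d j : ℤ)) _ = _
  rw [cells_natCast]

theorem shift (h : Input I r W σ) (i : Fin m) : σ.int [1, ((i : ℕ) : ℤ)] = I.s i := by
  rw [h.int 1 (by decide)]
  exact cells_natCast _ i

theorem deg (h : Input I r W σ) (i j : Fin m) :
    σ.int [2, ((i : ℕ) : ℤ), ((j : ℕ) : ℤ)] = (I.P i j).natDegree := by
  rw [h.int 2 (by decide)]
  change cells (fun i => cells (fun j => ((I.P i j).natDegree : ℤ)) _) _ = _
  rw [cells_natCast, cells_natCast]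

theorem coeffP (h : Input I r W σ) (i j : Fin m) (k : ℕ) :
    σ.fld [0, ((i : ℕ) : ℤ), ((j : ℕ) : ℤ), (k : ℤ)] = (I.P i j).coeff k := by
  rw [h.fld 0 (by decide)]
  change cells (fun i => cells (fun j =>
    cells (fun k : Fin ((I.P i j).natDegree + 1) => (I.P i j).coeff k) _) _) _ = _
  rw [cells_natCast, cells_natCast]
  by_cases hk : k < (I.P i j).natDegree + 1
  · exact cells_natCast _ (⟨k, hk⟩ : Fin _)
  · rw [cells_eq_zero _ (by push_cast; omega), coeff_eq_zero_of_natDegree_lt (by omega)]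

theorem coeffP_neg (h : Input I r W σ) (i j : Fin m) {z : ℤ} (hz : z < 0) :
    σ.fld [0, ((i : ℕ) : ℤ), ((j : ℕ) : ℤ), z] = 0 := by
  rw [h.fld 0 (by decide)]
  change cells (fun i => cells (fun j =>
    cells (fun k : Fin ((I.P i j).natDegree + 1) => (I.P i j).coeff k) _) _) _ = _
  rw [cells_natCast, cells_natCast]
  exact cells_eq_zero _ (by omega)

theorem coeffF (h : Input I r W σ) (i : Fin m) (j : Fin n) (k : ℕ) :
    σ.fld [1, ((i : ℕ) : ℤ), ((j : ℕ) : ℤ), (k : ℤ)] = (I.F i j).coeff k := by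
  rw [h.fld 1 (by decide)]
  change cells (fun i => cells (fun j =>
    cells (fun k : Fin (I.d j) => (I.F i j).coeff k) _) _) _ = _
  rw [cells_natCast, cells_natCast]
  by_cases hk : k < I.d j
  · exact cells_natCast _ (⟨k, hk⟩ : Fin _)
  · rw [cells_eq_zero _ (by omega), coeff_eq_zero_of_degree_lt]
    refine (I.F_deg i j).trans_le ?_
    exact_mod_cast Nat.le_of_not_lt hk

theorem cert (h : Input I r W σ) (i : Fin m) (j : Fin n) :
    σ.fld [2, ((i : ℕ) : ℤ), ((j : ℕ) : ℤ)] = I.C i j := by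
  rw [h.fld 2 (by decide)]
  change cells (fun i => cells (I.C i) _) _ = _
  rw [cells_natCast, cells_natCast]

theorem cert_eq_zero (h : Input I r W σ) {i j : ℕ} (hij : ¬ (i < m ∧ j < n)) :
    σ.fld [2, (i : ℤ), (j : ℤ)] = 0 := by
  rw [h.fld 2 (by decide)]
  change cells (fun i => cells (I.C i) (j : ℤ)) (i : ℤ) = 0
  by_cases hi : i < m
  · refine (cells_natCast _ (⟨i, hi⟩ : Fin m)).trans (cells_eq_zero _ ?_)
    omega
  · exact cells_eq_zero _ (by omega)

theorem rand (h : Input I r W σ) (i : Fin (m + 2)) : σ.fld [3, ((i : ℕ) : ℤ)] = r i := by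
  rw [h.fld 3 (by decide)]
  exact cells_natCast _ i

end Input

/-! ### The rank test -/

/-- The constant coefficient of `P`. -/
def constCoeff (P : Matrix (Fin m) (Fin m) K[X]) : Matrix (Fin m) (Fin m) K :=
  P.map fun p => p.coeff 0

/-- Write the block whose number is in variable `25` into the array `15`. -/
def loadChunk : Cmd K :=
  .ifPos (.var 25)
    (forLoops 22 (.var 2) 23 (.var 2) (.copy [.const 15, .var 22, .var 23]
      [.const 2, .var 22, .add (.mul (.sub (.var 25) (.const 1)) (.var 2)) (.var 23)]))
    (.seq (identityArray 15) (forLoops 22 (.var 0) 23 (.var 0)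
      (.copy [.const 15, .var 22, .var 23] [.const 0, .var 22, .var 23, .const 0])))

theorem wp_loadChunk {I : CertInstance K m n} {r : Fin (m + 2) → K} {W : ℕ} {σ₀ : State K}
    (h : Input I r W σ₀) {l : ℕ} (h25 : σ₀.var 25 = l) :
    wp loadChunk (fun σ t => t = 0 ∧ σ.mat 15 W = chunk W (constCoeff I.P) I.C l) σ₀ := by
  rw [loadChunk, wp_ifPos]
  simp only [IExp.eval, h25]
  cases l with
  | zero =>
    rw [if_neg (by simp)]
    refine wp_seq_of (wp_identityArray 15 h.size) ?_
    rintro σ₁ t₁ ⟨rfl, h1⟩ hF₁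
    have hI := h.of_frame_fresh hF₁ (.of_bool (by simp [identityArray])) (by simp [identityArray])
    refine (wp_fill m m 0 [15] 0 0 (fun i j => σ₁.fld [0, (i : ℕ), (j : ℕ), 0]) rfl rfl (by decide)
      ?_ ?_ ?_).mono ?_
    · intro σ hF; exact (hF.var 0 (by simp)).trans hI.rows
    · intro σ hF; exact (hF.var 0 (by simp)).trans hI.rows
    · intro i hi j hj σ hF hσ hσ' _ _
      rw [wp_copy]
      have ef := hF.fld 0 (by simp)
      simp [State.addr, IExp.eval, hσ, hσ', ef]
    · rintro σ t ⟨ht, hfill, hsame⟩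
      refine ⟨by simpa using ht, mat_eq_padded _ h1 (fun i j => ?_) hsame⟩
      have := hfill i i.2 j j.2
      simp only [List.cons_append, List.nil_append, zero_add] at this
      exact this.trans (hI.coeffP i j 0)
  | succ l =>
    rw [if_pos (by push_cast; omega)]
    refine (wp_fill W W 0 [15] 0 0 (fun i j => σ₀.fld [2, (i : ℕ), ((l * W + j : ℕ) : ℤ)]) rfl rfl
      (by decide) ?_ ?_ ?_).mono ?_
    · intro σ hF; exact (hF.var 2 (by simp)).trans h.size
    · intro σ hF; exact (hF.var 2 (by simp)).trans h.size
    · intro i hi j hj σ hF hσ hσ' _ _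
      rw [wp_copy]
      have ef := hF.fld 2 (by simp)
      have e2 := (hF.var 2 (by simp)).trans h.size
      have e25 := (hF.var 25 (by simp)).trans h25
      simp [State.addr, IExp.eval, hσ, hσ', ef, e2, e25]
    · rintro σ t ⟨ht, hfill, -⟩
      refine ⟨by simpa using ht, ?_⟩
      ext i j
      have := hfill i i.2 j j.2
      simp only [List.cons_append, List.nil_append, zero_add] at this
      refine this.trans ?_
      rw [chunk, Matrix.of_apply]
      split_ifs with hij
      · exact h.cert ⟨i, hij.1⟩ ⟨_, hij.2⟩
      · exact h.cert_eq_zero hij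

/-- Test whether `[P(0) C]` has rank `m`; if not, variable `4` is set to zero. -/
def rankTest (mm : Cmd K) : Cmd K :=
  .seq (identityArray 11) <|
  .seq (forLoop 25 (.add (.div (.var 1) (.var 2)) (.const 2))
    (.seq loadChunk (shrinkKernel mm))) <|
  zeroTest

theorem keepsInput_shrinkKernel (mm : Cmd K) : KeepsInput (shrinkKernel mm) :=
  .of_bool (by simp [shrinkKernel, copyArray, eliminate, eliminateColumn, eliminateLoop,
    blockUpdate, kernelRows])

/-- The left kernel of `[P(0) C]` is trivial. -/
def CertInstance.FullRank (I : CertInstance K m n) : Prop :=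
  ∀ v, Matrix.vecMul v (constCoeff I.P) = 0 → Matrix.vecMul v I.C = 0 → v = 0

open Classical in
-- The row space of the array `11` is the common left kernel of the chunks treated so far, starting
-- with the whole space. At the end this array is zero if and only if the left kernel of [P(0) C] is
-- trivial. Keeping a square, possibly redundant set of generators makes every round cost the same.
theorem wp_rankTest {mm : Cmd K} {μ : ℕ → ℕ} (hmm : Multiplies mm μ) {W l : ℕ}
    (hW : W = 2 ^ l) (hmW : m ≤ W) {I : CertInstance K m n} {r : Fin (m + 2) → K} {σ₀ : State K}
    (h : Input I r W σ₀) :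
    wp (rankTest mm) (fun σ t =>
      t ≤ (n / W + 2) * (2 * μ W + blockCost μ W l + W * W) + W * W ∧ Input I r W σ ∧
      σ.var 4 = if CertInstance.FullRank I then σ₀.var 4 else 0) σ₀ := by
  have hW0 : 0 < W := by rw [hW]; positivity
  refine wp_seq_of (wp_identityArray 11 h.size) ?_
  rintro σ₁ t₁ ⟨rfl, h1⟩ hF₁
  have hI₁ := h.of_frame_fresh hF₁ (.of_bool (by simp [identityArray])) (by simp [identityArray])
  have h41 : σ₁.var 4 = σ₀.var 4 := hF₁.var 4 (by simp [identityArray])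
  refine wp_seq_of (wp_forLoop (n / W + 2) (fun k σ => Fresh σ ∧
    ∀ v, (∃ w, v = Matrix.vecMul w (σ.mat 11 W)) ↔
      ∀ k' < k, Matrix.vecMul v (chunk W (constCoeff I.P) I.C k') = 0)
    (fun _ => 2 * μ W + blockCost μ W l + W * W) ?_ ?_ ?_ ?_) ?_
  · simp [loadChunk, identityArray, shrinkKernel, copyArray, eliminate, eliminateColumn,
      eliminateLoop, blockUpdate, kernelRows]
  · intro σ hF
    have e1 := (hF.var 1 (by simp [loadChunk, identityArray,
      (keepsInput_shrinkKernel mm).var 1])).trans hI₁.cols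
    have e2 := (hF.var 2 (by simp [loadChunk, identityArray,
      (keepsInput_shrinkKernel mm).var 2])).trans hI₁.size
    simp only [IExp.eval, e1, e2]
    push_cast
    rfl
  · refine ⟨fun z hz a => hI₁.fresh z (by simpa using hz) a, fun v => ?_⟩
    change (∃ w, v = Matrix.vecMul w (σ₁.mat 11 W)) ↔ _
    simp [h1]
  · rintro k hk σ₂ hF₂ h25 ⟨hf2, hker⟩
    have hI₂ : Input I r W σ₂ := by
      refine hI₁.of_frame hF₂ (.of_bool ?_) hf2
      have hk := keepsInput_shrinkKernel mm
      simp [loadChunk, identityArray, hk.var, hk.int, hk.fld]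
    refine wp_seq_of (wp_loadChunk hI₂ h25) ?_
    rintro σ₃ t₃ ⟨rfl, h3⟩ hF₃
    have hI₃ := hI₂.of_frame_fresh hF₃ (.of_bool (by simp [loadChunk, identityArray]))
      (by simp [loadChunk, identityArray])
    have a3 : σ₃.mat 11 W = σ₂.mat 11 W := State.mat_congr fun i _ j _ =>
      hF₃.fld 11 (by simp [loadChunk, identityArray]) _
    refine (wp_shrinkKernel hmm hW hI₃.size hI₃.fresh).mono ?_
    rintro σ₄ t₄ ⟨ht₄, hf4, h4⟩
    refine ⟨by simpa using ht₄, fun z hz a => hf4 z (by simpa using hz) a, fun v => ?_⟩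
    change (∃ w, v = Matrix.vecMul w (σ₄.mat 11 W)) ↔ _
    rw [h4 v, a3, hker v, h3]
    constructor
    · rintro ⟨ha, hb⟩ k' hk'
      rcases Nat.lt_succ_iff_lt_or_eq.1 hk' with hk' | rfl
      · exact ha k' hk'
      · exact hb
    · exact fun ha => ⟨fun k' hk' => ha k' (by omega), ha k (by omega)⟩
  rintro σ₂ t₂ ⟨ht₂, hf2, hker⟩ hF₂
  have hI₂ : Input I r W σ₂ := by
    refine hI₁.of_frame hF₂ (.of_bool ?_) hf2
    have hk := keepsInput_shrinkKernel mm
    simp [loadChunk, identityArray, hk.var, hk.int, hk.fld]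
  have h42 : σ₂.var 4 = σ₁.var 4 := hF₂.var 4 (by
    simp [loadChunk, identityArray, shrinkKernel, copyArray, eliminate, eliminateColumn,
      eliminateLoop, blockUpdate, kernelRows])
  refine (wp_zeroTest hI₂.size).framed.mono ?_
  rintro σ₃ t₃ ⟨⟨ht₃, h43⟩, hF₃⟩
  refine ⟨?_, hI₂.of_frame_fresh hF₃ (.of_bool (by simp [zeroTest])) (by simp [zeroTest]), ?_⟩
  · simp only [Finset.sum_const, Finset.card_range, smul_eq_mul] at ht₂
    omega
  · rw [h43, h42, h41]
    refine if_congr ?_ rfl rfl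
    rw [CertInstance.FullRank, ← forall_chunk_iff hmW hW0]
    constructor
    · intro h0 v hv
      obtain ⟨w, rfl⟩ := (hker v).2 hv
      rw [h0, Matrix.vecMul_zero]
    · intro h0
      ext i j
      have := h0 (Matrix.vecMul (Pi.single i 1) (σ₂.mat 11 W)) ((hker _).1 ⟨_, rfl⟩)
      have := congrFun this j
      simpa using this

/-! ### The leading matrix -/

/-- The shifted degree of a row, `0` for the zero row. -/
def rowDegree (s : Fin m → ℤ) (P : Matrix (Fin m) (Fin m) K[X]) (i : Fin m) : ℤ :=
  (shiftedRowDegree s P i).unbotD 0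

/-- The maximum over the first `k` columns in the definition of the shifted degree. -/
def partialRowDegree (s : Fin m → ℤ) (P : Matrix (Fin m) (Fin m) K[X]) (i : Fin m) (k : ℕ) :
    WithBot ℤ :=
  (Finset.univ.filter fun j : Fin m => (j : ℕ) < k).sup
    fun j => (P i j).degree.map fun d : ℕ => (d : ℤ) + s j

theorem partialRowDegree_zero (s : Fin m → ℤ) (P : Matrix (Fin m) (Fin m) K[X]) (i : Fin m) :
    partialRowDegree s P i 0 = ⊥ := by
  simp [partialRowDegree]

theorem partialRowDegree_self (s : Fin m → ℤ) (P : Matrix (Fin m) (Fin m) K[X]) (i : Fin m) :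
    partialRowDegree s P i m = shiftedRowDegree s P i := by
  simp [partialRowDegree, shiftedRowDegree]

theorem partialRowDegree_succ (s : Fin m → ℤ) (P : Matrix (Fin m) (Fin m) K[X]) (i j : Fin m) :
    partialRowDegree s P i (j + 1) = partialRowDegree s P i j ⊔
      (P i j).degree.map fun d : ℕ => (d : ℤ) + s j := by
  have : (Finset.univ.filter fun j' : Fin m => (j' : ℕ) < j + 1) =
      insert j (Finset.univ.filter fun j' : Fin m => (j' : ℕ) < j) := by
    ext j'
    simp [Fin.ext_iff]
    omega
  rw [partialRowDegree, this, Finset.sup_insert, sup_comm]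
  rfl

/-- For a zero row, `rowDegree` replaces ⊥ by 0. This does no harm: the entry is then a coefficient
of the zero polynomial. -/
theorem leadingMatrix_apply (s : Fin m → ℤ) (P : Matrix (Fin m) (Fin m) K[X]) (i j : Fin m) :
    leadingMatrix s P i j =
      if 0 ≤ rowDegree s P i - s j then (P i j).coeff (rowDegree s P i - s j).toNat else 0 := by
  rw [leadingMatrix, rowDegree]
  cases hd : shiftedRowDegree s P i with
  | bot =>
    have hP : P i j = 0 := by
      have : (P i j).degree.map (fun d : ℕ => (d : ℤ) + s j) ≤ ⊥ := by
        rw [← hd]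
        exact Finset.le_sup (f := fun j => (P i j).degree.map fun d : ℕ => (d : ℤ) + s j)
          (Finset.mem_univ j)
      rw [le_bot_iff, WithBot.map_eq_bot_iff, degree_eq_bot] at this
      exact this
    simp [hP]
  | coe z => rfl

/-- Cells at negative positions or beyond the degree of an entry hold 0, so the leading matrix can
be copied from the input without any test of the range. -/
theorem leadingMatrix_eq {I : CertInstance K m n} {r : Fin (m + 2) → K} {W : ℕ} {σ : State K}
    (h : Input I r W σ) (i j : Fin m) :
    σ.fld [0, ((i : ℕ) : ℤ), ((j : ℕ) : ℤ), rowDegree I.s I.P i - I.s j] =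
      leadingMatrix I.s I.P i j := by
  have hval : ∀ z : ℤ, σ.fld [0, ((i : ℕ) : ℤ), ((j : ℕ) : ℤ), z] =
      if 0 ≤ z then (I.P i j).coeff z.toNat else 0 := by
    intro z
    split_ifs with hz
    · lift z to ℕ using hz
      exact h.coeffP i j z
    · exact h.coeffP_neg i j (by omega)
  rw [hval, leadingMatrix_apply]

theorem sum_ite_lt_succ {M : Type*} [AddCommMonoid M] {N : ℕ} (f : Fin N → M) (i : Fin N) :
    ∑ i' : Fin N, (if (i' : ℕ) < (i : ℕ) + 1 then f i' else 0) =
      ∑ i' : Fin N, (if (i' : ℕ) < (i : ℕ) then f i' else 0) + f i := by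
  rw [← Finset.sum_erase_add _ _ (Finset.mem_univ i),
    ← Finset.sum_erase_add Finset.univ (fun i' : Fin N => if (i' : ℕ) < (i : ℕ) then
      f i' else 0) (Finset.mem_univ i)]
  simp only [Nat.lt_succ_self, if_true, lt_irrefl, if_false, add_zero]
  congr 1
  refine Finset.sum_congr rfl fun i' hi' => ?_
  have hne : (i' : ℕ) ≠ i := fun hc => Finset.ne_of_mem_erase hi' (Fin.ext hc)
  have : (i' : ℕ) < i + 1 ↔ (i' : ℕ) < i := by omega
  simp only [this]

/-- Compute the shifted row degrees; the sum of the differences to the shift goes into variable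
`11`. -/
def rowDegrees : Cmd K :=
  .seq (.setVar 11 (.const 0)) <|
  forLoop 22 (.var 0) <|
  .seq (.setVar 12 (.const 0)) <|
  .seq (.setVar 13 (.const 0)) <|
  .seq (forLoop 23 (.var 0) <|
    .seq (.loadInt 9 [.const 2, .var 22, .var 23]) <|
    .seq (.loadInt 14 [.const 1, .var 23]) <|
    .seq (.setVar 14 (.add (.var 9) (.var 14))) <|
    .ifZero [.const 0, .var 22, .var 23, .var 9] .skip <|
    .ifPos (.var 12) (.ifPos (.sub (.var 14) (.var 13)) (.setVar 13 (.var 14)) .skip) <|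
    .seq (.setVar 12 (.const 1)) (.setVar 13 (.var 14))) <|
  .seq (.storeInt [.const 22, .var 22] (.var 13)) <|
  .seq (.loadInt 14 [.const 1, .var 22]) <|
  .setVar 11 (.add (.var 11) (.sub (.var 13) (.var 14)))

theorem wp_rowDegrees {I : CertInstance K m n} {r : Fin (m + 2) → K} {W : ℕ} {σ₀ : State K}
    (h : Input I r W σ₀) :
    wp rowDegrees (fun σ t => t ≤ m * m ∧
      σ.var 11 = ∑ i, (rowDegree I.s I.P i - I.s i) ∧
      ∀ i : Fin m, σ.int [22, ((i : ℕ) : ℤ)] = rowDegree I.s I.P i) σ₀ := by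
  classical
  rw [rowDegrees, wp_seq, wp_setVar]
  set σ₁ : State K := { σ₀ with var := Function.update σ₀.var 11 (IExp.eval σ₀.var (.const 0)) }
  have hI₁ : Input I r W σ₁ := ⟨h.rows, h.cols, h.size, h.fresh, h.int, h.fld⟩
  refine (wp_forLoop m (fun k σ =>
    σ.var 11 = ∑ i : Fin m, (if (i : ℕ) < k then rowDegree I.s I.P i - I.s i else 0) ∧
    ∀ i : Fin m, (i : ℕ) < k → σ.int [22, ((i : ℕ) : ℤ)] = rowDegree I.s I.P i) (fun _ => m)
    (by simp) ?_ ?_ ?_).mono ?_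
  · intro σ hF; exact (hF.var 0 (by simp)).trans hI₁.rows
  · simp [σ₁, IExp.eval]
  · rintro k hk σ₂ hF₂ h22 ⟨h11, hdeg⟩
    have hI₂ := hI₁.of_frame_fresh hF₂ (.of_bool (by simp)) (by simp)
    simp only [wp_seq, wp_setVar]
    obtain ⟨i, rfl⟩ : ∃ i : Fin m, (i : ℕ) = k := ⟨⟨k, hk⟩, rfl⟩
    -- Variable `13` cannot tell ⊥ from a maximum equal to 0, so variable `12` records whether a
    -- nonzero entry has been met.
    refine (wp_forLoop m (fun k' σ =>
      σ.var 13 = (partialRowDegree I.s I.P i k').unbotD 0 ∧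
      σ.var 12 = if partialRowDegree I.s I.P i k' = ⊥ then 0 else 1) (fun _ => 1)
      (by simp) ?_ ?_ ?_).framed.mono ?_
    · intro σ hF
      have := hF.var 0 (by simp)
      simpa [hI₂.rows, IExp.eval] using this
    · simp [partialRowDegree_zero, IExp.eval]
    · rintro k' hk' σ₃ hF₃ h23 ⟨h13, h12⟩
      obtain ⟨j, rfl⟩ : ∃ j : Fin m, (j : ℕ) = k' := ⟨⟨k', hk'⟩, rfl⟩
      have e22 : σ₃.var 22 = (i : ℕ) := by
        have := hF₃.var 22 (by simp)
        simpa [h22] using this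
      have edeg : σ₃.int [2, ((i : ℕ) : ℤ), ((j : ℕ) : ℤ)] = (I.P i j).natDegree :=
        (hF₃.int 2 (by simp) _).trans (hI₂.deg i j)
      have eshift : σ₃.int [1, ((j : ℕ) : ℤ)] = I.s j := (hF₃.int 1 (by simp) _).trans (hI₂.shift j)
      have eP : σ₃.fld [0, ((i : ℕ) : ℤ), ((j : ℕ) : ℤ), ((I.P i j).natDegree : ℤ)] =
          (I.P i j).leadingCoeff := (hF₃.fld 0 (by simp) _).trans (hI₂.coeffP i j _)
      rw [partialRowDegree_succ]
      simp only [wp_seq, wp_loadInt, wp_setVar, wp_ifZero, wp_ifPos, wp_skip, State.addr, IExp.eval,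
        List.map_cons, List.map_nil]
      -- The degree stored for the zero polynomial is 0, so zero entries are recognized by a zero
      -- test of the coefficient at the stored degree. These tests are the only cost.
      by_cases hP : I.P i j = 0
      · have hz : (I.P i j).leadingCoeff = 0 := by rw [hP, leadingCoeff_zero]
        have hdz : (I.P i j).degree = ⊥ := by rw [hP, degree_zero]
        simp [e22, h23, edeg, eshift, eP, hz, hdz, h13, h12]
      · have hz : (I.P i j).leadingCoeff ≠ 0 := leadingCoeff_ne_zero.2 hP
        obtain ⟨d, hd⟩ : ∃ d : ℤ, ((I.P i j).natDegree : ℤ) + I.s j = d := ⟨_, rfl⟩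
        have hmap : WithBot.map (fun d : ℕ => (d : ℤ) + I.s j) (I.P i j).degree =
            (d : WithBot ℤ) := by
          rw [degree_eq_natDegree hP, ← hd]
          rfl
        rw [hmap]
        generalize hx : partialRowDegree I.s I.P i j = x at h12 h13 ⊢
        cases x with
        | bot => simp [e22, h23, edeg, eshift, eP, hz, h12, hd]
        | coe z =>
          have hsup : ((z : ℤ) : WithBot ℤ) ⊔ (d : WithBot ℤ) = ((max z d : ℤ) : WithBot ℤ) := rfl
          rw [hsup]
          simp only [WithBot.unbotD_coe] at h13
          by_cases hlt : z < d
          · simp [e22, h23, edeg, eshift, eP, hz, h13, h12, hlt, hd, max_eq_right hlt.le]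
          · have hle : d ≤ z := not_lt.1 hlt
            simp [e22, h23, edeg, eshift, eP, hz, h13, h12, hlt, hd, max_eq_left hle]
    · rintro σ₃ t₃ ⟨⟨ht₃, h13, -⟩, hF₃⟩
      rw [partialRowDegree_self] at h13
      simp only [wp_storeInt, wp_loadInt]
      have e22 : σ₃.var 22 = (i : ℕ) := by
        have := hF₃.var 22 (by simp)
        simpa [h22] using this
      have e11 : σ₃.var 11 = σ₂.var 11 := by
        have := hF₃.var 11 (by simp)
        simpa using this
      have eshift : σ₃.int [1, ((i : ℕ) : ℤ)] = I.s i := (hF₃.int 1 (by simp) _).trans (hI₂.shift i)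
      refine ⟨by simpa using ht₃, ?_, fun i' hi' => ?_⟩
      · rw [sum_ite_lt_succ, ← h11, ← e11]
        simp [State.addr, IExp.eval, e22, eshift, h13, rowDegree]
      · by_cases hii : (i' : ℕ) = i
        · simp [State.addr, IExp.eval, e22, h13, rowDegree, Fin.ext hii]
        · simp [State.addr, IExp.eval, e22, hii]
          rw [hF₃.int 22 (by simp)]
          exact hdeg i' (by omega)
  · rintro σ t ⟨ht, h11, hdeg⟩
    exact ⟨by simpa using ht, by simpa using h11, fun i => hdeg i i.2⟩

/-- Write the leading matrix into the array `10`. -/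
def leading : Cmd K :=
  .seq rowDegrees <|
  .seq (identityArray 10) <|
  forLoops 22 (.var 0) 23 (.var 0) <|
    .seq (.loadInt 9 [.const 22, .var 22]) <|
    .seq (.loadInt 8 [.const 1, .var 23]) <|
    .copy [.const 10, .var 22, .var 23] [.const 0, .var 22, .var 23, .sub (.var 9) (.var 8)]

theorem wp_leading {I : CertInstance K m n} {r : Fin (m + 2) → K} {W : ℕ} {σ₀ : State K}
    (h : Input I r W σ₀) :
    wp leading (fun σ t => t ≤ m * m ∧
      σ.var 11 = ∑ i, (rowDegree I.s I.P i - I.s i) ∧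
      σ.mat 10 W = padded W (leadingMatrix I.s I.P)) σ₀ := by
  refine wp_seq_of (wp_rowDegrees h) ?_
  rintro σ₁ t₁ ⟨ht₁, h11, hdeg⟩ hF₁
  have hI₁ := h.of_frame_fresh hF₁ (.of_bool (by simp [rowDegrees])) (by simp [rowDegrees])
  refine wp_seq_of (wp_identityArray 10 hI₁.size) ?_
  rintro σ₂ t₂ ⟨rfl, hid⟩ hF₂
  have hI₂ := hI₁.of_frame_fresh hF₂ (.of_bool (by simp [identityArray])) (by simp [identityArray])
  refine (wp_fill m m 0 [10] 0 0 (fun i j => σ₂.fld [0, (i : ℕ), (j : ℕ),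
    σ₁.int [22, (i : ℕ)] - σ₂.int [1, (j : ℕ)]]) rfl rfl (by decide) ?_ ?_ ?_).framed.mono ?_
  · intro σ hF; exact (hF.var 0 (by simp)).trans hI₂.rows
  · intro σ hF; exact (hF.var 0 (by simp)).trans hI₂.rows
  · intro i hi j hj σ hF hσ hσ' _ _
    have e22 := fun a => (hF.int 22 (by simp) a).trans (hF₂.int 22 (by simp [identityArray]) a)
    have e1 := hF.int 1 (by simp)
    have e0 := hF.fld 0 (by simp)
    simp [wp_seq, wp_loadInt, wp_copy, State.addr, IExp.eval, hσ, hσ', e22, e1, e0]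
  · rintro σ t ⟨⟨ht, hfill, hsame⟩, hF⟩
    refine ⟨by simp at ht; omega, ?_, mat_eq_padded _ hid (fun i j => ?_) hsame⟩
    · rw [hF.var 11 (by simp), hF₂.var 11 (by simp [identityArray]), h11]
    · have := hfill i i.2 j j.2
      simp only [List.cons_append, List.nil_append, zero_add] at this
      refine this.trans ?_
      rw [hdeg i, hI₂.shift j]
      exact leadingMatrix_eq hI₂ i j

/-! ### Evaluation -/

/-- Write `P(α)` into the array `10`, where `α` is the first random element. -/
def evaluate : Cmd K :=
  .seq (identityArray 10) <|
  forLoops 22 (.var 0) 23 (.var 0) <|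
    .seq (.loadInt 9 [.const 2, .var 22, .var 23]) <|
    .seq (.setConst [.const 10, .var 22, .var 23] 0) <|
    forLoop 24 (.add (.var 9) (.const 1)) <|
    .seq (.arith .mul [.const 10, .var 22, .var 23] [.const 10, .var 22, .var 23]
      [.const 3, .const 0]) <|
    .arith .add [.const 10, .var 22, .var 23] [.const 10, .var 22, .var 23]
      [.const 0, .var 22, .var 23, .sub (.var 9) (.var 24)]

theorem wp_evaluate {I : CertInstance K m n} {r : Fin (m + 2) → K} {W : ℕ} {σ₀ : State K}
    (h : Input I r W σ₀) :
    wp evaluate (fun σ t => t ≤ 2 * matrixSize I.P ∧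
      σ.mat 10 W = padded W (I.P.map (eval (r 0)))) σ₀ := by
  refine wp_seq_of (wp_identityArray 10 h.size) ?_
  rintro σ₁ t₁ ⟨rfl, hid⟩ hF₁
  have hI₁ := h.of_frame_fresh hF₁ (.of_bool (by simp [identityArray])) (by simp [identityArray])
  refine (wp_fill_sum m m
    (fun i j => if hij : i < m ∧ j < m then 2 * ((I.P ⟨i, hij.1⟩ ⟨j, hij.2⟩).natDegree + 1) else 0)
    [10] 0 0
    (fun i j => if hij : i < m ∧ j < m then (I.P ⟨i, hij.1⟩ ⟨j, hij.2⟩).eval (r 0) else 0)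
    (by simp) (by simp) (by decide) ?_ ?_ ?_).mono ?_
  · intro σ hF; exact (hF.var 0 (by simp)).trans hI₁.rows
  · intro σ hF; exact (hF.var 0 (by simp)).trans hI₁.rows
  · intro i hi j hj σ₂ hF₂ hσ hσ' _ _
    obtain ⟨i, rfl⟩ : ∃ i' : Fin m, (i' : ℕ) = i := ⟨⟨i, hi⟩, rfl⟩
    obtain ⟨j, rfl⟩ : ∃ j' : Fin m, (j' : ℕ) = j := ⟨⟨j, hj⟩, rfl⟩
    have hI₂ := hI₁.of_frame_fresh hF₂ (.of_bool (by simp)) (by simp)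
    simp only [i.2, j.2, and_self, dif_pos, Fin.eta]
    rw [wp_seq, wp_loadInt, wp_seq, wp_setConst]
    obtain ⟨D, hD⟩ : ∃ D, (I.P i j).natDegree = D := ⟨_, rfl⟩
    simp only [State.addr, IExp.eval, List.map_cons, List.map_nil, hσ, hσ', List.cons_append,
      List.nil_append, zero_add]
    simp only [hI₂.deg i j, hD]
    -- Horner's rule from the top: after `k` rounds the `D + 1 - k` lowest coefficients are still to
    -- be absorbed, and the current value `x` stands in front of the power with that exponent.
    refine (wp_forLoop (D + 1) (fun k σ => ∃ x : K,
      σ.fld = Function.update σ₂.fld [10, ((i : ℕ) : ℤ), ((j : ℕ) : ℤ)] x ∧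
      x * r 0 ^ (D + 1 - k) + ∑ e ∈ Finset.range (D + 1 - k), (I.P i j).coeff e * r 0 ^ e =
        (I.P i j).eval (r 0)) (fun _ => 2) (by simp) ?_ ?_ ?_).mono ?_
    · intro σ hF
      have := hF.var 9 (by simp)
      simp [IExp.eval, this]
    · refine ⟨0, ?_, ?_⟩
      · simp [hσ, hσ']
      · rw [zero_mul, zero_add, Nat.sub_zero, eval_eq_sum_range, hD]
    · rintro k hk σ₃ hF₃ h24 ⟨x, hx, hsum⟩
      have e22 : σ₃.var 22 = (i : ℕ) := by
        have := hF₃.var 22 (by simp)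
        simpa [hσ] using this
      have e23 : σ₃.var 23 = (j : ℕ) := by
        have := hF₃.var 23 (by simp)
        simpa [hσ'] using this
      have e9 : σ₃.var 9 = D := by
        have := hF₃.var 9 (by simp)
        simpa using this
      have er : σ₃.fld [3, 0] = r 0 := by
        rw [hx, Function.update_of_ne (by simp)]
        exact hI₂.rand 0
      have eP₂ : σ₂.fld [0, ((i : ℕ) : ℤ), ((j : ℕ) : ℤ), (D : ℤ) - k] =
          (I.P i j).coeff (D - k) := by
        rw [← hI₂.coeffP i j (D - k), Nat.cast_sub (by omega)]
      have ex : σ₃.fld [10, ((i : ℕ) : ℤ), ((j : ℕ) : ℤ)] = x := by rw [hx, Function.update_self]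
      rw [wp_seq, wp_arith, wp_arith]
      refine ⟨by simp, by simp, by simp, x * r 0 + (I.P i j).coeff (D - k), ?_, ?_⟩
      · simp [State.addr, IExp.eval, e22, e23, e9, h24, er, eP₂, ex, Op.eval, hx]
      · rw [← hsum, show D + 1 - k = (D - k) + 1 by omega, Finset.sum_range_succ,
          show D + 1 - (k + 1) = D - k by omega]
        ring
    · rintro σ t ⟨ht, x, hx, hsum⟩
      refine ⟨by simp at ht ⊢; omega, ?_⟩
      simp only [Nat.sub_self, pow_zero, mul_one, Finset.range_zero, Finset.sum_empty, add_zero] at hsum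
      rw [hx, hsum]
  · rintro σ t ⟨ht, hfill, hsame⟩
    refine ⟨(zero_add t).trans_le (ht.trans (le_of_eq ?_)), mat_eq_padded _ hid (fun i j => ?_) hsame⟩
    · rw [Finset.sum_range, matrixSize]
      have : ∀ i : Fin m, ∑ j ∈ Finset.range m, (if hij : (i : ℕ) < m ∧ j < m then
          2 * ((I.P ⟨i, hij.1⟩ ⟨j, hij.2⟩).natDegree + 1) else 0) =
          2 * (m + ∑ j, (I.P i j).natDegree) := by
        intro i
        rw [Finset.sum_range]
        simp [← Finset.mul_sum, Finset.sum_add_distrib]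
        ring
      simp only [this, ← Finset.mul_sum, Finset.sum_add_distrib]
      simp
      ring
    · have := hfill i i.2 j j.2
      simp only [List.cons_append, List.nil_append, zero_add] at this
      exact this.trans (by simp)

/-! ### The determinant test -/

/-- The sum of the differences between the shifted row degrees and the shift: the degree of the
determinant if the matrix is reduced. -/
def degreeSum (s : Fin m → ℤ) (P : Matrix (Fin m) (Fin m) K[X]) : ℤ :=
  ∑ i, (rowDegree s P i - s i)

/-- The sum of the order goes into variable `17`. -/
def orderSum : Cmd K :=
  .seq (.setVar 17 (.const 0)) <|
  forLoop 22 (.var 1) <|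
  .seq (.loadInt 9 [.const 0, .var 22]) (.setVar 17 (.add (.var 17) (.var 9)))

theorem wp_orderSum {I : CertInstance K m n} {r : Fin (m + 2) → K} {W : ℕ} {σ₀ : State K}
    (h : Input I r W σ₀) : wp orderSum (fun σ t => t = 0 ∧ σ.var 17 = I.sigma) σ₀ := by
  rw [orderSum, wp_seq, wp_setVar]
  refine (wp_forLoop n (fun k σ =>
    σ.var 17 = ((∑ j : Fin n, (if (j : ℕ) < k then I.d j else 0) : ℕ) : ℤ)) (fun _ => 0)
    (by simp) ?_ ?_ ?_).mono ?_
  · intro σ hF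
    have := hF.var 1 (by simp)
    simpa [h.cols, IExp.eval] using this
  · simp [IExp.eval]
  · rintro k hk σ hF h22 h17
    obtain ⟨j, rfl⟩ : ∃ j : Fin n, (j : ℕ) = k := ⟨⟨k, hk⟩, rfl⟩
    have e0 : σ.int [0, ((j : ℕ) : ℤ)] = I.d j := (hF.int 0 (by simp) _).trans (h.order j)
    rw [wp_seq, wp_loadInt, wp_setVar, sum_ite_lt_succ]
    simp [State.addr, IExp.eval, h22, e0, h17]
  · rintro σ t ⟨ht, h17⟩
    refine ⟨by simpa using ht, ?_⟩
    rw [h17]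
    simp [CertInstance.sigma]

/-- Compare the determinant in `fld[12, 0]` to the one in `fld[13, 0]` times the power of the first
random element whose exponent is in variable `11`. -/
def compareDet : Cmd K :=
  .ifPos (.sub (.var 11) (.var 17)) (.setVar 4 (.const 0)) <|
  .ifZero [.const 13, .const 0] (.setVar 4 (.const 0)) <|
  .seq (.ifPos (.var 11) (forLoop 22 (.var 11)
    (.arith .mul [.const 13, .const 0] [.const 13, .const 0] [.const 3, .const 0])) .skip) <|
  .seq (.arith .sub [.const 13, .const 0] [.const 13, .const 0] [.const 12, .const 0]) <|
  .ifZero [.const 13, .const 0] .skip (.setVar 4 (.const 0))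

open Classical in
-- The exponent is compared to `N` first, so that the power costs at most `N` multiplications; two
-- zero tests and a subtraction are added. A negative exponent counts as 0, in agreement with
-- `Int.toNat`.
theorem wp_compareDet {N : ℕ} {Δ : ℤ} {σ₀ : State K} (h17 : σ₀.var 17 = N) (h11 : σ₀.var 11 = Δ) :
    wp compareDet (fun σ t => t ≤ N + 3 ∧
      σ.var 4 = if Δ ≤ N ∧ σ₀.fld [13, 0] ≠ 0 ∧
        σ₀.fld [13, 0] * σ₀.fld [3, 0] ^ Δ.toNat = σ₀.fld [12, 0] then σ₀.var 4 else 0) σ₀ := by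
  rw [compareDet, wp_ifPos]
  simp only [IExp.eval, h17, h11]
  by_cases hΔ : Δ ≤ N
  swap
  · rw [if_pos (by omega), wp_setVar]
    simp [IExp.eval, hΔ]
  rw [if_neg (by omega), wp_ifZero]
  simp only [State.addr, IExp.eval, List.map_cons, List.map_nil]
  by_cases hL : σ₀.fld [13, 0] = 0
  · rw [if_pos hL, wp_setVar]
    simp [IExp.eval, hL]
  rw [if_neg hL]
  have hpow : wp (.ifPos (.var 11) (forLoop 22 (.var 11)
      (.arith .mul [.const 13, .const 0] [.const 13, .const 0] [.const 3, .const 0])) .skip)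
      (fun σ t => t ≤ N ∧ σ.fld [13, 0] = σ₀.fld [13, 0] * σ₀.fld [3, 0] ^ Δ.toNat) σ₀ := by
    rw [wp_ifPos, wp_skip]
    simp only [IExp.eval, h11]
    split_ifs with hp
    · refine (wp_forLoop Δ.toNat (fun k σ =>
        σ.fld [13, 0] = σ₀.fld [13, 0] * σ₀.fld [3, 0] ^ k) (fun _ => 1) (by simp) ?_ ?_ ?_).mono ?_
      · intro σ hF
        have := (hF.var 11 (by simp)).trans h11
        simp only [IExp.eval, this]
        omega
      · simp
      · rintro k hk σ hF - hI
        have e3 := hF.fld 3 (by simp) [0]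
        rw [wp_arith]
        simp [State.addr, IExp.eval, hI, e3, Op.eval, pow_succ, mul_assoc]
      · rintro σ t ⟨ht, hI⟩
        refine ⟨?_, hI⟩
        simp at ht
        omega
    · rw [show Δ.toNat = 0 by omega]
      simp
  refine wp_seq_of hpow ?_
  rintro σ₁ t₁ ⟨ht₁, h13⟩ hF₁
  have e12 : σ₁.fld [12, 0] = σ₀.fld [12, 0] := hF₁.fld 12 (by simp) _
  have e4 : σ₁.var 4 = σ₀.var 4 := hF₁.var 4 (by simp)
  rw [wp_seq, wp_arith]
  refine ⟨by simp, ?_⟩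
  rw [wp_ifZero, wp_skip, wp_setVar]
  simp only [State.addr, IExp.eval, List.map_cons, List.map_nil, Function.update_self, Op.eval,
    h13, e12, sub_eq_zero]
  by_cases hE : σ₀.fld [13, 0] * σ₀.fld [3, 0] ^ Δ.toNat = σ₀.fld [12, 0]
  · rw [if_pos hE]
    simp [hΔ, hL, hE, e4]
    omega
  · rw [if_neg hE]
    simp [hE]
    omega

/-- The determinant of the leading matrix is not zero, and the determinant of `P` at `α` is what it
has to be if `P` is a reduced basis. -/
def CertInstance.DetTest (I : CertInstance K m n) (α : K) : Prop :=
  degreeSum I.s I.P ≤ I.sigma ∧ (leadingMatrix I.s I.P).det ≠ 0 ∧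
    (leadingMatrix I.s I.P).det * α ^ (degreeSum I.s I.P).toNat = (I.P.map (eval α)).det

/-- Run the determinant test; if it fails, variable `4` is set to zero. -/
def detTest (mm : Cmd K) : Cmd K :=
  .seq leading <|
  .seq (determinant mm) <|
  .seq (.copy [.const 13, .const 0] [.const 12, .const 0]) <|
  .seq evaluate <|
  .seq (determinant mm) <|
  .seq orderSum compareDet

theorem keepsInput_determinant (mm : Cmd K) : KeepsInput (determinant mm) :=
  .of_bool (by simp [determinant, eliminate, eliminateColumn, eliminateLoop, blockUpdate])

theorem keepsFld_determinant (mm : Cmd K) : (determinant mm).keepsFld 13 = true := by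
  simp [determinant, eliminate, eliminateColumn, eliminateLoop, blockUpdate]

theorem keepsVar_determinant (mm : Cmd K) :
    (determinant mm).keepsVar 4 = true ∧ (determinant mm).keepsVar 11 = true := by
  simp [determinant, eliminate, eliminateColumn, eliminateLoop, blockUpdate]

open Classical in
theorem wp_detTest {mm : Cmd K} {μ : ℕ → ℕ} (hmm : Multiplies mm μ) {W l : ℕ}
    (hW : W = 2 ^ l) (hmW : m ≤ W) {I : CertInstance K m n} {r : Fin (m + 2) → K} {σ₀ : State K}
    (h : Input I r W σ₀) :
    wp (detTest mm) (fun σ t =>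
      t ≤ m * m + 2 * (blockCost μ W l + 1) + 2 * matrixSize I.P + I.sigma + 3 ∧ Input I r W σ ∧
      σ.var 4 = if CertInstance.DetTest I (r 0) then σ₀.var 4 else 0) σ₀ := by
  refine wp_seq_of (wp_leading h) ?_
  rintro σ₁ t₁ ⟨ht₁, h11, hmat₁⟩ hF₁
  have hI₁ := h.of_frame_fresh hF₁ (.of_bool (by simp [leading, rowDegrees, identityArray]))
    (by simp [leading, rowDegrees, identityArray])
  refine wp_seq_of (wp_determinant hmm hW hI₁.size hI₁.fresh) ?_
  rintro σ₂ t₂ ⟨ht₂, hf₂, -, hdet₂⟩ hF₂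
  have hI₂ := hI₁.of_frame hF₂ (keepsInput_determinant mm) hf₂
  rw [hmat₁, det_padded hmW] at hdet₂
  rw [wp_seq, wp_copy]
  simp only [State.addr, IExp.eval, List.map_cons, List.map_nil]
  set σ₃ : State K := { σ₂ with fld := Function.update σ₂.fld [13, 0] (σ₂.fld [12, 0]) } with hσ₃
  have hF₃ : Frame (.copy [.const 13, .const 0] [.const 12, .const 0]) σ₂ σ₃ := by
    have := (Exec.copy [.const 13, .const 0] [.const 12, .const 0] σ₂).frame
    simpa [State.addr, IExp.eval] using this
  have hI₃ := hI₂.of_frame_fresh hF₃ (.of_bool (by simp)) (by simp)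
  refine wp_seq_of (wp_evaluate hI₃) ?_
  rintro σ₄ t₄ ⟨ht₄, hmat₄⟩ hF₄
  have hI₄ := hI₃.of_frame_fresh hF₄ (.of_bool (by simp [evaluate, identityArray]))
    (by simp [evaluate, identityArray])
  refine wp_seq_of (wp_determinant hmm hW hI₄.size hI₄.fresh) ?_
  rintro σ₅ t₅ ⟨ht₅, hf₅, -, hdet₅⟩ hF₅
  have hI₅ := hI₄.of_frame hF₅ (keepsInput_determinant mm) hf₅
  rw [hmat₄, det_padded hmW] at hdet₅
  refine wp_seq_of (wp_orderSum hI₅) ?_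
  rintro σ₆ t₆ ⟨rfl, h17⟩ hF₆
  have hI₆ := hI₅.of_frame_fresh hF₆ (.of_bool (by simp [orderSum])) (by simp [orderSum])
  have e11 : σ₆.var 11 = degreeSum I.s I.P := by
    rw [hF₆.var 11 (by simp [orderSum]), hF₅.var 11 (keepsVar_determinant mm).2,
      hF₄.var 11 (by simp [evaluate, identityArray])]
    exact (hF₂.var 11 (keepsVar_determinant mm).2).trans h11
  have e4 : σ₆.var 4 = σ₀.var 4 := by
    rw [hF₆.var 4 (by simp [orderSum]), hF₅.var 4 (keepsVar_determinant mm).1,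
      hF₄.var 4 (by simp [evaluate, identityArray])]
    exact (hF₂.var 4 (keepsVar_determinant mm).1).trans
      (hF₁.var 4 (by simp [leading, rowDegrees, identityArray]))
  have e13 : σ₆.fld [13, 0] = (leadingMatrix I.s I.P).det := by
    rw [hF₆.fld 13 (by simp [orderSum]), hF₅.fld 13 (keepsFld_determinant mm),
      hF₄.fld 13 (by simp [evaluate, identityArray]), hσ₃]
    simp [hdet₂]
  have e12 : σ₆.fld [12, 0] = (I.P.map (eval (r 0))).det := by
    rw [hF₆.fld 12 (by simp [orderSum]), hdet₅]
  have e3 : σ₆.fld [3, 0] = r 0 := hI₆.rand 0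
  refine (wp_compareDet h17 e11).framed.mono ?_
  rintro σ₇ t₇ ⟨⟨ht₇, h4⟩, hF₇⟩
  refine ⟨by omega, hI₆.of_frame_fresh hF₇ (.of_bool (by simp [compareDet]))
    (by simp [compareDet]), ?_⟩
  rw [h4, e13, e12, e3, e4]
  exact if_congr Iff.rfl rfl rfl

/-! ### The size of the padded matrices -/

/-- The least power of two which is at least `m` goes into variable `2`. -/
def padSize : Cmd K :=
  .seq (.setVar 2 (.const 1)) <|
  .whilePos (.sub (.var 0) (.var 2)) (.setVar 2 (.add (.var 2) (.var 2)))

theorem wp_padSize {σ₀ : State K} (hm : 0 < m) (h0 : σ₀.var 0 = m) :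
    wp padSize (fun σ t => t = 0 ∧ σ.int = σ₀.int ∧ σ.fld = σ₀.fld ∧
      ∃ l, σ.var 2 = (2 ^ l : ℕ) ∧ m ≤ 2 ^ l ∧ 2 ^ l < 2 * m) σ₀ := by
  rw [padSize, wp_seq, wp_setVar]
  -- Induction on a bound for m - 2^l. Doubling happens only while 2^l < m, and so preserves 2^l <
  -- 2m.
  have key : ∀ k l, m - 2 ^ l ≤ k → 2 ^ l < 2 * m → ∀ σ : State K, σ.var 0 = m →
      σ.var 2 = (2 ^ l : ℕ) → σ.int = σ₀.int → σ.fld = σ₀.fld →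
      wp (.whilePos (.sub (.var 0) (.var 2)) (.setVar 2 (.add (.var 2) (.var 2))))
        (fun σ t => t = 0 ∧ σ.int = σ₀.int ∧ σ.fld = σ₀.fld ∧
          ∃ l, σ.var 2 = (2 ^ l : ℕ) ∧ m ≤ 2 ^ l ∧ 2 ^ l < 2 * m) σ := by
    intro k
    induction k with
    | zero =>
      intro l hl hl' σ e0 e2 ei ef
      exact wp_while_neg (by simp only [IExp.eval, e0, e2]; omega) ⟨rfl, ei, ef, l, e2, by omega, hl'⟩
    | succ k ih =>
      intro l hl hl' σ e0 e2 ei ef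
      by_cases hlt : 2 ^ l < m
      · refine wp_while_pos (by simp only [IExp.eval, e0, e2]; omega) ?_
        rw [wp_setVar]
        have hp : 0 < 2 ^ l := by positivity
        refine wp.mono (ih (l + 1) (by rw [pow_succ]; omega) (by rw [pow_succ]; omega) _
          ?_ ?_ ?_ ?_) ?_
        rotate_right
        · rintro σ' t ⟨rfl, h⟩
          exact ⟨rfl, h⟩
        · simpa using e0
        · simp [IExp.eval, e2, pow_succ]
          ring
        · exact ei
        · exact ef
      · exact wp_while_neg (by simp only [IExp.eval, e0, e2]; omega)
          ⟨rfl, ei, ef, l, e2, by omega, hl'⟩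
  refine (key m 0 (by omega) (by simp; omega) _ ?_ ?_ ?_ ?_).mono ?_
  rotate_right
  · rintro σ t ⟨rfl, h⟩
    exact ⟨rfl, h⟩
  · simpa using h0
  · simp [IExp.eval]
  · rfl
  · rfl

/-! ### The product test -/

/-- The coefficients of the combination of the rows of `P` by all random elements but the first
two. -/
def combinedCoeff (I : CertInstance K m n) (r : Fin (m + 2) → K) (j : Fin m) (k : ℕ) : K :=
  ∑ i : Fin m, r i.succ.succ * (I.P i j).coeff k

theorem Input.rand_succ_succ {I : CertInstance K m n} {r : Fin (m + 2) → K} {W : ℕ} {σ : State K}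
    (h : Input I r W σ) (i : Fin m) :
    σ.fld [3, 2 + ((i : ℕ) : ℤ)] = r i.succ.succ := by
  rw [← h.rand]
  simp [add_comm, add_left_comm, one_add_one_eq_two]

/-- Add a multiple of entry (variable `23`, variable `22`) of `P` to the combination. -/
def addEntry : Cmd K :=
  .seq (.loadInt 9 [.const 2, .var 23, .var 22]) <|
  forLoop 24 (.add (.var 9) (.const 1)) <|
  .seq (.arith .mul [.const 12, .const 5] [.const 3, .add (.const 2) (.var 23)]
    [.const 0, .var 23, .var 22, .var 24]) <|
  .arith .add [.const 17, .var 22, .var 24] [.const 17, .var 22, .var 24] [.const 12, .const 5]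

theorem wp_addEntry {I : CertInstance K m n} {r : Fin (m + 2) → K} {W : ℕ} {σ₀ : State K}
    (h : Input I r W σ₀) (i j : Fin m) (h22 : σ₀.var 22 = (j : ℕ)) (h23 : σ₀.var 23 = (i : ℕ)) :
    wp addEntry (fun σ t => t ≤ 2 * ((I.P i j).natDegree + 1) ∧ ∀ (j' : Fin m) (k : ℕ),
      σ.fld [17, ((j' : ℕ) : ℤ), (k : ℤ)] = σ₀.fld [17, ((j' : ℕ) : ℤ), (k : ℤ)] +
        if j' = j then r i.succ.succ * (I.P i j).coeff k else 0) σ₀ := by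
  rw [addEntry, wp_seq, wp_loadInt]
  simp only [State.addr, IExp.eval, List.map_cons, List.map_nil, h22, h23, h.deg i j]
  obtain ⟨D, hD⟩ : ∃ D, (I.P i j).natDegree = D := ⟨_, rfl⟩
  rw [hD]
  set σ₁ : State K := { σ₀ with var := Function.update σ₀.var 9 (D : ℤ) }
  have hI₁ : Input I r W σ₁ := ⟨h.rows, h.cols, h.size, h.fresh, h.int, h.fld⟩
  refine (wp_forLoop (D + 1) (fun e σ => ∀ (j' : Fin m) (k : ℕ),
      σ.fld [17, ((j' : ℕ) : ℤ), (k : ℤ)] = σ₀.fld [17, ((j' : ℕ) : ℤ), (k : ℤ)] +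
        if j' = j ∧ k < e then r i.succ.succ * (I.P i j).coeff k else 0)
    (fun _ => 2) (by simp) ?_ ?_ ?_).mono ?_
  · intro σ hF
    have := hF.var 9 (by simp)
    simp [IExp.eval, this, σ₁]
  · intro j' k
    simp [σ₁]
  · rintro e he σ hF h24 hinv
    have e22 : σ.var 22 = (j : ℕ) := (hF.var 22 (by simp)).trans (by simpa [σ₁] using h22)
    have e23 : σ.var 23 = (i : ℕ) := (hF.var 23 (by simp)).trans (by simpa [σ₁] using h23)
    have eP : σ.fld [0, ((i : ℕ) : ℤ), ((j : ℕ) : ℤ), (e : ℤ)] = (I.P i j).coeff e :=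
      (hF.fld 0 (by simp) _).trans (hI₁.coeffP i j e)
    have er : σ.fld [3, 2 + ((i : ℕ) : ℤ)] = r i.succ.succ :=
      (hF.fld 3 (by simp) _).trans (hI₁.rand_succ_succ i)
    rw [wp_seq, wp_arith, wp_arith]
    refine ⟨by simp, by simp, by simp, fun j' k => ?_⟩
    simp only [State.addr, IExp.eval, List.map_cons, List.map_nil, e22, e23, h24, er, eP, Op.eval,
      State.setVar_fld, Function.update_self]
    by_cases hjk : j' = j ∧ k = e
    · obtain ⟨rfl, rfl⟩ := hjk
      simp [hinv]
    · rw [Function.update_of_ne (by simp [← Fin.ext_iff]; tauto),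
        Function.update_of_ne (by simp), hinv]
      congr 1
      have : (j' = j ∧ k < e + 1) ↔ (j' = j ∧ k < e) := by
        constructor
        · rintro ⟨h1, h2⟩
          exact ⟨h1, by have := fun hk => hjk ⟨h1, hk⟩; omega⟩
        · rintro ⟨h1, h2⟩
          exact ⟨h1, by omega⟩
      simp only [this]
  · rintro σ t ⟨ht, hinv⟩
    refine ⟨?_, fun j' k => ?_⟩
    · simp at ht ⊢
      omega
    · rw [hinv]
      congr 1
      by_cases hk : k < D + 1
      · simp [hk]
      · rw [coeff_eq_zero_of_natDegree_lt (by omega)]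
        simp

/-- Combine the rows of `P` by the random elements. -/
def combineRows : Cmd K :=
  forLoop 22 (.var 0) <| forLoop 23 (.var 0) addEntry

/-- The accumulators in the array `17` must start at zero, which is `h17`. Each stored coefficient
of P costs one multiplication and one addition. -/
theorem wp_combineRows {I : CertInstance K m n} {r : Fin (m + 2) → K} {W : ℕ} {σ₀ : State K}
    (h : Input I r W σ₀) (h17 : ∀ a, σ₀.fld (17 :: a) = 0) :
    wp combineRows (fun σ t => t ≤ 2 * matrixSize I.P ∧ ∀ (j : Fin m) (k : ℕ),
      σ.fld [17, ((j : ℕ) : ℤ), (k : ℤ)] = combinedCoeff I r j k) σ₀ := by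
  refine (wp_forLoop m (fun e σ => ∀ (j : Fin m) (k : ℕ),
      σ.fld [17, ((j : ℕ) : ℤ), (k : ℤ)] = if (j : ℕ) < e then combinedCoeff I r j k else 0)
    (fun j => ∑ i : Fin m, if hj : j < m then 2 * ((I.P i ⟨j, hj⟩).natDegree + 1) else 0)
    (by simp [addEntry]) ?_ ?_ ?_).mono ?_
  · intro σ hF
    exact (hF.var 0 (by simp [addEntry])).trans h.rows
  · intro j k
    simp [h17]
  · rintro e he σ₁ hF₁ h22 hinv
    obtain ⟨j, rfl⟩ : ∃ j : Fin m, (j : ℕ) = e := ⟨⟨e, he⟩, rfl⟩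
    have hI₁ := h.of_frame_fresh hF₁ (.of_bool (by simp [addEntry])) (by simp [addEntry])
    refine (wp_forLoop m (fun e σ => ∀ (j' : Fin m) (k : ℕ),
        σ.fld [17, ((j' : ℕ) : ℤ), (k : ℤ)] = σ₁.fld [17, ((j' : ℕ) : ℤ), (k : ℤ)] +
          if j' = j then ∑ i : Fin m, (if (i : ℕ) < e then
            r i.succ.succ * (I.P i j).coeff k else 0) else 0)
      (fun i => if hi : i < m then 2 * ((I.P ⟨i, hi⟩ j).natDegree + 1) else 0)
      (by simp [addEntry]) ?_ ?_ ?_).mono ?_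
    · intro σ hF
      exact (hF.var 0 (by simp [addEntry])).trans hI₁.rows
    · intro j' k
      simp
    · rintro e he' σ₂ hF₂ h23 hinv₂
      obtain ⟨i, rfl⟩ : ∃ i : Fin m, (i : ℕ) = e := ⟨⟨e, he'⟩, rfl⟩
      have hI₂ := hI₁.of_frame_fresh hF₂ (.of_bool (by simp [addEntry])) (by simp [addEntry])
      refine (wp_addEntry hI₂ i j ((hF₂.var 22 (by simp [addEntry])).trans h22) h23).mono ?_
      rintro σ₃ t₃ ⟨ht₃, hadd⟩
      refine ⟨by simpa using ht₃, fun j' k => ?_⟩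
      rw [State.setVar_fld, hadd, hinv₂, add_assoc]
      congr 1
      split_ifs with hj
      · rw [sum_ite_lt_succ]
      · rw [add_zero]
    · rintro σ₂ t₂ ⟨ht₂, hinv₂⟩
      refine ⟨?_, fun j' k => ?_⟩
      · rw [Finset.sum_range] at ht₂
        simpa using ht₂
      · rw [State.setVar_fld, hinv₂, hinv]
        by_cases hj : j' = j
        · subst hj
          simp [combinedCoeff]
        · have hne : (j' : ℕ) ≠ j := fun hc => hj (Fin.ext hc)
          have : (j' : ℕ) < j + 1 ↔ (j' : ℕ) < j := by omega
          simp [hj, this]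
  · rintro σ t ⟨ht, hinv⟩
    refine ⟨ht.trans (le_of_eq ?_), fun j k => by simpa using hinv j k⟩
    rw [Finset.sum_range, matrixSize]
    simp only [Fin.is_lt, dif_pos, Fin.eta]
    rw [Finset.sum_comm]
    simp only [← Finset.mul_sum, Finset.sum_add_distrib]
    simp
    ring

/-- The powers of the second random element go into the array `18`. -/
def powers : Cmd K :=
  .seq (.setConst [.const 18, .const 0] 1) <|
  forLoop 23 (.var 9) <|
  .arith .mul [.const 18, .add (.var 23) (.const 1)] [.const 18, .var 23] [.const 3, .const 1]

theorem wp_powers {N : ℕ} {σ₀ : State K} (h9 : σ₀.var 9 = N) :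
    wp powers (fun σ t => t ≤ N ∧ ∀ k ≤ N, σ.fld [18, (k : ℤ)] = σ₀.fld [3, 1] ^ k) σ₀ := by
  rw [powers, wp_seq, wp_setConst]
  refine (wp_forLoop N (fun e σ => ∀ k ≤ e, σ.fld [18, (k : ℤ)] = σ₀.fld [3, 1] ^ k) (fun _ => 1)
    (by simp) ?_ ?_ ?_).mono ?_
  · intro σ hF
    exact (hF.var 9 (by simp)).trans h9
  · intro k hk
    obtain rfl : k = 0 := by omega
    simp [State.addr, IExp.eval]
  · rintro e he σ hF h23 hinv
    have e3 := hF.fld 3 (by simp) [1]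
    rw [wp_arith]
    refine ⟨by simp, le_rfl, fun k hk => ?_⟩
    simp only [State.addr, IExp.eval, List.map_cons, List.map_nil, h23, Op.eval,
      State.setVar_fld]
    by_cases hke : k = e + 1
    · subst hke
      rw [hinv e le_rfl, e3]
      simp [State.addr, IExp.eval, pow_succ]
    · rw [Function.update_of_ne (by simp; omega), hinv k (by omega)]
  · rintro σ t ⟨ht, hinv⟩
    exact ⟨by simp at ht; omega, fun k hk => by simpa using hinv k hk⟩

/-- The contribution of entry `i` of column `j` to the product test. -/
def termValue (I : CertInstance K m n) (r : Fin (m + 2) → K) (j : Fin n) (i : Fin m) : K :=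
  ∑ l ∈ Finset.range (I.d j + 1), combinedCoeff I r i (I.d j - l) * r 1 ^ (I.d j - l) *
    ∑ e ∈ Finset.range (l + 1), (I.F i j).coeff e * r 1 ^ e -
  r i.succ.succ * I.C i j * r 1 ^ I.d j

/-- Add the contribution of entry (variable `23`, variable `22`). -/
def addTerm : Cmd K :=
  .seq (.setConst [.const 12, .const 1] 0) <|
  .seq (forLoop 24 (.add (.var 9) (.const 1)) <|
    .seq (.arith .mul [.const 12, .const 2] [.const 1, .var 23, .var 22, .var 24]
      [.const 18, .var 24]) <|
    .seq (.arith .add [.const 12, .const 1] [.const 12, .const 1] [.const 12, .const 2]) <|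
    .seq (.arith .mul [.const 12, .const 2] [.const 17, .var 23, .sub (.var 9) (.var 24)]
      [.const 18, .sub (.var 9) (.var 24)]) <|
    .seq (.arith .mul [.const 12, .const 2] [.const 12, .const 2] [.const 12, .const 1]) <|
    .arith .add [.const 12, .const 0] [.const 12, .const 0] [.const 12, .const 2]) <|
  .seq (.arith .mul [.const 12, .const 2] [.const 3, .add (.const 2) (.var 23)]
    [.const 2, .var 23, .var 22]) <|
  .seq (.arith .mul [.const 12, .const 2] [.const 12, .const 2] [.const 18, .var 9]) <|
  .arith .sub [.const 12, .const 0] [.const 12, .const 0] [.const 12, .const 2]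

/-- `fld[12, 1]` carries the value of the part of F of degree up to `l`, so the inner sum in
`termValue` is never computed anew and each `l` costs five operations. The term with C costs three
more. -/
theorem wp_addTerm {I : CertInstance K m n} {r : Fin (m + 2) → K} {W : ℕ} {σ₀ : State K}
    (h : Input I r W σ₀) (i : Fin m) (j : Fin n) (h22 : σ₀.var 22 = (j : ℕ))
    (h23 : σ₀.var 23 = (i : ℕ)) (h9 : σ₀.var 9 = I.d j)
    (h17 : ∀ k : ℕ, σ₀.fld [17, ((i : ℕ) : ℤ), (k : ℤ)] = combinedCoeff I r i k)
    (h18 : ∀ k ≤ I.d j, σ₀.fld [18, (k : ℤ)] = r 1 ^ k) :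
    wp addTerm (fun σ t => t ≤ 5 * (I.d j + 1) + 3 ∧
      σ.fld [12, 0] = σ₀.fld [12, 0] + termValue I r j i) σ₀ := by
  rw [addTerm, wp_seq, wp_setConst]
  simp only [State.addr, IExp.eval, List.map_cons, List.map_nil]
  set σ₁ : State K := { σ₀ with fld := Function.update σ₀.fld [12, 1] 0 } with hσ₁
  have hF₁ : Frame (.setConst [.const 12, .const 1] 0) σ₀ σ₁ := by
    have := (Exec.setConst [.const 12, .const 1] 0 σ₀).frame
    simpa [State.addr, IExp.eval] using this
  have hI₁ := h.of_frame_fresh hF₁ (.of_bool (by simp)) (by simp)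
  have e17 := hF₁.fld 17 (by simp)
  have e18 := hF₁.fld 18 (by simp)
  refine wp_seq_of (wp_forLoop (I.d j + 1) (fun l σ =>
    σ.fld [12, 1] = ∑ e ∈ Finset.range l, (I.F i j).coeff e * r 1 ^ e ∧
    σ.fld [12, 0] = σ₀.fld [12, 0] + ∑ l' ∈ Finset.range l,
      combinedCoeff I r i (I.d j - l') * r 1 ^ (I.d j - l') *
        ∑ e ∈ Finset.range (l' + 1), (I.F i j).coeff e * r 1 ^ e)
    (fun _ => 5) (by simp) ?_ ?_ ?_) ?_
  · intro σ hF
    have := (hF.var 9 (by simp)).trans h9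
    simp [IExp.eval, this]
  · simp [hσ₁]
  · rintro l hl σ hF h24 ⟨hH, hA⟩
    have e22 : σ.var 22 = (j : ℕ) := (hF.var 22 (by simp)).trans h22
    have e23 : σ.var 23 = (i : ℕ) := (hF.var 23 (by simp)).trans h23
    have e9 : σ.var 9 = I.d j := (hF.var 9 (by simp)).trans h9
    have eF : σ.fld [1, ((i : ℕ) : ℤ), ((j : ℕ) : ℤ), (l : ℤ)] = (I.F i j).coeff l :=
      (hF.fld 1 (by simp) _).trans (hI₁.coeffF i j l)
    have eV : σ.fld [17, ((i : ℕ) : ℤ), (I.d j : ℤ) - l] = combinedCoeff I r i (I.d j - l) := by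
      rw [← h17 (I.d j - l), hF.fld 17 (by simp), e17, Nat.cast_sub (by omega)]
    have eB : σ.fld [18, (l : ℤ)] = r 1 ^ l := by
      rw [hF.fld 18 (by simp), e18, h18 l (by omega)]
    have eB' : σ.fld [18, (I.d j : ℤ) - l] = r 1 ^ (I.d j - l) := by
      rw [← h18 (I.d j - l) (by omega), hF.fld 18 (by simp), e18, Nat.cast_sub (by omega)]
    simp only [wp_seq, wp_arith]
    simp [State.addr, IExp.eval, e22, e23, e9, h24, eF, eV, eB, eB', Op.eval, hH, hA,
      Finset.sum_range_succ, add_assoc]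
  · rintro σ₂ t₂ ⟨ht₂, -, hA⟩ hF₂
    have hI₂ := hI₁.of_frame_fresh hF₂ (.of_bool (by simp)) (by simp)
    have e22 : σ₂.var 22 = (j : ℕ) := (hF₂.var 22 (by simp)).trans h22
    have e23 : σ₂.var 23 = (i : ℕ) := (hF₂.var 23 (by simp)).trans h23
    have e9 : σ₂.var 9 = I.d j := (hF₂.var 9 (by simp)).trans h9
    have eB : σ₂.fld [18, (I.d j : ℤ)] = r 1 ^ I.d j := by
      rw [hF₂.fld 18 (by simp), e18, h18 _ le_rfl]
    have eC := hI₂.cert i j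
    have er := hI₂.rand_succ_succ i
    simp only [Finset.sum_const, Finset.card_range, smul_eq_mul] at ht₂
    simp only [wp_seq, wp_arith]
    simp [State.addr, IExp.eval, e22, e23, e9, eC, er, eB, Op.eval, hA, termValue, add_sub_assoc]
    omega

/-- The test for a column. -/
def CertInstance.ColumnTest (I : CertInstance K m n) (r : Fin (m + 2) → K) (j : Fin n) : Prop :=
  ∑ i, termValue I r j i = 0

/-- Run the test for the column whose index is in variable `22`. -/
def columnTest : Cmd K :=
  .seq (.loadInt 9 [.const 0, .var 22]) <|
  .seq powers <|
  .seq (.setConst [.const 12, .const 0] 0) <|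
  .seq (forLoop 23 (.var 0) addTerm) <|
  .ifZero [.const 12, .const 0] .skip (.setVar 4 (.const 0))

open Classical in
theorem wp_columnTest {I : CertInstance K m n} {r : Fin (m + 2) → K} {W : ℕ} {σ₀ : State K}
    (h : Input I r W σ₀) (j : Fin n) (h22 : σ₀.var 22 = (j : ℕ))
    (h17 : ∀ (i : Fin m) (k : ℕ), σ₀.fld [17, ((i : ℕ) : ℤ), (k : ℤ)] = combinedCoeff I r i k) :
    wp columnTest (fun σ t => t ≤ I.d j + m * (5 * (I.d j + 1) + 3) + 1 ∧
      σ.var 4 = if CertInstance.ColumnTest I r j then σ₀.var 4 else 0) σ₀ := by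
  rw [columnTest, wp_seq, wp_loadInt]
  simp only [State.addr, IExp.eval, List.map_cons, List.map_nil, h22, h.order j]
  set σ₁ : State K := { σ₀ with var := Function.update σ₀.var 9 (I.d j : ℤ) } with hσ₁
  have hI₁ : Input I r W σ₁ := ⟨h.rows, h.cols, h.size, h.fresh, h.int, h.fld⟩
  have h22₁ : σ₁.var 22 = (j : ℕ) := h22
  have h4₁ : σ₁.var 4 = σ₀.var 4 := rfl
  have h9₁ : σ₁.var 9 = I.d j := by simp [hσ₁]
  refine wp_seq_of (wp_powers h9₁) ?_
  rintro σ₂ t₂ ⟨ht₂, h18⟩ hF₂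
  have hI₂ := hI₁.of_frame_fresh hF₂ (.of_bool (by simp [powers])) (by simp [powers])
  rw [wp_seq, wp_setConst]
  simp only [State.addr, IExp.eval, List.map_cons, List.map_nil]
  set σ₃ : State K := { σ₂ with fld := Function.update σ₂.fld [12, 0] 0 } with hσ₃
  have hF₃ : Frame (.setConst [.const 12, .const 0] 0) σ₂ σ₃ := by
    have := (Exec.setConst [.const 12, .const 0] 0 σ₂).frame
    simpa [State.addr, IExp.eval] using this
  have hI₃ := hI₂.of_frame_fresh hF₃ (.of_bool (by simp)) (by simp)
  have h31 : σ₁.fld [3, 1] = r 1 := hI₁.rand 1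
  refine wp_seq_of (wp_forLoop m (fun k σ => σ.fld [12, 0] =
    ∑ i : Fin m, if (i : ℕ) < k then termValue I r j i else 0)
    (fun _ => 5 * (I.d j + 1) + 3) (by simp [addTerm]) ?_ ?_ ?_) ?_
  · intro σ hF
    exact (hF.var 0 (by simp [addTerm])).trans hI₃.rows
  · simp [hσ₃]
  · rintro k hk σ₄ hF₄ h23 hinv
    obtain ⟨i, rfl⟩ : ∃ i : Fin m, (i : ℕ) = k := ⟨⟨k, hk⟩, rfl⟩
    have hI₄ := hI₃.of_frame_fresh hF₄ (.of_bool (by simp [addTerm])) (by simp [addTerm])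
    refine (wp_addTerm hI₄ i j ?_ h23 ?_ (fun k => ?_) (fun k hk => ?_)).mono ?_
    · rw [hF₄.var 22 (by simp [addTerm]), hF₃.var 22 (by simp), hF₂.var 22 (by simp [powers]), h22₁]
    · rw [hF₄.var 9 (by simp [addTerm]), hF₃.var 9 (by simp), hF₂.var 9 (by simp [powers]), h9₁]
    · rw [hF₄.fld 17 (by simp [addTerm]), hF₃.fld 17 (by simp), hF₂.fld 17 (by simp [powers])]
      exact h17 i k
    · rw [hF₄.fld 18 (by simp [addTerm]), hF₃.fld 18 (by simp), h18 k hk, h31]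
    · rintro σ t ⟨ht, hA⟩
      refine ⟨ht, ?_⟩
      rw [State.setVar_fld, hA, hinv, sum_ite_lt_succ]
  · rintro σ₄ t₄ ⟨ht₄, hA⟩ hF₄
    simp only [Finset.sum_const, Finset.card_range, smul_eq_mul] at ht₄
    have e4 : σ₄.var 4 = σ₀.var 4 := by
      rw [hF₄.var 4 (by simp [addTerm]), hF₃.var 4 (by simp), hF₂.var 4 (by simp [powers]), h4₁]
    simp only [Fin.is_lt, if_true] at hA
    rw [wp_ifZero, wp_skip, wp_setVar]
    simp only [State.addr, IExp.eval, List.map_cons, List.map_nil, hA]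
    by_cases hz : ∑ i, termValue I r j i = 0
    · rw [if_pos hz, if_pos (show CertInstance.ColumnTest I r j from hz)]
      exact ⟨by omega, e4⟩
    · rw [if_neg hz, if_neg (show ¬ CertInstance.ColumnTest I r j from hz)]
      exact ⟨by omega, by simp⟩

/-- Run the tests for all columns. -/
def columnTests : Cmd K := forLoop 22 (.var 1) columnTest

open Classical in
theorem wp_columnTests {I : CertInstance K m n} {r : Fin (m + 2) → K} {W : ℕ} {σ₀ : State K}
    (h : Input I r W σ₀)
    (h17 : ∀ (i : Fin m) (k : ℕ), σ₀.fld [17, ((i : ℕ) : ℤ), (k : ℤ)] = combinedCoeff I r i k) :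
    wp columnTests (fun σ t =>
      t ≤ I.sigma + m * (5 * (I.sigma + n) + 3 * n) + n ∧
      σ.var 4 = if ∀ j, CertInstance.ColumnTest I r j then σ₀.var 4 else 0) σ₀ := by
  refine (wp_forLoop n (fun k σ => σ.var 4 =
    if ∀ j : Fin n, (j : ℕ) < k → CertInstance.ColumnTest I r j then σ₀.var 4 else 0)
    (fun j => if hj : j < n then I.d ⟨j, hj⟩ + m * (5 * (I.d ⟨j, hj⟩ + 1) + 3) + 1 else 0)
    (by simp [columnTest, powers, addTerm]) ?_ ?_ ?_).mono ?_
  · intro σ hF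
    exact (hF.var 1 (by simp [columnTest, powers, addTerm])).trans h.cols
  · simp
  · rintro k hk σ₁ hF₁ h22 hinv
    obtain ⟨j, rfl⟩ : ∃ j : Fin n, (j : ℕ) = k := ⟨⟨k, hk⟩, rfl⟩
    have hI₁ := h.of_frame_fresh hF₁ (.of_bool (by simp [columnTest, powers, addTerm]))
      (by simp [columnTest, powers, addTerm])
    refine (wp_columnTest hI₁ j h22 fun i k =>
      (hF₁.fld 17 (by simp [columnTest, powers, addTerm]) _).trans (h17 i k)).mono ?_
    rintro σ t ⟨ht, h4⟩
    refine ⟨by simpa using ht, ?_⟩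
    rw [State.setVar_var, Function.update_of_ne (by decide), h4, hinv, ← ite_and]
    refine if_congr ?_ rfl rfl
    constructor
    · rintro ⟨h1, h2⟩ j' hj'
      rcases Nat.lt_succ_iff_lt_or_eq.1 hj' with h3 | h3
      · exact h2 j' h3
      · rwa [Fin.ext h3]
    · exact fun h1 => ⟨h1 j (by omega), fun j' hj' => h1 j' (by omega)⟩
  · rintro σ t ⟨ht, h4⟩
    refine ⟨ht.trans (le_of_eq ?_), by simpa using h4⟩
    rw [Finset.sum_range]
    simp only [Fin.is_lt, dif_pos, Fin.eta, Finset.sum_add_distrib, ← Finset.mul_sum]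
    simp only [CertInstance.sigma, Finset.sum_const, Finset.card_univ, Fintype.card_fin, smul_eq_mul]
    ring

/-! ### The program -/

/-- The certification program, which calls `mm` for the multiplication of matrices. -/
def certify (mm : Cmd K) : Cmd K :=
  .seq (.setVar 4 (.const 1)) <|
  .seq padSize <|
  .seq combineRows <|
  .seq columnTests <|
  .seq (detTest mm) <|
  .seq (rankTest mm) <|
  .setVar 0 (.var 4)

/-- All tests are passed. -/
def CertInstance.Passes (I : CertInstance K m n) (r : Fin (m + 2) → K) : Prop :=
  (∀ j, CertInstance.ColumnTest I r j) ∧ CertInstance.DetTest I (r 0) ∧ CertInstance.FullRank I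

/-- A bound for the number of operations, where `μ` is the cost of the multiplication. -/
def certifyCost (μ : ℕ → ℕ) (I : CertInstance K m n) (l : ℕ) : ℕ :=
  2 * matrixSize I.P + (I.sigma + m * (5 * (I.sigma + n) + 3 * n) + n) +
    (m * m + 2 * (blockCost μ (2 ^ l) l + 1) + 2 * matrixSize I.P + I.sigma + 3) +
    ((n / 2 ^ l + 2) * (2 * μ (2 ^ l) + blockCost μ (2 ^ l) l + 2 ^ l * 2 ^ l) + 2 ^ l * 2 ^ l)

theorem input_init (I : CertInstance K m n) (r : Fin (m + 2) → K) {W : ℕ} {σ : State K}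
    (h0 : σ.var 0 = m) (h1 : σ.var 1 = n) (h2 : σ.var 2 = W)
    (hi : σ.int = (I.init r).int) (hf : σ.fld = (I.init r).fld) : Input I r W σ := by
  refine ⟨h0, h1, h2, fun z _ a => ?_, fun z _ a => by rw [hi], fun z _ a => by rw [hf]⟩
  rw [hi, hf]
  constructor
  · simp only [CertInstance.init]
  · simp only [CertInstance.init]

open Classical in
theorem wp_certify {mm : Cmd K} {μ : ℕ → ℕ} (hmm : Multiplies mm μ) (hm : 0 < m)
    (I : CertInstance K m n) (r : Fin (m + 2) → K) :
    wp (certify mm) (fun σ t =>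
      (∃ l, m ≤ 2 ^ l ∧ 2 ^ l < 2 * m ∧ t ≤ certifyCost μ I l) ∧
      σ.var 0 = if CertInstance.Passes I r then 1 else 0) (I.init r) := by
  rw [certify, wp_seq, wp_setVar]
  refine wp_seq_of (wp_padSize hm (by simp [CertInstance.init])) ?_
  rintro σ₁ t₁ ⟨rfl, hi₁, hf₁, l, h2, hml, hlm⟩ hF₁
  have hI₁ : Input I r (2 ^ l) σ₁ := by
    refine input_init I r ?_ ?_ h2 hi₁ hf₁
    · rw [hF₁.var 0 (by simp [padSize])]
      simp [CertInstance.init]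
    · rw [hF₁.var 1 (by simp [padSize])]
      simp [CertInstance.init]
  have h4₁ : σ₁.var 4 = 1 := by
    rw [hF₁.var 4 (by simp [padSize])]
    simp [IExp.eval]
  have h17 : ∀ a, σ₁.fld (17 :: a) = 0 := by
    intro a
    rw [hf₁]
    simp only [CertInstance.init]
  refine wp_seq_of (wp_combineRows hI₁ h17) ?_
  rintro σ₂ t₂ ⟨ht₂, h17₂⟩ hF₂
  have hI₂ := hI₁.of_frame_fresh hF₂ (.of_bool (by simp [combineRows, addEntry]))
    (by simp [combineRows, addEntry])
  have h4₂ : σ₂.var 4 = 1 := (hF₂.var 4 (by simp [combineRows, addEntry])).trans h4₁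
  refine wp_seq_of (wp_columnTests hI₂ h17₂) ?_
  rintro σ₃ t₃ ⟨ht₃, h4₃⟩ hF₃
  have hI₃ := hI₂.of_frame_fresh hF₃
    (.of_bool (by simp [columnTests, columnTest, powers, addTerm]))
    (by simp [columnTests, columnTest, powers, addTerm])
  refine wp_seq_of (wp_detTest hmm rfl hml hI₃) ?_
  rintro σ₄ t₄ ⟨ht₄, hI₄, h4₄⟩ -
  refine wp_seq_of (wp_rankTest hmm rfl hml hI₄) ?_
  rintro σ₅ t₅ ⟨ht₅, hI₅, h4₅⟩ -
  rw [wp_setVar]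
  refine ⟨⟨l, hml, hlm, ?_⟩, ?_⟩
  · rw [certifyCost]
    omega
  · simp only [IExp.eval, Function.update_self]
    rw [h4₅, h4₄, h4₃, h4₂, ← ite_and, ← ite_and]
    refine if_congr ?_ rfl rfl
    rw [CertInstance.Passes]
    tauto

/-- `Answers` only says that some execution exists. As the machine is deterministic, every execution
is the one found in `wp_certify`, which makes the bound and the answer hold for all. -/
theorem answers_certify_iff {mm : Cmd K} {μ : ℕ → ℕ} (hmm : Multiplies mm μ) (hm : 0 < m)
    (I : CertInstance K m n) (r : Fin (m + 2) → K) : ∃ t₀ : ℕ,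
      (∃ l, m ≤ 2 ^ l ∧ 2 ^ l < 2 * m ∧ t₀ ≤ certifyCost μ I l) ∧
      ∀ b t, I.Answers (certify mm) r b t ↔ t = t₀ ∧ (b = true ↔ CertInstance.Passes I r) := by
  classical
  obtain ⟨σ₀, t₀, hex, hcost, h0⟩ := wp_certify hmm hm I r
  refine ⟨t₀, hcost, fun b t => ⟨?_, ?_⟩⟩
  · rintro ⟨σ, hex', hb⟩
    obtain ⟨rfl, rfl⟩ := hex.det hex'
    refine ⟨rfl, ?_⟩
    rw [h0] at hb
    cases b <;> split_ifs at hb <;> simp_all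
  · rintro ⟨rfl, hb⟩
    refine ⟨σ₀, hex, ?_⟩
    rw [h0]
    cases b <;> simp_all

/-! ### Why the tests decide the problem: algebra, probability and cost -/

/-! ### The determinant of a reduced matrix -/

theorem natDegree_prod_le_and_coeff {ι : Type*} (t : Finset ι) (p : ι → K[X]) (e : ι → ℕ)
    (h : ∀ i ∈ t, (p i).natDegree ≤ e i) :
    (∏ i ∈ t, p i).natDegree ≤ ∑ i ∈ t, e i ∧
      (∏ i ∈ t, p i).coeff (∑ i ∈ t, e i) = ∏ i ∈ t, (p i).coeff (e i) := by
  classical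
  induction t using Finset.induction_on with
  | empty => simp
  | insert a t ha ih =>
    obtain ⟨ih₁, ih₂⟩ := ih fun i hi => h i (Finset.mem_insert_of_mem hi)
    have h₁ := h a (Finset.mem_insert_self a t)
    rw [Finset.prod_insert ha, Finset.sum_insert ha, Finset.prod_insert ha,
      coeff_mul_add_eq_of_natDegree_le h₁ ih₁, ih₂]
    exact ⟨natDegree_mul_le_of_le h₁ ih₁, rfl⟩

theorem le_rowDegree (s : Fin m → ℤ) (P : Matrix (Fin m) (Fin m) K[X]) {i j : Fin m}
    (h : P i j ≠ 0) : ((P i j).natDegree : ℤ) + s j ≤ rowDegree s P i := by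
  have h₁ : (P i j).degree.map (fun d : ℕ => (d : ℤ) + s j) ≤ shiftedRowDegree s P i :=
    Finset.le_sup (f := fun j => (P i j).degree.map fun d : ℕ => (d : ℤ) + s j) (Finset.mem_univ j)
  have h₂ : (P i j).degree.map (fun d : ℕ => (d : ℤ) + s j) =
      (((P i j).natDegree + s j : ℤ) : WithBot ℤ) := by
    rw [degree_eq_natDegree h]
    rfl
  rw [h₂] at h₁
  rw [rowDegree]
  cases hd : shiftedRowDegree s P i with
  | bot => simp [hd] at h₁
  | coe z =>
    rw [hd, WithBot.coe_le_coe] at h₁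
    exact h₁

/-- For every permutation τ the numbers r_(τ i) - s_i have the same sum Δ. So the term of τ in the
Leibniz expansion of det P has degree at most Δ, and its coefficient there is the term of τ in the
expansion of det L. If one of these numbers is negative, the corresponding entries of P and L
vanish, and with them both terms. -/
theorem prod_perm_leadingMatrix (s : Fin m → ℤ) (P : Matrix (Fin m) (Fin m) K[X])
    (τ : Equiv.Perm (Fin m)) :
    (∏ i, leadingMatrix s P (τ i) i ≠ 0 → 0 ≤ degreeSum s P) ∧
    (∏ i, P (τ i) i).natDegree ≤ (degreeSum s P).toNat ∧
    (0 ≤ degreeSum s P → (∏ i, P (τ i) i).coeff (degreeSum s P).toNat =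
      ∏ i, leadingMatrix s P (τ i) i) := by
  have hsum : degreeSum s P = ∑ i, (rowDegree s P (τ i) - s i) := by
    rw [degreeSum, Finset.sum_sub_distrib, Finset.sum_sub_distrib,
      Equiv.sum_comp τ (fun i => rowDegree s P i)]
  by_cases hneg : ∃ i, rowDegree s P (τ i) - s i < 0
  · obtain ⟨i, hi⟩ := hneg
    have h₁ : P (τ i) i = 0 := by
      by_contra hP
      have := le_rowDegree s P hP
      omega
    have h₂ : leadingMatrix s P (τ i) i = 0 := by
      rw [leadingMatrix_apply, if_neg (by omega)]
    have h₃ : ∏ i, P (τ i) i = 0 := Finset.prod_eq_zero (Finset.mem_univ i) h₁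
    have h₄ : ∏ i, leadingMatrix s P (τ i) i = 0 := Finset.prod_eq_zero (Finset.mem_univ i) h₂
    rw [h₃, h₄]
    simp
  · push Not at hneg
    have hdeg : ∀ i ∈ (Finset.univ : Finset (Fin m)),
        (P (τ i) i).natDegree ≤ (rowDegree s P (τ i) - s i).toNat := by
      intro i _
      by_cases hP : P (τ i) i = 0
      · simp [hP]
      · have := le_rowDegree s P hP
        omega
    have hnat : (degreeSum s P).toNat = ∑ i, (rowDegree s P (τ i) - s i).toNat := by
      have : degreeSum s P = ((∑ i, (rowDegree s P (τ i) - s i).toNat : ℕ) : ℤ) := by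
        rw [hsum, Nat.cast_sum]
        exact Finset.sum_congr rfl fun i _ => (Int.toNat_of_nonneg (hneg i)).symm
      omega
    obtain ⟨h₁, h₂⟩ := natDegree_prod_le_and_coeff _ _ _ hdeg
    rw [hnat]
    refine ⟨fun _ => ?_, h₁, fun _ => ?_⟩
    · rw [hsum]
      exact Finset.sum_nonneg fun i _ => hneg i
    · rw [h₂]
      refine Finset.prod_congr rfl fun i _ => ?_
      rw [leadingMatrix_apply, if_pos (hneg i)]

/-- This holds whether or not P is reduced. It bounds the degree of the polynomial behind the
determinant test on incorrect instances. -/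
theorem natDegree_det_le (s : Fin m → ℤ) (P : Matrix (Fin m) (Fin m) K[X]) :
    P.det.natDegree ≤ (degreeSum s P).toNat := by
  rw [Matrix.det_apply]
  refine natDegree_sum_le_of_forall_le _ _ fun τ _ => ?_
  refine (natDegree_smul_le _ _).trans ?_
  exact (prod_perm_leadingMatrix s P τ).2.1

/-- If det L is not zero, some term of its expansion is not zero, hence Δ ≥ 0; then the two Leibniz
expansions agree term by term. -/
theorem coeff_det {s : Fin m → ℤ} {P : Matrix (Fin m) (Fin m) K[X]}
    (h : (leadingMatrix s P).det ≠ 0) :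
    P.det.coeff (degreeSum s P).toNat = (leadingMatrix s P).det := by
  have hpos : 0 ≤ degreeSum s P := by
    by_contra hneg
    refine h ?_
    rw [Matrix.det_apply]
    refine Finset.sum_eq_zero fun τ _ => ?_
    rw [smul_eq_zero_iff_eq]
    by_contra hne
    exact hneg ((prod_perm_leadingMatrix s P τ).1 hne)
  rw [Matrix.det_apply, Matrix.det_apply, finsetSum_coeff]
  refine Finset.sum_congr rfl fun τ _ => ?_
  rw [← (prod_perm_leadingMatrix s P τ).2.2 hpos]
  rcases Int.units_eq_one_or (Equiv.Perm.sign τ) with hs | hs <;> simp [hs]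

/-! ### Approximants -/

theorem mem_approximants_iff {d : Fin n → ℕ} {F : Matrix (Fin m) (Fin n) K[X]}
    {p : Fin m → K[X]} :
    p ∈ approximants d F ↔ ∀ j, ∀ k < d j, (Matrix.vecMul p F j).coeff k = 0 := by
  simp only [← X_pow_dvd_iff]
  constructor
  · rintro ⟨q, hq⟩ j
    rw [hq, Matrix.vecMul_diagonal]
    exact Dvd.intro_left _ rfl
  · intro h
    choose q hq using h
    refine ⟨q, funext fun j => ?_⟩
    rw [Matrix.vecMul_diagonal, hq, mul_comm]

/-- There are approximants whose determinant is a power of `X` with exponent at most the sum of the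
order. -/
theorem exists_approximants_det (F : Matrix (Fin m) (Fin n) K[X]) (N : ℕ) :
    ∀ d : Fin n → ℕ, ∑ j, d j = N → ∃ P : Matrix (Fin m) (Fin m) K[X],
      (∀ i, P i ∈ approximants d F) ∧ ∃ k ≤ N, P.det = X ^ k := by
  induction N with
  | zero =>
    intro d hd
    refine ⟨1, fun i => ?_, 0, le_rfl, by simp⟩
    rw [mem_approximants_iff]
    intro j k hk
    have := (Finset.sum_eq_zero_iff.1 hd) j (Finset.mem_univ j)
    omega
  | succ N ih =>
    intro d hd
    obtain ⟨j, hj⟩ : ∃ j, 0 < d j := by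
      by_contra hne
      push Not at hne
      have : ∑ j, d j = 0 := Finset.sum_eq_zero fun j _ => Nat.le_zero.1 (hne j)
      omega
    have hsum : ∑ j', Function.update d j (d j - 1) j' = N := by
      have h₁ := Finset.add_sum_erase Finset.univ d (Finset.mem_univ j)
      rw [← Finset.add_sum_erase Finset.univ _ (Finset.mem_univ j), Function.update_self,
        Finset.sum_congr rfl fun j' hj' => Function.update_of_ne (Finset.ne_of_mem_erase hj') _ _]
      omega
    obtain ⟨P, hP, k, hk, hdet⟩ := ih _ hsum
    have hmem : ∀ p : Fin m → K[X], p ∈ approximants (Function.update d j (d j - 1)) F →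
        (Matrix.vecMul p F j).coeff (d j - 1) = 0 → p ∈ approximants d F := by
      intro p hp h0
      rw [mem_approximants_iff] at hp ⊢
      intro j' k' hk'
      by_cases hjj : j' = j
      · subst hjj
        by_cases hkk : k' = d j' - 1
        · rw [hkk, h0]
        · exact hp j' k' (by simp; omega)
      · exact hp j' k' (by rwa [Function.update_of_ne hjj])
    -- Going from `d j - 1` to `d j` adds a single linear condition, with residual `c i` on row `i`.
    -- If some residual is not zero, that row is multiplied by X and a multiple of it cancels the
    -- residuals of the other rows; the determinant gains one factor X.
    set c : Fin m → K := fun i => (Matrix.vecMul (P i) F j).coeff (d j - 1) with hc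
    by_cases hzero : ∀ i, c i = 0
    · exact ⟨P, fun i => hmem _ (hP i) (hzero i), k, by omega, hdet⟩
    push Not at hzero
    obtain ⟨i, hi⟩ := hzero
    set v : Fin m → K[X] := fun i' => if i' = i then X else C (-(c i' / c i)) with hv
    have hrow : ∀ i', ((1 : Matrix (Fin m) (Fin m) K[X]).updateCol i v * P) i' =
        if i' = i then (X : K[X]) • P i else P i' + C (-(c i' / c i)) • P i := by
      intro i'
      have hL : (1 : Matrix (Fin m) (Fin m) K[X]).updateCol i v i' =
          if i' = i then Pi.single i X else Pi.single i' 1 + Pi.single i (C (-(c i' / c i))) := by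
        ext1 l
        split_ifs with h₁
        · by_cases h₂ : l = i
          · simp [h₁, h₂, hv]
          · simp [h₁, h₂, Ne.symm h₂]
        · by_cases h₂ : l = i
          · simp [h₁, h₂, hv, eq_comm (a := i)]
          · simp [h₂, Matrix.one_apply, Pi.single_apply, eq_comm (a := l)]
      rw [Matrix.mul_apply_eq_vecMul, hL]
      split_ifs
      · ext1 l
        simp [Matrix.single_vecMul]
      · ext1 l
        simp [Matrix.add_vecMul, Matrix.single_vecMul]
    refine ⟨(1 : Matrix (Fin m) (Fin m) K[X]).updateCol i v * P, fun i' => ?_, k + 1, by omega, ?_⟩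
    · rw [hrow]
      split_ifs with h₁
      · refine hmem _ (Submodule.smul_mem _ _ (hP i)) ?_
        rw [Matrix.smul_vecMul, Pi.smul_apply, smul_eq_mul]
        -- Multiplication by X moves the coefficient of degree `d j - 2`, which vanishes already, to
        -- degree `d j - 1`. For `d j = 1` it is the constant coefficient of a multiple of X.
        rcases Nat.eq_zero_or_pos (d j - 1) with h0 | h0
        · rw [h0, coeff_X_mul_zero]
        · have := mem_approximants_iff.1 (hP i) j (d j - 1 - 1) (by simp; omega)
          obtain ⟨e, he⟩ : ∃ e, d j - 1 = e + 1 := ⟨d j - 1 - 1, by omega⟩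
          rw [he] at this ⊢
          rw [coeff_X_mul]
          simpa using this
      · refine hmem _ (Submodule.add_mem _ (hP i') (Submodule.smul_mem _ _ (hP i))) ?_
        rw [Matrix.add_vecMul, Matrix.smul_vecMul, Pi.add_apply, Pi.smul_apply, smul_eq_mul,
          coeff_add, coeff_C_mul]
        change c i' + -(c i' / c i) * c i = 0
        field_simp
        ring
    -- By Cramer's rule for the identity, replacing its column `i` by `v` gives the determinant `v
    -- i`, which is X.
    · rw [Matrix.det_mul, hdet, ← Matrix.cramer_apply, Matrix.cramer_one, pow_succ']
      simp [hv]

/-- A nonzero determinant makes the rows independent, so only generation is left to check. -/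
theorem isRowBasis_iff {P : Matrix (Fin m) (Fin m) K[X]} {M : Submodule K[X] (Fin m → K[X])}
    (hdet : P.det ≠ 0) : IsRowBasis P M ↔ ∀ p, p ∈ M ↔ ∃ w, p = Matrix.vecMul w P := by
  have hspan : ∀ p, p ∈ Submodule.span K[X] (Set.range fun i => P i) ↔
      ∃ w, p = Matrix.vecMul w P := by
    intro p
    rw [Submodule.mem_span_range_iff_exists_fun]
    refine exists_congr fun w => ?_
    rw [Matrix.vecMul_eq_sum, eq_comm]
  constructor
  · rintro ⟨-, h⟩ p
    rw [← h, hspan]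
  · intro h
    refine ⟨Matrix.linearIndependent_rows_of_det_ne_zero hdet, ?_⟩
    ext p
    rw [hspan, h]

/-! ### Characterization of the correct instances -/

/-- The difference between what the coefficients of `P F` are and what they should be. -/
def defect (I : CertInstance K m n) (i : Fin m) (j : Fin n) (t : ℕ) : K :=
  ((I.P * I.F) i j).coeff t - if t = I.d j then I.C i j else 0

/-- Up to degree `d j`, column `j` of `P F` is `C X^(d j)`. -/
def CertInstance.ProductCorrect (I : CertInstance K m n) : Prop :=
  ∀ i j, ∀ t ≤ I.d j, defect I i j t = 0

/-- The determinant of `P` is the power of `X` which is determined by the leading matrix. -/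
def CertInstance.DetCorrect (I : CertInstance K m n) : Prop :=
  degreeSum I.s I.P ≤ I.sigma ∧ (leadingMatrix I.s I.P).det ≠ 0 ∧
    I.P.det = C (leadingMatrix I.s I.P).det * X ^ (degreeSum I.s I.P).toNat

variable {I : CertInstance K m n}

theorem productCorrect_iff : CertInstance.ProductCorrect I ↔
    (∀ i, I.P i ∈ approximants I.d I.F) ∧ ∀ i j, I.C i j = ((I.P * I.F) i j).coeff (I.d j) := by
  simp only [mem_approximants_iff, ← Matrix.mul_apply_eq_vecMul]
  constructor
  · intro h
    refine ⟨fun i j k hk => ?_, fun i j => ?_⟩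
    · have := h i j k hk.le
      rwa [defect, if_neg hk.ne, sub_zero] at this
    · have := h i j _ le_rfl
      rw [defect, if_pos rfl, sub_eq_zero] at this
      exact this.symm
  · rintro ⟨h₁, h₂⟩ i j t ht
    rw [defect]
    split_ifs with h
    · rw [h, h₂, sub_self]
    · rw [sub_zero]
      exact h₁ i j t (lt_of_le_of_ne ht h)

theorem det_ne_zero_of_isShiftReduced (h : IsShiftReduced I.s I.P) :
    (leadingMatrix I.s I.P).det ≠ 0 ∧ I.P.det ≠ 0 := by
  have h₁ : (leadingMatrix I.s I.P).det ≠ 0 :=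
    ((Matrix.isUnit_iff_isUnit_det _).1 h).ne_zero
  refine ⟨h₁, fun h₂ => h₁ ?_⟩
  rw [← coeff_det h₁, h₂, coeff_zero]

/-- The approximants of `exists_approximants_det` are combinations of the rows of P, so det P
divides X^k with k ≤ σ and equals c X^k' with k' ≤ k. Its coefficient of degree Δ is det L, which is
not zero; hence Δ = k' and c = det L. -/
theorem detCorrect_of_isYes (h : I.IsYes) : CertInstance.DetCorrect I := by
  obtain ⟨⟨hb, hr⟩, -⟩ := h
  obtain ⟨hL, hdet⟩ := det_ne_zero_of_isShiftReduced hr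
  have hb' := (isRowBasis_iff hdet).1 hb
  obtain ⟨P₀, hP₀, k, hk, hdet₀⟩ := exists_approximants_det I.F I.sigma I.d rfl
  choose Q hQ using fun i => (hb' _).1 (hP₀ i)
  have hmul : P₀ = Matrix.of Q * I.P := by
    refine funext fun i => ?_
    rw [Matrix.mul_apply_eq_vecMul, hQ]
    rfl
  have hdvd : I.P.det ∣ X ^ k := by
    rw [← hdet₀, hmul, Matrix.det_mul]
    exact Dvd.intro_left _ rfl
  obtain ⟨k', hk', hassoc⟩ := (dvd_prime_pow prime_X k).1 hdvd
  obtain ⟨u, hu⟩ := hassoc.symm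
  obtain ⟨c, hc, hcu⟩ := Polynomial.isUnit_iff.1 u.isUnit
  have hdet' : I.P.det = C c * X ^ k' := by rw [← hu, ← hcu, mul_comm]
  have hcoeff := coeff_det hL
  rw [hdet', coeff_C_mul_X_pow] at hcoeff
  split_ifs at hcoeff with heq
  · refine ⟨by omega, hL, ?_⟩
    rw [hdet', ← hcoeff, heq]
  · exact absurd hcoeff.symm hL

theorem coeff_zero_vecMul {p : ℕ} (w : Fin m → K[X]) (M : Matrix (Fin m) (Fin p) K[X]) (j : Fin p) :
    (Matrix.vecMul w M j).coeff 0 =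
      Matrix.vecMul (fun i => (w i).coeff 0) (M.map fun q => q.coeff 0) j := by
  simp [Matrix.vecMul, dotProduct, finsetSum_coeff, mul_coeff_zero]

/-- Column j of P F is C X^(d j) up to degree d j. In that range, multiplication by w from the left
can only bring in w(0), and only in degree d j. -/
theorem coeff_vecMul_product (h : CertInstance.ProductCorrect I) (w : Fin m → K[X]) (j : Fin n)
    {t : ℕ} (ht : t ≤ I.d j) :
    (Matrix.vecMul (Matrix.vecMul w I.P) I.F j).coeff t =
      if t = I.d j then Matrix.vecMul (fun i => (w i).coeff 0) I.C j else 0 := by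
  have hco : ∀ i, ∀ k ≤ I.d j, ((I.P * I.F) i j).coeff k = if k = I.d j then I.C i j else 0 :=
    fun i k hk => sub_eq_zero.1 (h i j k hk)
  rw [Matrix.vecMul_vecMul, Matrix.vecMul, Matrix.vecMul, dotProduct, dotProduct, finsetSum_coeff]
  have : ∀ i, (w i * (I.P * I.F) i j).coeff t =
      if t = I.d j then (w i).coeff 0 * I.C i j else 0 := by
    intro i
    rw [coeff_mul, Finset.sum_eq_single (0, t)]
    · rw [hco i t ht]
      split_ifs <;> simp
    · rintro ⟨a, b⟩ hab hne
      rw [Finset.HasAntidiagonal.mem_antidiagonal] at hab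
      have hb : b ≠ I.d j := by
        rintro rfl
        refine hne ?_
        have : a = 0 := by omega
        subst this
        simp at hab
        simp [hab]
      rw [hco i b (by simp at hab; omega), if_neg hb, mul_zero]
    · simp
  simp only [this]
  split_ifs <;> simp

/-- If v kills P(0), then v P = X p. If v also kills C, then v P F vanishes up to degree d j in
column j, so p F vanishes below d j and p is an approximant. Hence p = w P and (v - X w) P = 0,
which gives v = X w; the constant vector v must be 0. -/
theorem fullRank_of_isYes (h : I.IsYes) : CertInstance.FullRank I := by
  have hprod : CertInstance.ProductCorrect I := by
    rw [productCorrect_iff]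
    refine ⟨fun i => ?_, h.2⟩
    rw [← h.1.1.2]
    exact Submodule.subset_span ⟨i, rfl⟩
  obtain ⟨-, hdet⟩ := det_ne_zero_of_isShiftReduced h.1.2
  have hb := (isRowBasis_iff hdet).1 h.1.1
  intro v hv₁ hv₂
  have hX : ∀ j, X ∣ Matrix.vecMul (fun i => C (v i)) I.P j := by
    intro j
    rw [X_dvd_iff, coeff_zero_vecMul]
    simpa [constCoeff] using congrFun hv₁ j
  choose p hp using hX
  have hp' : Matrix.vecMul (fun i => C (v i)) I.P = (X : K[X]) • p := funext hp
  have hmem : p ∈ approximants I.d I.F := by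
    rw [mem_approximants_iff]
    intro j k hk
    have := coeff_vecMul_product hprod (fun i => C (v i)) j (Nat.succ_le_of_lt hk)
    rw [hp', Matrix.smul_vecMul, Pi.smul_apply, smul_eq_mul, coeff_X_mul] at this
    rw [this]
    split_ifs
    · simpa using congrFun hv₂ j
    · rfl
  obtain ⟨w, hw⟩ := (hb p).1 hmem
  have hzero : Matrix.vecMul ((fun i => C (v i)) - (X : K[X]) • w) I.P = 0 := by
    rw [Matrix.sub_vecMul, Matrix.smul_vecMul, ← hw, hp', sub_self]
  have := Matrix.eq_zero_of_vecMul_eq_zero hdet hzero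
  funext i
  have hi := congrArg (fun q => q.coeff 0) (congrFun this i)
  simpa using hi

/-- The left side of X^(k+1) p = w P has no constant coefficient, so w(0) kills P(0); after
multiplication by F it has no coefficient of degree d j in column j, so w(0) kills C. By full rank,
w is divisible by X, and one factor X is removed from both sides. -/
theorem mem_span_of_pow_smul (hprod : CertInstance.ProductCorrect I)
    (hrank : CertInstance.FullRank I) {p : Fin m → K[X]} (hp : p ∈ approximants I.d I.F) (k : ℕ) :
    ∀ w, (X : K[X]) ^ k • p = Matrix.vecMul w I.P → ∃ w, p = Matrix.vecMul w I.P := by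
  induction k with
  | zero => exact fun w hw => ⟨w, by simpa using hw⟩
  | succ k ih =>
    intro w hw
    have h₁ : Matrix.vecMul (fun i => (w i).coeff 0) (constCoeff I.P) = 0 := by
      funext j
      rw [constCoeff, ← coeff_zero_vecMul, ← hw, pow_succ']
      simp [mul_assoc]
    have h₂ : Matrix.vecMul (fun i => (w i).coeff 0) I.C = 0 := by
      funext j
      have := coeff_vecMul_product hprod w j le_rfl
      rw [if_pos rfl, ← hw, Matrix.smul_vecMul, Pi.smul_apply, smul_eq_mul] at this
      rw [← this]
      -- The approximant p contributes d j factors X, and the power in front at least one more.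
      have hdvd : X ^ (I.d j + 1) ∣ X ^ (k + 1) * Matrix.vecMul p I.F j := by
        rw [add_comm (I.d j) 1, pow_add, pow_one]
        exact mul_dvd_mul (dvd_pow_self X (by omega))
          (X_pow_dvd_iff.2 (mem_approximants_iff.1 hp j))
      exact X_pow_dvd_iff.1 hdvd _ (by omega)
    have h₃ := hrank _ h₁ h₂
    have hX : ∀ i, X ∣ w i := fun i => X_dvd_iff.2 (congrFun h₃ i)
    choose w' hw' using hX
    refine ih w' ?_
    have hww : w = (X : K[X]) • w' := funext hw'
    rw [hww, Matrix.smul_vecMul, pow_succ', mul_smul] at hw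
    funext j
    exact mul_left_cancel₀ X_ne_zero (congrFun hw j)

/-- For the converse, the determinant condition places a power of X times any approximant into the
row space, and full rank removes this power again. -/
theorem isYes_iff : I.IsYes ↔ CertInstance.ProductCorrect I ∧ CertInstance.DetCorrect I ∧
    CertInstance.FullRank I := by
  constructor
  · intro h
    refine ⟨?_, detCorrect_of_isYes h, fullRank_of_isYes h⟩
    rw [productCorrect_iff]
    refine ⟨fun i => ?_, h.2⟩
    rw [← h.1.1.2]
    exact Submodule.subset_span ⟨i, rfl⟩
  · rintro ⟨hprod, ⟨-, hL, hdet⟩, hrank⟩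
    have hdet0 : I.P.det ≠ 0 := by
      rw [hdet]
      exact mul_ne_zero (C_ne_zero.2 hL) (pow_ne_zero _ X_ne_zero)
    obtain ⟨hrows, hC⟩ := productCorrect_iff.1 hprod
    refine ⟨⟨(isRowBasis_iff hdet0).2 fun p => ⟨fun hp => ?_, ?_⟩, ?_⟩, hC⟩
    -- The witness comes from adj(P) P = det P; dividing by det L leaves the bare power of X.
    · refine mem_span_of_pow_smul hprod hrank hp (degreeSum I.s I.P).toNat
        (Matrix.vecMul (C (leadingMatrix I.s I.P).det⁻¹ • p) I.P.adjugate) ?_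
      rw [Matrix.vecMul_vecMul, Matrix.adjugate_mul, hdet, Matrix.vecMul_smul, Matrix.vecMul_one,
        smul_smul, mul_right_comm, ← C_mul, mul_inv_cancel₀ hL, C_1, one_mul]
    · rintro ⟨w, rfl⟩
      rw [Matrix.vecMul_eq_sum]
      exact Submodule.sum_mem _ fun i _ => Submodule.smul_mem _ _ (hrows i)
    · exact (Matrix.isUnit_iff_isUnit_det _).2 (isUnit_iff_ne_zero.2 hL)

/-! ### The tests as polynomial identities -/

theorem detTest_of_detCorrect (h : CertInstance.DetCorrect I) (α : K) :
    CertInstance.DetTest I α := by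
  obtain ⟨h₁, h₂, h₃⟩ := h
  refine ⟨h₁, h₂, ?_⟩
  have := (evalRingHom α).map_det I.P
  rw [h₃] at this
  simpa [RingHom.mapMatrix_apply] using this

/-- The polynomial of which the test for a column takes the value. -/
def columnPoly (I : CertInstance K m n) (u : Fin m → K) (j : Fin n) : K[X] :=
  ∑ t ∈ Finset.range (I.d j + 1), monomial t (∑ i, u i * defect I i j t)

/-- Both sides sum over the pairs (k, e) with k + e ≤ N, on the left by k = N - l and on the right
by k + e. With accumulated inner sums the left side takes O(N) operations, so a product truncated
after degree N is evaluated without computing its coefficients. -/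
theorem sum_range_mul_sum_range (a b : ℕ → K) (N : ℕ) :
    ∑ l ∈ Finset.range (N + 1), a (N - l) * ∑ e ∈ Finset.range (l + 1), b e =
      ∑ t ∈ Finset.range (N + 1), ∑ x ∈ Finset.HasAntidiagonal.antidiagonal t, a x.1 * b x.2 := by
  rw [← Finset.sum_flip]
  have h₁ : ∀ k ∈ Finset.range (N + 1), a (N - (N - k)) * ∑ e ∈ Finset.range (N - k + 1), b e =
      ∑ e ∈ Finset.range (N + 1 - k), a k * b e := by
    intro k hk
    rw [Finset.mem_range] at hk
    rw [Finset.mul_sum, show N - (N - k) = k by omega, show N - k + 1 = N + 1 - k by omega]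
  rw [Finset.sum_congr rfl h₁, ← Finset.sum_range_diag_flip (N + 1) fun k e => a k * b e]
  refine Finset.sum_congr rfl fun t _ => ?_
  rw [Finset.Nat.sum_antidiagonal_eq_sum_range_succ_mk]

/-- The program combines the rows of P before multiplying by F. Interchanging the sums shows that
its result is the value, at the second random element, of the polynomial whose coefficients are the
combined defects. -/
theorem sum_termValue (r : Fin (m + 2) → K) (j : Fin n) :
    ∑ i, termValue I r j i = (columnPoly I (fun i => r i.succ.succ) j).eval (r 1) := by
  have hterm : ∀ i : Fin m, ∑ l ∈ Finset.range (I.d j + 1),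
      combinedCoeff I r i (I.d j - l) * r 1 ^ (I.d j - l) *
        ∑ e ∈ Finset.range (l + 1), (I.F i j).coeff e * r 1 ^ e =
      ∑ t ∈ Finset.range (I.d j + 1), (∑ i' : Fin m,
        r i'.succ.succ * (I.P i' i * I.F i j).coeff t) * r 1 ^ t := by
    intro i
    rw [sum_range_mul_sum_range (fun k => combinedCoeff I r i k * r 1 ^ k)
      (fun e => (I.F i j).coeff e * r 1 ^ e)]
    refine Finset.sum_congr rfl fun t _ => ?_
    simp only [coeff_mul, Finset.mul_sum]
    rw [Finset.sum_comm, Finset.sum_mul]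
    refine Finset.sum_congr rfl fun x hx => ?_
    rw [← Finset.HasAntidiagonal.mem_antidiagonal.1 hx, combinedCoeff, pow_add, Finset.sum_mul, Finset.sum_mul,
      Finset.sum_mul]
    refine Finset.sum_congr rfl fun i' _ => ?_
    ring
  simp only [termValue, hterm, Finset.sum_sub_distrib]
  simp only [columnPoly, eval_finsetSum, eval_monomial, defect, mul_sub, Finset.sum_sub_distrib,
    sub_mul]
  congr 1
  · rw [Finset.sum_comm]
    refine Finset.sum_congr rfl fun t _ => ?_
    rw [← Finset.sum_mul, Finset.sum_comm]
    simp only [Matrix.mul_apply, finsetSum_coeff, Finset.mul_sum]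
  · rw [Finset.sum_eq_single (I.d j)]
    · simp [Finset.sum_mul]
    · intro t _ ht
      simp [ht]
    · simp

theorem columnTest_of_productCorrect (h : CertInstance.ProductCorrect I) (r : Fin (m + 2) → K)
    (j : Fin n) : CertInstance.ColumnTest I r j := by
  rw [CertInstance.ColumnTest, sum_termValue, columnPoly, Finset.sum_eq_zero, eval_zero]
  intro t ht
  rw [Finset.sum_eq_zero, monomial_zero_right]
  intro i _
  rw [h i j t (by rw [Finset.mem_range] at ht; omega), mul_zero]

theorem passes_of_isYes (h : I.IsYes) (r : Fin (m + 2) → K) : CertInstance.Passes I r := by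
  obtain ⟨h₁, h₂, h₃⟩ := isYes_iff.1 h
  exact ⟨columnTest_of_productCorrect h₁ r, detTest_of_detCorrect h₂ _, h₃⟩

/-! ### Counting -/

/-- Counting by fibres of the map that forgets coordinate `i`: the tuples in question map into `T`,
and at most `k` lie over each point of `T`. -/
theorem card_filter_piFinset_le {S : Finset K} {N : ℕ} (i : Fin (N + 1))
    {E : (Fin (N + 1) → K) → Prop} [DecidablePred E] {k : ℕ} (T : Finset (Fin N → K))
    (hT : ∀ a ∈ S, ∀ b ∈ Fintype.piFinset (fun _ : Fin N => S), E (i.insertNth a b) → b ∈ T)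
    (h : ∀ b ∈ T, (S.filter fun a => E (i.insertNth a b)).card ≤ k) :
    ((Fintype.piFinset fun _ : Fin (N + 1) => S).filter E).card ≤ k * T.card := by
  classical
  refine Finset.card_le_mul_card_image_of_maps_to (f := i.removeNth) (fun r hr => ?_) k
    fun b hb => ?_
  · rw [Finset.mem_filter, Fintype.mem_piFinset] at hr
    refine hT (r i) (hr.1 i) _ (Fintype.mem_piFinset.2 fun l => hr.1 _) ?_
    rw [Fin.insertNth_self_removeNth]
    exact hr.2
  · refine le_trans (Finset.card_le_card_of_injOn (fun r => r i) (fun r hr => ?_) ?_) (h b hb)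
    · simp only [Finset.coe_filter, Set.mem_ofPred_eq, Finset.mem_filter, Fintype.mem_piFinset] at hr ⊢
      obtain ⟨⟨h₁, h₂⟩, rfl⟩ := hr
      refine ⟨h₁ i, ?_⟩
      rw [Fin.insertNth_self_removeNth]
      exact h₂
    · intro r hr r' hr' heq
      simp only [Finset.coe_filter, Set.mem_ofPred_eq, Finset.mem_filter] at hr hr'
      rw [← Fin.insertNth_self_removeNth i r, ← Fin.insertNth_self_removeNth i r', hr.2, hr'.2]
      congr 1

theorem card_filter_isRoot_le {S : Finset K} {p : K[X]} (hp : p ≠ 0) {N : ℕ}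
    (hN : p.natDegree ≤ N) {E : K → Prop} [DecidablePred E] (hE : ∀ a, E a → p.eval a = 0) :
    (S.filter E).card ≤ N := by
  classical
  refine le_trans ?_ ((card_roots' p).trans hN)
  refine le_trans (Finset.card_le_card fun a ha => ?_) (Multiset.toFinset_card_le p.roots)
  rw [Multiset.mem_toFinset, mem_roots hp]
  exact hE a (Finset.mem_filter.1 ha).2

open Classical in
-- Passing makes the first random element a root of det L · X^Δ - det P, which is not zero. Its
-- degree is at most σ because Δ ≤ σ is part of the test and Δ bounds the degree of det P.
theorem card_detTest_le (S : Finset K) (h : ¬ CertInstance.DetCorrect I) :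
    ((Fintype.piFinset fun _ : Fin (m + 2) => S).filter
      fun r => CertInstance.DetTest I (r 0)).card ≤ I.sigma * S.card ^ (m + 1) := by
  by_cases hpre : degreeSum I.s I.P ≤ I.sigma ∧ (leadingMatrix I.s I.P).det ≠ 0
  · have hne : C (leadingMatrix I.s I.P).det * X ^ (degreeSum I.s I.P).toNat - I.P.det ≠ 0 := by
      intro h0
      exact h ⟨hpre.1, hpre.2, (sub_eq_zero.1 h0).symm⟩
    refine (card_filter_piFinset_le 0 (Fintype.piFinset fun _ : Fin (m + 1) => S)
      (fun a _ b hb _ => hb) (fun b _ => card_filter_isRoot_le hne (N := I.sigma) ?_ fun a ha => ?_)).trans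
      (le_of_eq (by simp))
    · refine (natDegree_sub_le _ _).trans (max_le ?_ ?_)
      · refine (natDegree_C_mul_X_pow_le _ _).trans ?_
        omega
      · refine (natDegree_det_le I.s I.P).trans ?_
        omega
    · have h₁ := ha.2.2
      have h₂ := (evalRingHom a).map_det I.P
      simp only [Fin.insertNth_zero', Fin.cons_zero] at h₁
      rw [eval_sub, eval_mul, eval_C, eval_pow, eval_X, h₁, sub_eq_zero]
      exact h₂.symm
  · rw [Finset.filter_eq_empty_iff.2]
    · simp
    · exact fun r _ hr => hpre ⟨hr.1, hr.2.1⟩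

theorem columnPoly_coeff (u : Fin m → K) (j : Fin n) {t : ℕ} (ht : t ≤ I.d j) :
    (columnPoly I u j).coeff t = ∑ i, u i * defect I i j t := by
  simp only [columnPoly, finsetSum_coeff, coeff_monomial]
  rw [Finset.sum_ite_eq' (Finset.range (I.d j + 1)) t, if_pos (Finset.mem_range.2 (by omega))]

theorem natDegree_columnPoly_le (u : Fin m → K) (j : Fin n) :
    (columnPoly I u j).natDegree ≤ I.d j := by
  refine natDegree_sum_le_of_forall_le _ _ fun t ht => (natDegree_monomial_le _).trans ?_
  rw [Finset.mem_range] at ht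
  omega

open Classical in
-- Either the random combination cancels the nonzero defect, or it leaves a nonzero polynomial of
-- degree at most `d j` of which the second random element is a root. The first event accounts for
-- at most one and the second for at most `d j` times `S.card ^ (m + 1)` tuples.
theorem card_columnTest_lt {S : Finset K} (hS : 0 < S.card) {i : Fin m} {j : Fin n} {t : ℕ}
    (ht : t ≤ I.d j) (h : defect I i j t ≠ 0) :
    ((Fintype.piFinset fun _ : Fin (m + 2) => S).filter
      fun r => CertInstance.ColumnTest I r j).card < (I.d j + 1) * S.card ^ (m + 1) := by
  set A := Fintype.piFinset fun _ : Fin (m + 2) => S with hA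
  set B := Fintype.piFinset fun _ : Fin (m + 1) => S with hB
  have hBcard : B.card = S.card ^ (m + 1) := by simp [hB]
  set lin : (Fin m → K) → K := fun u => ∑ i', u i' * defect I i' j t with hlin
  set Z := B.filter fun b => lin (fun i' => b i'.succ) = 0 with hZ
  set Y := B.filter fun b => ¬ lin (fun i' => b i'.succ) = 0 with hY
  have hZY : Z.card + Y.card = B.card := Finset.card_filter_add_card_filter_not _
  have hpos : 0 < S.card ^ (m + 1) := by positivity
  have hd := I.d_pos j
  have htail : ∀ (a : K) (b : Fin (m + 1) → K) (i' : Fin m),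
      -- With coordinate 1 removed, `b 0` is the element of the determinant test and the
      -- coefficients of the combination are the `b i'.succ`.
      Fin.insertNth (α := fun _ => K) 1 a b i'.succ.succ = b i'.succ := by
    intro a b i'
    have : (i'.succ.succ : Fin (m + 2)) = Fin.succAbove 1 i'.succ := by
      rw [Fin.succAbove_of_le_castSucc _ _ (by simp [Fin.le_iff_val_le_val])]
    rw [this, Fin.insertNth_apply_succAbove]
  have hone : ∀ (a : K) (b : Fin (m + 1) → K), Fin.insertNth (α := fun _ => K) 1 a b 1 = a :=
    fun a b => Fin.insertNth_apply_same _ _ _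
  have hgood : (A.filter fun r => CertInstance.ColumnTest I r j ∧
      ¬ lin (fun i' => r i'.succ.succ) = 0).card ≤ I.d j * Y.card := by
    refine card_filter_piFinset_le 1 Y (fun a _ b hb hE => ?_) fun b hb => ?_
    · simp only [htail] at hE
      exact Finset.mem_filter.2 ⟨hb, hE.2⟩
    · have hb' := (Finset.mem_filter.1 hb).2
      refine card_filter_isRoot_le (p := columnPoly I (fun i' => b i'.succ) j) (fun h0 => hb' ?_)
        (natDegree_columnPoly_le _ j) fun a ha => ?_
      · exact (columnPoly_coeff _ j ht).symm.trans (by rw [h0, coeff_zero])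
      · have := ha.1
        rw [CertInstance.ColumnTest, sum_termValue, hone] at this
        simpa only [htail] using this
  -- With all other coordinates fixed, the linear form vanishes for at most one value of the
  -- coordinate in front of the nonzero defect.
  have hbad : (A.filter fun r => lin (fun i' => r i'.succ.succ) = 0).card ≤ S.card ^ (m + 1) := by
    refine (card_filter_piFinset_le i.succ.succ (k := 1) B (fun a _ b hb _ => hb)
      fun b _ => ?_).trans (by rw [one_mul, hBcard])
    rw [Finset.card_le_one]
    intro a ha a' ha'
    have h₁ := (Finset.mem_filter.1 ha).2
    have h₂ := (Finset.mem_filter.1 ha').2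
    have hdiff : (a - a') * defect I i j t = 0 := by
      have h₃ := congrArg₂ (· - ·) h₁ h₂
      simp only [hlin, ← Finset.sum_sub_distrib, ← sub_mul, sub_zero] at h₃
      rw [Finset.sum_eq_single i] at h₃
      · simpa using h₃
      · intro i' _ hi'
        have hne : i'.succ.succ ≠ i.succ.succ := by simpa using hi'
        obtain ⟨l, hl⟩ := Fin.exists_succAbove_eq hne
        rw [← hl, Fin.insertNth_apply_succAbove, Fin.insertNth_apply_succAbove, sub_self, zero_mul]
      · simp
    rcases mul_eq_zero.1 hdiff with h₃ | h₃
    · exact sub_eq_zero.1 h₃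
    · exact absurd h₃ h
  have hsplit : (A.filter fun r => CertInstance.ColumnTest I r j).card ≤
      (A.filter fun r => lin (fun i' => r i'.succ.succ) = 0).card +
      (A.filter fun r => CertInstance.ColumnTest I r j ∧
        ¬ lin (fun i' => r i'.succ.succ) = 0).card := by
    refine le_trans (Finset.card_le_card fun r hr => ?_) (Finset.card_union_le _ _)
    rw [Finset.mem_union, Finset.mem_filter, Finset.mem_filter]
    rw [Finset.mem_filter] at hr
    by_cases h0 : lin (fun i' => r i'.succ.succ) = 0
    · exact Or.inl ⟨hr.1, h0⟩
    · exact Or.inr ⟨hr.1, hr.2, h0⟩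
  -- This gives the strict inequality. If no tuple from S cancels the defect, the first count is 0;
  -- otherwise `Y` is smaller than `B`, and as `d j > 0` the second bound is not attained.
  rcases Nat.eq_zero_or_pos Z.card with hZ0 | hZ0
  · have hbad0 : (A.filter fun r => lin (fun i' => r i'.succ.succ) = 0).card = 0 := by
      rw [Finset.card_eq_zero, Finset.filter_eq_empty_iff]
      intro r hr h0
      rw [Finset.card_eq_zero] at hZ0
      have : (fun l : Fin (m + 1) => r l.succ) ∈ Z :=
        Finset.mem_filter.2 ⟨Fintype.mem_piFinset.2 fun l => Fintype.mem_piFinset.1 hr _, h0⟩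
      rw [hZ0] at this
      exact absurd this (Finset.notMem_empty _)
    have : I.d j * Y.card ≤ I.d j * S.card ^ (m + 1) := Nat.mul_le_mul_left _ (by omega)
    rw [add_mul]
    omega
  · have : I.d j * Y.card < I.d j * S.card ^ (m + 1) := Nat.mul_lt_mul_of_pos_left (by omega) hd
    rw [add_mul]
    omega

open Classical in
-- A wrong instance violates one of the three conditions, and the test of that one condition
-- suffices, so the bounds are not added. Lack of full rank never passes; the other two bounds are σ
-- and, strictly, `d j + 1` times `S.card ^ (m + 1)`.
theorem card_passes_lt {S : Finset K} (hS : 2 * (I.sigma + 1) ≤ S.card) (h : ¬ I.IsYes) :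
    2 * ((Fintype.piFinset fun _ : Fin (m + 2) => S).filter
      fun r => CertInstance.Passes I r).card < S.card ^ (m + 2) := by
  have hpos : 0 < S.card := by omega
  have hpow : 0 < S.card ^ (m + 1) := by positivity
  have hmul : 2 * (I.sigma + 1) * S.card ^ (m + 1) ≤ S.card ^ (m + 2) := by
    rw [pow_succ' _ (m + 1)]
    exact Nat.mul_le_mul_right _ hS
  suffices ((Fintype.piFinset fun _ : Fin (m + 2) => S).filter
      fun r => CertInstance.Passes I r).card < (I.sigma + 1) * S.card ^ (m + 1) by
    rw [mul_assoc] at hmul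
    omega
  by_cases hrank : CertInstance.FullRank I
  swap
  · rw [Finset.filter_eq_empty_iff.2 fun r _ hr => hrank hr.2.2]
    simp [hpos]
  by_cases hdet : CertInstance.DetCorrect I
  swap
  · refine lt_of_le_of_lt ((Finset.card_le_card ?_).trans (card_detTest_le S hdet)) ?_
    · exact Finset.monotone_filter_right _ fun r _ hr => hr.2.1
    · rw [add_mul]
      omega
  have hprod : ¬ CertInstance.ProductCorrect I := fun hp => h (isYes_iff.2 ⟨hp, hdet, hrank⟩)
  rw [CertInstance.ProductCorrect] at hprod
  push Not at hprod
  obtain ⟨i, j, t, ht, hne⟩ := hprod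
  have hle : I.d j ≤ I.sigma :=
    Finset.single_le_sum (f := I.d) (fun _ _ => Nat.zero_le _) (Finset.mem_univ j)
  refine lt_of_le_of_lt (Finset.card_le_card ?_) ((card_columnTest_lt hpos ht hne).trans_le
    (Nat.mul_le_mul_right _ (by omega)))
  exact Finset.monotone_filter_right _ fun r _ hr => hr.1 j

/-! ### The cost -/

/-- The cost of an elimination of size `W` is at most this constant times `W ^ ω`. -/
def elimConst (ω κ : ℝ) : ℝ := 3 + (2 * κ + 2) / ((2 : ℝ) ^ (ω - 1) - 2)

theorem two_lt_two_rpow {ω : ℝ} (hω : 2 < ω) : 2 < (2 : ℝ) ^ (ω - 1) := by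
  have := Real.rpow_lt_rpow_of_exponent_lt (x := 2) one_lt_two (show (1 : ℝ) < ω - 1 by linarith)
  simpa using this

theorem three_le_elimConst {ω κ : ℝ} (hω : 2 < ω) (hκ : 0 ≤ κ) : 3 ≤ elimConst ω κ := by
  have h := two_lt_two_rpow hω
  have : 0 ≤ (2 * κ + 2) / ((2 : ℝ) ^ (ω - 1) - 2) := div_nonneg (by linarith) (by linarith)
  rw [elimConst]
  linarith

/-- Put x = 2^(ω-1). The updates at level k cost at most 2(κ + 1) W x^k, so A W x^k is a bound for
the recursion as soon as A (x - 2) ≥ 2κ + 2. This is possible because ω > 2 means x > 2. For k = 0,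
A ≥ 3 covers 2W + 1. -/
theorem blockCost_le {ω κ : ℝ} (hω : 2 < ω) (hκ : 0 ≤ κ) {μ : ℕ → ℕ}
    (hμ : ∀ N : ℕ, 0 < N → (μ N : ℝ) ≤ κ * (N : ℝ) ^ ω) {W : ℕ} (hW : 0 < W) (k : ℕ) :
    (blockCost μ W k : ℝ) ≤ elimConst ω κ * (W * ((2 : ℝ) ^ (ω - 1)) ^ k) := by
  have hx := two_lt_two_rpow hω
  have hA := three_le_elimConst hω hκ
  have hA2 : elimConst ω κ * ((2 : ℝ) ^ (ω - 1) - 2) ≥ 2 * κ + 2 := by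
    rw [elimConst, add_mul, div_mul_cancel₀ _ (by linarith)]
    linarith
  have hW1 : (1 : ℝ) ≤ W := by exact_mod_cast hW
  set x : ℝ := (2 : ℝ) ^ (ω - 1) with hxdef
  set A := elimConst ω κ
  induction k with
  | zero =>
    rw [blockCost, pow_zero, mul_one]
    push_cast
    have : 3 * (W : ℝ) ≤ A * W := mul_le_mul_of_nonneg_right hA (by linarith)
    linarith
  | succ k ih =>
    rw [blockCost]
    push_cast
    have hp : (0 : ℝ) < 2 ^ k := by positivity
    have hdiv : ((W / 2 ^ k : ℕ) : ℝ) ≤ W / 2 ^ k := by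
      have := Nat.cast_div_le (α := ℝ) (m := W) (n := 2 ^ k)
      push_cast at this
      exact this
    have hpow : ((2 : ℝ) ^ k) ^ ω = 2 ^ k * x ^ k := by
      have h2 : (2 : ℝ) ^ ω = 2 * x := by
        rw [hxdef, Real.rpow_sub_one (by norm_num)]
        ring
      rw [← Real.rpow_natCast, ← Real.rpow_mul (by norm_num), mul_comm (k : ℝ) ω,
        Real.rpow_mul (by norm_num), h2, Real.rpow_natCast, Real.rpow_natCast, mul_pow]
    have hμk : (μ (2 ^ k) : ℝ) ≤ κ * (2 ^ k * x ^ k) := by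
      have := hμ (2 ^ k) (by positivity)
      push_cast at this
      rwa [hpow] at this
    have hxk : (2 : ℝ) ^ k ≤ x ^ k := pow_le_pow_left₀ (by norm_num) hx.le k
    have hsum : (μ (2 ^ k) : ℝ) + 2 ^ k * 2 ^ k ≤ (κ + 1) * (2 ^ k * x ^ k) := by
      have : (2 : ℝ) ^ k * 2 ^ k ≤ 2 ^ k * x ^ k := mul_le_mul_of_nonneg_left hxk hp.le
      linarith
    have hprod : ((W / 2 ^ k : ℕ) : ℝ) * ((μ (2 ^ k) : ℝ) + 2 ^ k * 2 ^ k) ≤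
        (κ + 1) * (W * x ^ k) := by
      calc _ ≤ (W / 2 ^ k : ℝ) * ((κ + 1) * (2 ^ k * x ^ k)) :=
            mul_le_mul hdiv hsum (by positivity) (by positivity)
        _ = _ := by field_simp
    have hWx : 0 ≤ W * x ^ k := by positivity
    have hfin := mul_le_mul_of_nonneg_right hA2 hWx
    rw [pow_succ]
    linarith

/-- The constant in the bound for the cost. -/
def costConst (ω κ c : ℝ) : ℝ :=
  4 * max c 0 + 7 + (15 + (2 : ℝ) ^ ω * (2 * elimConst ω κ + 2 * (2 * κ + elimConst ω κ + 1) + 1))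

/-- Everything is compared to m σ and to Q = m^(ω-1) (m + n). The n / W + 2 rounds of the rank test,
at O(W^ω) each, amount to O(n W^(ω-1) + W^ω), and W < 2m turns powers of W into powers of m. -/
theorem certifyCost_le {ω κ : ℝ} (hω : 2 < ω) (hκ : 0 ≤ κ) {μ : ℕ → ℕ}
    (hμ : ∀ N : ℕ, 0 < N → (μ N : ℝ) ≤ κ * (N : ℝ) ^ ω) (hm : 0 < m)
    {I : CertInstance K m n} {l : ℕ} (hl : 2 ^ l < 2 * m) {c : ℝ}
    (hc : (matrixSize I.P : ℝ) ≤ c * ((m : ℝ) * I.sigma)) :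
    (certifyCost μ I l : ℝ) ≤
      costConst ω κ c * ((m : ℝ) * I.sigma + (m : ℝ) ^ (ω - 1) * ((m : ℝ) + n)) := by
  have hm1 : (1 : ℝ) ≤ m := by exact_mod_cast hm
  have hn0 : (0 : ℝ) ≤ n := Nat.cast_nonneg n
  have hs0 : (0 : ℝ) ≤ I.sigma := Nat.cast_nonneg _
  have hA := three_le_elimConst hω hκ
  obtain ⟨W, hWdef⟩ : ∃ W, W = 2 ^ l := ⟨_, rfl⟩
  have hW : 0 < W := by rw [hWdef]; positivity
  have hW1 : (1 : ℝ) ≤ W := by exact_mod_cast hW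
  have hW2 : (W : ℝ) ≤ 2 * m := by
    have : W ≤ 2 * m := by omega
    exact_mod_cast this
  set B : ℝ := (2 : ℝ) ^ ω with hB
  have hB0 : 0 ≤ B := by positivity
  set A := elimConst ω κ with hAdef
  set y : ℝ := (m : ℝ) ^ (ω - 1) with hy
  set z : ℝ := (W : ℝ) ^ (ω - 1) with hz
  have hym : (m : ℝ) ≤ y := by
    have := Real.rpow_le_rpow_of_exponent_le hm1 (show (1 : ℝ) ≤ ω - 1 by linarith)
    simpa using this
  have hzW : (W : ℝ) ≤ z := by
    have := Real.rpow_le_rpow_of_exponent_le hW1 (show (1 : ℝ) ≤ ω - 1 by linarith)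
    simpa using this
  have hWz : (W : ℝ) ^ ω = W * z := by
    rw [hz, Real.rpow_sub_one (by positivity)]
    field_simp
  -- The factor 2^ω in the constant is the price of padding: z ≤ (2m)^(ω-1) = (B / 2) y.
  have hBy : 2 * z ≤ B * y * 1 := by
    have h₁ : z ≤ (2 * (m : ℝ)) ^ (ω - 1) := Real.rpow_le_rpow (by positivity) hW2 (by linarith)
    rw [Real.mul_rpow (by norm_num) (by positivity), Real.rpow_sub_one (by norm_num)] at h₁
    linarith
  have hbc : (blockCost μ W l : ℝ) ≤ A * (W * z) := by
    have := blockCost_le hω hκ hμ hW l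
    have hx : ((2 : ℝ) ^ (ω - 1)) ^ l = z := by
      rw [hz, hWdef, ← Real.rpow_natCast, ← Real.rpow_mul (by norm_num), mul_comm,
        Real.rpow_mul (by norm_num), Real.rpow_natCast]
      push_cast
      rfl
    rwa [hx] at this
  have hμW : (μ W : ℝ) ≤ κ * (W * z) := by
    rw [← hWz]
    exact hμ W hW
  have hWW : (W : ℝ) * W ≤ W * z := mul_le_mul_of_nonneg_left hzW (by linarith)
  have hmz : (W : ℝ) * z ≤ B * (y * m) := by
    have h₁ : (W : ℝ) * z ≤ 2 * m * z := mul_le_mul_of_nonneg_right hW2 (by linarith)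
    have h₂ := mul_le_mul_of_nonneg_right hBy (by linarith : (0 : ℝ) ≤ m)
    linarith
  have hnz : (n : ℝ) * z ≤ B * (y * n) := by
    have h₂ := mul_le_mul_of_nonneg_right hBy hn0
    have h₃ : 0 ≤ n * z := mul_nonneg hn0 (by linarith)
    linarith
  have hdiv : ((n / W : ℕ) : ℝ) * W ≤ n := by
    exact_mod_cast Nat.div_mul_le_self n W
  set D := 2 * κ + A + 1 with hD
  have hD0 : 0 ≤ D := by rw [hD]; linarith
  have hchunk : (((n / W : ℕ) : ℝ) + 2) * (2 * μ W + blockCost μ W l + W * W) ≤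
      D * (2 * (B * (y * (m + n)))) := by
    have h₁ : (2 * μ W + blockCost μ W l + W * W : ℝ) ≤ D * (W * z) := by
      rw [hD]
      linarith
    have h₂ : (((n / W : ℕ) : ℝ) + 2) * (W * z) ≤ n * z + 2 * (W * z) := by
      have := mul_le_mul_of_nonneg_right hdiv (by linarith : 0 ≤ z)
      linarith
    have h₀ : 0 ≤ B * (y * n) := le_trans (mul_nonneg hn0 (by linarith)) hnz
    calc _ ≤ (((n / W : ℕ) : ℝ) + 2) * (D * (W * z)) :=
          mul_le_mul_of_nonneg_left h₁ (by positivity)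
      _ = D * ((((n / W : ℕ) : ℝ) + 2) * (W * z)) := by ring
      _ ≤ D * (2 * (B * (y * (m + n)))) := by
          refine mul_le_mul_of_nonneg_left ?_ hD0
          linarith
  obtain ⟨Q, hQ⟩ : ∃ Q, y * ((m : ℝ) + n) = Q := ⟨_, rfl⟩
  have hyn : 0 ≤ y * n := mul_nonneg (by linarith) hn0
  have hymm : (m : ℝ) * m ≤ y * m := mul_le_mul_of_nonneg_right hym (by linarith)
  have hmmQ : (m : ℝ) * m ≤ Q := by linarith
  have hmnQ : (m : ℝ) * n ≤ Q := by
    have := mul_le_mul_of_nonneg_right hym hn0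
    have : 0 ≤ y * m := mul_nonneg (by linarith) (by linarith)
    linarith
  have hnQ : (n : ℝ) ≤ Q := by
    have := mul_le_mul_of_nonneg_right hm1 hn0
    linarith
  have h1Q : 1 ≤ Q := by
    have := mul_le_mul hm1 hm1 zero_le_one (by linarith)
    linarith
  have hWzQ : (W : ℝ) * z ≤ B * Q := by
    have := mul_le_mul_of_nonneg_left (show y * m ≤ Q by linarith) hB0
    linarith
  have hbcQ : (blockCost μ W l : ℝ) ≤ A * (B * Q) :=
    hbc.trans (mul_le_mul_of_nonneg_left hWzQ (by linarith))
  have hσ : (I.sigma : ℝ) ≤ m * I.sigma := by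
    have := mul_le_mul_of_nonneg_right hm1 hs0
    linarith
  have hmσ : 0 ≤ (m : ℝ) * I.sigma := by positivity
  have hsize : (matrixSize I.P : ℝ) ≤ max c 0 * (m * I.sigma) :=
    hc.trans (mul_le_mul_of_nonneg_right (le_max_left _ _) hmσ)
  rw [hQ] at hchunk ⊢
  rw [certifyCost, ← hWdef]
  push_cast
  -- The size of P occurs four times, and σ or m σ seven times. The 15 collects 8 m n, n, m m and
  -- the constant 5. The multiples of B stand for the two determinants, the rank test and its final
  -- zero test.
  have e : costConst ω κ c = 4 * max c 0 + 7 + (15 + B * (2 * A + 2 * D + 1)) := rfl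
  rw [e]
  have hc0 : 0 ≤ max c 0 := le_max_right _ _
  have h₁ : 0 ≤ (4 * max c 0 + 7) * Q := mul_nonneg (by linarith) (by linarith)
  have h₂ : 0 ≤ (15 + B * (2 * A + 2 * D + 1)) * (m * I.sigma) :=
    mul_nonneg (add_nonneg (by norm_num) (mul_nonneg hB0 (by linarith))) hmσ
  linarith

/-- Costs are natural numbers, so the real bound may be replaced by its floor. That κ is not
negative follows from the case N = 1. -/
theorem multiplies_of_matMulWithin {ω κ : ℝ} (h : MatMulWithin K ω κ) :
    ∃ (mm : Cmd K) (μ : ℕ → ℕ), Multiplies mm μ ∧ 0 ≤ κ ∧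
      ∀ N : ℕ, 0 < N → (μ N : ℝ) ≤ κ * (N : ℝ) ^ ω := by
  obtain ⟨mm, hmm⟩ := h
  have hκ : 0 ≤ κ := by
    obtain ⟨-, t, -, ht, -⟩ := hmm 1 one_pos 1 1
    have : (0 : ℝ) ≤ t := Nat.cast_nonneg t
    simp at ht
    linarith
  refine ⟨mm, fun N => ⌊κ * (N : ℝ) ^ ω⌋₊, fun N hN A B => ?_, hκ, fun N _ => ?_⟩
  · obtain ⟨σ, t, hex, ht, hres⟩ := hmm N hN A B
    exact ⟨σ, t, hex, Nat.le_floor ht, hres⟩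
  · exact Nat.floor_le (by positivity)

end AlgRAM

theorem theorem1p1 (ω : ℝ) (hω : 2 < ω) (κ : ℝ) :
    ∃ Γ : ℝ → ℝ, ∀ (K : Type*) [Field K], AlgRAM.MatMulWithin K ω κ →
      ∃ prog : AlgRAM.Cmd K, ∀ (m n : ℕ), 0 < m → 0 < n → ∀ I : CertInstance K m n,
        -- the program always halts with an answer
        (∀ r : Fin (m + 2) → K, ∃ (b : Bool) (t : ℕ), I.Answers prog r b t) ∧
        -- cost, assuming that the size of `P` is at most a constant `c` times `m σ`
        (∀ c : ℝ, (matrixSize I.P : ℝ) ≤ c * ((m : ℝ) * I.sigma) →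
          ∀ (r : Fin (m + 2) → K) (b : Bool) (t : ℕ), I.Answers prog r b t →
            (t : ℝ) ≤ Γ c * ((m : ℝ) * I.sigma + (m : ℝ) ^ (ω - 1) * ((m : ℝ) + n))) ∧
        -- the answer False is always correct
        (∀ (r : Fin (m + 2) → K) (t : ℕ), I.Answers prog r false t → ¬ I.IsYes) ∧
        -- the answer True is wrong with probability less than 1/2
        (∀ S : Finset K, 2 * (I.sigma + 1) ≤ S.card → ¬ I.IsYes →
          uniformProb S (m + 2) (fun r => ∃ t, I.Answers prog r true t) < 1 / 2) := by
  classical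
  -- The constant is fixed before the field, so it depends on ω, κ and c only.
  refine ⟨AlgRAM.costConst ω κ, fun K _ hmul => ?_⟩
  obtain ⟨mm, μ, hmm, hκ, hμ⟩ := AlgRAM.multiplies_of_matMulWithin hmul
  refine ⟨AlgRAM.certify mm, fun m n hm _ I => ?_⟩
  choose t₀ hcost hans using AlgRAM.answers_certify_iff hmm hm I
  refine ⟨fun r => ?_, fun c hc r b t ht => ?_, fun r t ht hyes => ?_, fun S hS hno => ?_⟩
  · exact ⟨decide (AlgRAM.CertInstance.Passes I r), t₀ r, (hans r _ _).2 ⟨rfl, by simp⟩⟩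
  · obtain ⟨rfl, -⟩ := (hans r b t).1 ht
    obtain ⟨l, -, hl, hle⟩ := hcost r
    exact (Nat.cast_le.2 hle).trans (AlgRAM.certifyCost_le hω hκ hμ hm hl hc)
  · have := ((hans r false t).1 ht).2.2 (AlgRAM.passes_of_isYes hyes r)
    exact absurd this (by simp)
  · have hcard := AlgRAM.card_passes_lt hS hno
    have hev : ∀ r, (∃ t, I.Answers (AlgRAM.certify mm) r true t) ↔
        AlgRAM.CertInstance.Passes I r := by
      intro r
      simp [hans]
    simp only [hev, uniformProb]
    have hpos : (0 : ℝ) < (S.card : ℝ) ^ (m + 2) := by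
      have : 0 < S.card := by omega
      positivity
    rw [div_lt_iff₀ hpos]
    have h₂ : (2 : ℝ) * (((Fintype.piFinset fun _ : Fin (m + 2) => S).filter
        fun r => AlgRAM.CertInstance.Passes I r).card : ℝ) < (S.card : ℝ) ^ (m + 2) := by
      exact_mod_cast hcard
    have h₃ : (((Fintype.piFinset fun _ : Fin (m + 2) => S).filter
        fun r => AlgRAM.CertInstance.Passes I r).card : ℝ) < 1 / 2 * (S.card : ℝ) ^ (m + 2) := by
      linarith
    convert h₃
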